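/- Let $(\tilde L,\Phi,\xi,\eta,g)$ be an almost contact metric manifold, i.e. $\Phi^2=-I+\eta\otimes\xi$, $\eta(\xi)=1$, $\Phi\xi=0$, $\eta\circ\Phi=0$, $g(\Phi X,\Phi Y)=g(X,Y)-\eta(X)\eta(Y)$, and suppose that it is locally conformal almost cosymplectic with smooth function $\beta$, i.e. for all $X,Y$ $$(\tilde\nabla_X\Phi)Y=\beta\big(g(\Phi X,Y)\xi-\eta(Y)\Phi X\big),\qquad \tilde\nabla_X\xi=\beta\big(X-\eta(X)\xi\big),$$ where $\tilde\nabla$ is the Levi-Civita connection of $g$. Let $L_\nu,L_T,L_\perp$ be Riemannian manifolds with metrics $g_\nu,g_T,g_\perp$, let $\phi_1,\phi_2:L_\nu\to(0,\infty)$ be smooth, and let $L=L_\nu\times_{\phi_1}L_T\times_{\phi_2}L_\perp$ be the product manifold with the bi-warped product metric $g_\nu+\phi_1^2g_T+\phi_2^2g_\perp$, isometrically immersed in $\tilde L$, with second fundamental form $\Sigma$. Assume that the copies of $L_\nu$, $L_T$, $L_\perp$ in $L$ are submanifolds of $\tilde L$ of the following types: * each copy of $L_\nu$ is tangent to $\xi$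 and proper slant with one and the same angle $\nu\in[0,\pi/2]$: for every tangent vector $X$ of $L_\nu$ linearly independent of $\xi$ the angle between $\Phi X$ and the tangent space of $L_\nu$ is $\nu$, and $L_\nu$ is neither invariant nor anti-invariant; * each copy of $L_T$ is invariant, $\Phi(TL_T)\subseteq TL_T$; * each copy of $L_\perp$ is anti-invariant, $\Phi(TL_\perp)\subseteq T^\perp L_\perp$. Let $\mathfrak D^\perp=TL_\perp$ and let $\mathfrak D^\nu$ be the orthogonal complement of $\xi$ in $TL_\nu$; assume that $L$ is $\mathfrak D^\perp$–$\mathfrak D^\nu$ mixed totally geodesic, i.e. $\Sigma(Z,U)=0$ for $Z\in\mathfrak D^\perp$, $U\in\mathfrak D^\nu$. Put $n_1=\dim L_T$, $n_2=\dim L_\perp$. Then: (i) At every point of $L$ $$\|\Sigma\|^2\ \ge\ n_1(1+\cot^2\nu)(1+\cos^2\nu)\big(\|\vec\nabla(\ln\phi_1)\|^2-\beta^2\big)+n_2(\csc^2\nu-1)\big(\|\vec\nabla(\ln\phi_2)\|^2-\beta^2\big),$$ where $\|\Sigma\|^2=\sum_{i,j}g(\Sigma(e_i,e_j),\Sigma(e_i,e_j))$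 for an orthonormal frame $(e_i)$ of $L$, and $\vec\nabla(\ln\phi_i)$ is the gradient of $\ln\phi_i$ on $L_\nu$. (ii) If equality holds in (i) at every point of $L$, then every copy of $L_\nu$ is a totally geodesic submanifold of $\tilde L$, every copy of $L_T$ and every copy of $L_\perp$ is a totally umbilical submanifold of $\tilde L$, and $L$ is $\mathfrak D^\nu$-totally geodesic, i.e. $\Sigma(U,V)=0$ for $U,V\in\mathfrak D^\nu$. -/

import Mathlib

open Bundle Module
open scoped Manifold ContDiff InnerProductSpace

noncomputable section

namespace BiWarped

section Riemannian

variable {E : Type*} [NormedAddCommGroup E] [NormedSpace ℝ E] [FiniteDimensional ℝ E]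
  {H : Type*} [TopologicalSpace H] (I : ModelWithCorners ℝ E H)
  {M : Type*} [TopologicalSpace M] [ChartedSpace H M]

instance tangentSpaceFiniteDimensional (x : M) : FiniteDimensional ℝ (TangentSpace I x) :=
  inferInstanceAs (FiniteDimensional ℝ E)

/-- The coordinate vector field with constant components `v` in the preferred chart at `x`
(the tangent space at `x` is identified with `E` by this chart, so that its value at `x` is `v`).
It is meaningful near `x`. -/
def coordField (x : M) (v : TangentSpace I x) : Π y : M, TangentSpace I y :=
  VectorField.mpullback I 𝓘(ℝ, E) (extChartAt I x) (fun _ => (v : E))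

variable [RiemannianBundle (fun x : M => TangentSpace I x)]

/-- The derivative at `x` in the direction `u` of the metric coefficient `g(∂_v, ∂_w)` in the
preferred chart at `x`. -/
def metricDeriv (x : M) (u v w : TangentSpace I x) : ℝ :=
  mfderiv I 𝓘(ℝ, ℝ) (fun y => ⟪coordField I x v y, coordField I x w y⟫_ℝ) x u

/-- The Christoffel symbol at `x` of the Levi-Civita connection, in the preferred chart at `x`:
`Γ(v, w)` is the vector with
`2 g(Γ(v, w), z) = D_v g(∂_w, ∂_z) + D_w g(∂_v, ∂_z) - D_z g(∂_v, ∂_w)` for all `z`. -/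
def christoffel (x : M) (v w : TangentSpace I x) : TangentSpace I x :=
  ∑ k, ((1 / 2 : ℝ) *
      (metricDeriv I x v w (stdOrthonormalBasis ℝ (TangentSpace I x) k)
        + metricDeriv I x w v (stdOrthonormalBasis ℝ (TangentSpace I x) k)
        - metricDeriv I x (stdOrthonormalBasis ℝ (TangentSpace I x) k) v w)) •
    stdOrthonormalBasis ℝ (TangentSpace I x) k

variable {E' : Type*} [NormedAddCommGroup E'] [NormedSpace ℝ E']
  {H' : Type*} [TopologicalSpace H'] (J : ModelWithCorners ℝ E' H')
  {N : Type*} [TopologicalSpace N] [ChartedSpace H' N]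

/-- The Levi-Civita covariant derivative at `p`, in the direction `u`, of a vector field `V` along
a map `ι : N → M`: in the preferred chart at `ι p` it is `D_u V + Γ(dι u, V p)`. -/
def covDerivAlong (ι : N → M) (V : Π q : N, TangentSpace I (ι q)) (p : N)
    (u : TangentSpace J p) : TangentSpace I (ι p) :=
  let DV : E := mfderiv J 𝓘(ℝ, E)
    (fun q => (mfderiv I 𝓘(ℝ, E) (extChartAt I (ι p)) (ι q) (V q) : E)) p u
  let DV' : TangentSpace I (ι p) := DV
  DV' + christoffel I (ι p) (mfderiv J I ι p u) (V p)

/-- The Levi-Civita covariant derivative `∇_u V` at `x` of a vector field `V` on `M`. -/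
def covDeriv (V : Π y : M, TangentSpace I y) (x : M) (u : TangentSpace I x) : TangentSpace I x :=
  covDerivAlong I I id V x u

/-- The tangent space at `p` of an immersed submanifold `ι : N → M`, inside `T_{ι p} M`. -/
def tangentImage (ι : N → M) (p : N) : Submodule ℝ (TangentSpace I (ι p)) :=
  LinearMap.range (mfderiv J I ι p).toLinearMap

/-- The second fundamental form of an immersed submanifold `ι : N → M` (with the induced metric):
the normal component of `∇_u (dι W)`, for a vector field `W` of `N` with `W p = w`. -/
def secondFundForm (ι : N → M) (p : N) (u w : TangentSpace J p) : TangentSpace I (ι p) :=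
  (tangentImage I J ι p)ᗮ.starProjection
    (covDerivAlong I J ι (fun q => mfderiv J I ι q (coordField J p w q)) p u)

/-- An orthonormal frame of `T_p N` for the metric induced by the immersion `ι`. -/
def inducedFrame (ι : N → M) (p : N) (i : Fin (finrank ℝ (tangentImage I J ι p))) :
    TangentSpace J p :=
  Function.invFun (mfderiv J I ι p)
    (stdOrthonormalBasis ℝ (tangentImage I J ι p) i : TangentSpace I (ι p))

/-- The squared norm `‖Σ‖² = ∑ i j, g(Σ(e_i, e_j), Σ(e_i, e_j))` of the second fundamental form. -/
def secondFundFormNormSq (ι : N → M) (p : N) : ℝ :=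
  ∑ i, ∑ j, ⟪secondFundForm I J ι p (inducedFrame I J ι p i) (inducedFrame I J ι p j),
    secondFundForm I J ι p (inducedFrame I J ι p i) (inducedFrame I J ι p j)⟫_ℝ

/-- The mean curvature vector `H = (1 / n) ∑ i, Σ(e_i, e_i)`. -/
def meanCurvature (ι : N → M) (p : N) : TangentSpace I (ι p) :=
  (1 / (finrank ℝ (tangentImage I J ι p) : ℝ)) •
    ∑ i, secondFundForm I J ι p (inducedFrame I J ι p i) (inducedFrame I J ι p i)

/-- The immersed submanifold `ι` is totally geodesic: `Σ = 0`. -/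
def IsTotallyGeodesic (ι : N → M) : Prop :=
  ∀ (p : N) (u w : TangentSpace J p), secondFundForm I J ι p u w = 0

/-- The immersed submanifold `ι` is totally umbilical: `Σ(u, w) = g(u, w) H`. -/
def IsTotallyUmbilical (ι : N → M) : Prop :=
  ∀ (p : N) (u w : TangentSpace J p), secondFundForm I J ι p u w =
    ⟪mfderiv J I ι p u, mfderiv J I ι p w⟫_ℝ • meanCurvature I J ι p

/-- The squared norm `∑ i, (e_i φ)²` of the gradient of `φ` at `x`, for an orthonormal basis
`(e_i)` of `T_x M`. -/
def gradNormSq (φ : M → ℝ) (x : M) : ℝ :=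
  ∑ i,
    let d : ℝ := mfderiv I 𝓘(ℝ, ℝ) φ x (stdOrthonormalBasis ℝ (TangentSpace I x) i)
    d ^ 2

end Riemannian

section AlmostContact

variable (E : Type*) [NormedAddCommGroup E] [NormedSpace ℝ E] [FiniteDimensional ℝ E]
  (M : Type*) [TopologicalSpace M] [ChartedSpace E M] [IsManifold 𝓘(ℝ, E) ∞ M]
  [RiemannianBundle (fun x : M => TangentSpace 𝓘(ℝ, E) x)]

/-- An almost contact metric structure `(Φ, ξ, η, g)`, where `g` is the given Riemannian metric
on `M`. -/
structure AlmostContactMetric where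
  Φ : Π x : M, TangentSpace 𝓘(ℝ, E) x →L[ℝ] TangentSpace 𝓘(ℝ, E) x
  ξ : Π x : M, TangentSpace 𝓘(ℝ, E) x
  η : Π x : M, TangentSpace 𝓘(ℝ, E) x →L[ℝ] ℝ
  smooth_Φ : ContMDiff 𝓘(ℝ, E) (𝓘(ℝ, E).prod 𝓘(ℝ, E →L[ℝ] E)) ∞
    (fun x : M => TotalSpace.mk' (E →L[ℝ] E)
      (E := fun x : M => TangentSpace 𝓘(ℝ, E) x →L[ℝ] TangentSpace 𝓘(ℝ, E) x) x (Φ x))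
  smooth_ξ : ContMDiff 𝓘(ℝ, E) (𝓘(ℝ, E).prod 𝓘(ℝ, E)) ∞
    (fun x : M => TotalSpace.mk' E (E := fun x : M => TangentSpace 𝓘(ℝ, E) x) x (ξ x))
  smooth_η : ContMDiff 𝓘(ℝ, E) (𝓘(ℝ, E).prod 𝓘(ℝ, E →L[ℝ] ℝ)) ∞
    (fun x : M => TotalSpace.mk' (E →L[ℝ] ℝ)
      (E := fun x : M => TangentSpace 𝓘(ℝ, E) x →L[ℝ] Bundle.Trivial M ℝ x) x (η x))
  Φ_Φ : ∀ x v, Φ x (Φ x v) = -v + η x v • ξ x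
  η_ξ : ∀ x, η x (ξ x) = 1
  Φ_ξ : ∀ x, Φ x (ξ x) = 0
  η_Φ : ∀ x v, η x (Φ x v) = 0
  inner_Φ_Φ : ∀ x v w, ⟪Φ x v, Φ x w⟫_ℝ = ⟪v, w⟫_ℝ - η x v * η x w

variable {E M}

namespace AlmostContactMetric

/-- `(M, Φ, ξ, η, g)` is locally conformal almost cosymplectic with function `β`:
`(∇_X Φ) Y = β (g(Φ X, Y) ξ - η(Y) Φ X)` and `∇_X ξ = β (X - η(X) ξ)`, where
`(∇_X Φ) Y = ∇_X (Φ Y) - Φ (∇_X Y)`. -/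
structure IsLocallyConformalAlmostCosymplectic (S : AlmostContactMetric E M) (β : M → ℝ) :
    Prop where
  smooth_β : ContMDiff 𝓘(ℝ, E) 𝓘(ℝ, ℝ) ∞ β
  cov_Φ : ∀ (x : M) (X : TangentSpace 𝓘(ℝ, E) x) (Y : Π y : M, TangentSpace 𝓘(ℝ, E) y),
    ContMDiffAt 𝓘(ℝ, E) (𝓘(ℝ, E).prod 𝓘(ℝ, E)) ∞
      (fun y : M => TotalSpace.mk' E (E := fun x : M => TangentSpace 𝓘(ℝ, E) x) y (Y y)) x →
    covDeriv 𝓘(ℝ, E) (fun y => S.Φ y (Y y)) x X - S.Φ x (covDeriv 𝓘(ℝ, E) Y x X) =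
      β x • (⟪S.Φ x X, Y x⟫_ℝ • S.ξ x - S.η x (Y x) • S.Φ x X)
  cov_ξ : ∀ (x : M) (X : TangentSpace 𝓘(ℝ, E) x),
    covDeriv 𝓘(ℝ, E) S.ξ x X = β x • (X - S.η x X • S.ξ x)

variable (S : AlmostContactMetric E M)
  (E' : Type*) [NormedAddCommGroup E'] [NormedSpace ℝ E']
  {N : Type*} [TopologicalSpace N] [ChartedSpace E' N]

/-- The submanifold `ι` is invariant: `Φ (TN) ⊆ TN`. -/
def IsInvariant (ι : N → M) : Prop :=
  ∀ p, ∀ v ∈ tangentImage 𝓘(ℝ, E) 𝓘(ℝ, E') ι p,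
    S.Φ (ι p) v ∈ tangentImage 𝓘(ℝ, E) 𝓘(ℝ, E') ι p

/-- The submanifold `ι` is anti-invariant: `Φ (TN) ⊆ T^⊥ N`. -/
def IsAntiInvariant (ι : N → M) : Prop :=
  ∀ p, ∀ v ∈ tangentImage 𝓘(ℝ, E) 𝓘(ℝ, E') ι p,
    S.Φ (ι p) v ∈ (tangentImage 𝓘(ℝ, E) 𝓘(ℝ, E') ι p)ᗮ

/-- `ξ` is tangent to the submanifold `ι`. -/
def IsTangentToReeb (ι : N → M) : Prop :=
  ∀ p, S.ξ (ι p) ∈ tangentImage 𝓘(ℝ, E) 𝓘(ℝ, E') ι p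

/-- The submanifold `ι` is tangent to `ξ` and slant with slant angle `ν ∈ [0, π / 2]`: for every
tangent vector `X` linearly independent of `ξ`, the angle between `Φ X` and the tangent space (that
is, between `Φ X` and its orthogonal projection to the tangent space) is `ν`. -/
def IsSlant (ι : N → M) (ν : ℝ) : Prop :=
  S.IsTangentToReeb E' ι ∧ ν ∈ Set.Icc 0 (Real.pi / 2) ∧
  ∀ p, ∀ X ∈ tangentImage 𝓘(ℝ, E) 𝓘(ℝ, E') ι p, LinearIndependent ℝ ![X, S.ξ (ι p)] →
    InnerProductGeometry.angle (S.Φ (ι p) X)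
      ((tangentImage 𝓘(ℝ, E) 𝓘(ℝ, E') ι p).starProjection (S.Φ (ι p) X)) = ν

/-- The submanifold `ι` is proper slant: slant, but neither invariant nor anti-invariant. -/
def IsProperSlant (ι : N → M) (ν : ℝ) : Prop :=
  S.IsSlant E' ι ν ∧ ¬ S.IsInvariant E' ι ∧ ¬ S.IsAntiInvariant E' ι

end AlmostContactMetric

end AlmostContact

section Product

variable {E : Type*} [NormedAddCommGroup E] [NormedSpace ℝ E] [FiniteDimensional ℝ E]
  {M : Type*} [TopologicalSpace M] [ChartedSpace E M] [IsManifold 𝓘(ℝ, E) ∞ M]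
  [RiemannianBundle (fun x : M => TangentSpace 𝓘(ℝ, E) x)]
  {E₁ : Type*} [NormedAddCommGroup E₁] [NormedSpace ℝ E₁]
  {L₁ : Type*} [TopologicalSpace L₁] [ChartedSpace E₁ L₁]
  {E₂ : Type*} [NormedAddCommGroup E₂] [NormedSpace ℝ E₂]
  {L₂ : Type*} [TopologicalSpace L₂] [ChartedSpace E₂ L₂]
  {E₃ : Type*} [NormedAddCommGroup E₃] [NormedSpace ℝ E₃]
  {L₃ : Type*} [TopologicalSpace L₃] [ChartedSpace E₃ L₃]

/-- The model with corners of the product of three (boundaryless) manifolds. -/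
abbrev prodModel (E₁ E₂ E₃ : Type*) [NormedAddCommGroup E₁] [NormedSpace ℝ E₁]
    [NormedAddCommGroup E₂] [NormedSpace ℝ E₂] [NormedAddCommGroup E₃] [NormedSpace ℝ E₃] :
    ModelWithCorners ℝ (E₁ × E₂ × E₃) (ModelProd E₁ (ModelProd E₂ E₃)) :=
  𝓘(ℝ, E₁).prod (𝓘(ℝ, E₂).prod 𝓘(ℝ, E₃))

/-- The tangent vector `(u, x, z)` of a product at `p`. -/
def tangentTriple (p : L₁ × L₂ × L₃) (u : TangentSpace 𝓘(ℝ, E₁) p.1)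
    (x : TangentSpace 𝓘(ℝ, E₂) p.2.1) (z : TangentSpace 𝓘(ℝ, E₃) p.2.2) :
    TangentSpace (prodModel E₁ E₂ E₃) p :=
  ((u, x, z) : E₁ × E₂ × E₃)

/-- The leaf `L₁ × {b} × {c}` of `f : L₁ × L₂ × L₃ → M`. -/
def leaf₁ (f : L₁ × L₂ × L₃ → M) (b : L₂) (c : L₃) : L₁ → M := fun a => f (a, b, c)

/-- The leaf `{a} × L₂ × {c}` of `f : L₁ × L₂ × L₃ → M`. -/
def leaf₂ (f : L₁ × L₂ × L₃ → M) (a : L₁) (c : L₃) : L₂ → M := fun b => f (a, b, c)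

/-- The leaf `{a} × {b} × L₃` of `f : L₁ × L₂ × L₃ → M`. -/
def leaf₃ (f : L₁ × L₂ × L₃ → M) (a : L₁) (b : L₂) : L₃ → M := fun c => f (a, b, c)

/-- `f` makes the bi-warped product `L₁ ×_{φ₁} L₂ ×_{φ₂} L₃`, whose metric is
`g₁ + φ₁² g₂ + φ₂² g₃`, an isometrically immersed submanifold of `M`. -/
structure IsBiWarpedProductSubmanifold
    [RiemannianBundle (fun x : L₁ => TangentSpace 𝓘(ℝ, E₁) x)]
    [RiemannianBundle (fun x : L₂ => TangentSpace 𝓘(ℝ, E₂) x)]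
    [RiemannianBundle (fun x : L₃ => TangentSpace 𝓘(ℝ, E₃) x)]
    (f : L₁ × L₂ × L₃ → M) (φ₁ φ₂ : L₁ → ℝ) : Prop where
  smooth_f : ContMDiff (prodModel E₁ E₂ E₃) 𝓘(ℝ, E) ∞ f
  smooth_φ₁ : ContMDiff 𝓘(ℝ, E₁) 𝓘(ℝ, ℝ) ∞ φ₁
  smooth_φ₂ : ContMDiff 𝓘(ℝ, E₁) 𝓘(ℝ, ℝ) ∞ φ₂
  pos_φ₁ : ∀ a, 0 < φ₁ a
  pos_φ₂ : ∀ a, 0 < φ₂ a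
  isometric : ∀ (p : L₁ × L₂ × L₃) (u u' : TangentSpace 𝓘(ℝ, E₁) p.1)
    (x x' : TangentSpace 𝓘(ℝ, E₂) p.2.1) (z z' : TangentSpace 𝓘(ℝ, E₃) p.2.2),
    ⟪mfderiv (prodModel E₁ E₂ E₃) 𝓘(ℝ, E) f p (tangentTriple p u x z),
      mfderiv (prodModel E₁ E₂ E₃) 𝓘(ℝ, E) f p (tangentTriple p u' x' z')⟫_ℝ =
      ⟪u, u'⟫_ℝ + φ₁ p.1 ^ 2 * ⟪x, x'⟫_ℝ + φ₂ p.1 ^ 2 * ⟪z, z'⟫_ℝ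

/-- The distribution `D^ν` at `p`: the vectors tangent to the first factor and orthogonal
to `ξ`, so that `TL = D ⊕ D^⊥ ⊕ D^ν ⊕ ⟨ξ⟩` if `ξ` is tangent to the first factor. -/
def slantDistribution (S : AlmostContactMetric E M) (f : L₁ × L₂ × L₃ → M) (p : L₁ × L₂ × L₃) :
    Set (TangentSpace (prodModel E₁ E₂ E₃) p) :=
  {v | (∃ u, v = tangentTriple p u 0 0) ∧
    ⟪mfderiv (prodModel E₁ E₂ E₃) 𝓘(ℝ, E) f p v, S.ξ (f p)⟫_ℝ = 0}

/-- The distribution `D^⊥` at `p`: the vectors tangent to the third factor. -/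
def antiInvariantDistribution (p : L₁ × L₂ × L₃) : Set (TangentSpace (prodModel E₁ E₂ E₃) p) :=
  {v | ∃ z, v = tangentTriple p 0 0 z}

/-- `L` is `D^⊥`-`D^ν` mixed totally geodesic: `Σ(Z, U) = 0` for `Z` in `D^⊥`, `U` in `D^ν`. -/
def IsMixedTotallyGeodesic (S : AlmostContactMetric E M) (f : L₁ × L₂ × L₃ → M) : Prop :=
  ∀ p, ∀ Z ∈ antiInvariantDistribution (E₁ := E₁) (E₂ := E₂) (E₃ := E₃) p,
    ∀ U ∈ slantDistribution (E₁ := E₁) (E₂ := E₂) (E₃ := E₃) S f p,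
    secondFundForm 𝓘(ℝ, E) (prodModel E₁ E₂ E₃) f p Z U = 0

/-- `L` is `D^ν`-totally geodesic: `Σ(U, V) = 0` for `U`, `V` in `D^ν`. -/
def IsSlantTotallyGeodesic (S : AlmostContactMetric E M) (f : L₁ × L₂ × L₃ → M) : Prop :=
  ∀ p, ∀ U ∈ slantDistribution (E₁ := E₁) (E₂ := E₂) (E₃ := E₃) S f p,
    ∀ V ∈ slantDistribution (E₁ := E₁) (E₂ := E₂) (E₃ := E₃) S f p,
    secondFundForm 𝓘(ℝ, E) (prodModel E₁ E₂ E₃) f p U V = 0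

end Product

end BiWarped

end

open BiWarped

/-!
The argument rests on comparing, at a point of `L`, the second derivatives `∇_s (df w)` of the
immersion `f` with the almost contact structure. Their components tangent to `L` are the Christoffel
symbols of the bi-warped product metric, which the Koszul formula expresses through the derivatives
of `ln φ₁` and `ln φ₂` (lemmas `christoffelFirst…`); they are symmetric in `s` and `w`; and the
identities for `∇Φ` and `∇ξ` extend to vector fields along `f`, so that they can be inserted when a
scalar function such as `⟪Φ V, W⟫` on `L` is differentiated.

*The invariant factor.* Differentiating `⟪Φ U, X⟫ = 0` along `L_T` gives
`(U (ln φ₁) - β η(U)) ⟪Φ Y, X⟫ + ⟪Φ U, ∇_Y X⟫ = 0`. The second summand is symmetric in `X` and `Y`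
and the first one is skew, so both vanish: `d (ln φ₁) = β η` on `L_ν` unless `L_T` is a point
(`mvfderiv_log_φ₁`). Hence `‖grad (ln φ₁)‖² = β²`, and the first term of the inequality is zero.

*The slant factor.* Let `T U` be the component of `Φ U` tangent to the leaf of `L_ν`. The slant
condition says `|T U|² = cos² ν (|U|² - η(U)²)` (`inner_slantOperator_self`), and properness says
that neither `cos ν` nor `sin ν` is zero.

*The third factor.* Unless `L_⊥` is a point, `ξ (ln φ₂) = β`, so that `G = grad (ln φ₂) - β ξ` is
orthogonal to `ξ` and `|G|² = ‖grad (ln φ₂)‖² - β²`. Put `U = T G`; it is orthogonal to `ξ` and to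
`grad (ln φ₂)`, and `(T U) (ln φ₂) = -|U|²`. The length of `T U` stays constant when the point moves
along the leaf of `L_⊥`; with the mixed totally geodesic condition its derivative in the direction
`Z` is `(T U) (ln φ₂) ⟪Φ U, Z⟫` up to a factor. Hence, if `G ≠ 0`, `Φ U` is orthogonal to `L_⊥`
along a neighbourhood in this leaf, and differentiating `⟪Φ U, W⟫ = 0` gives `⟪Φ U, ∇_Z W⟫ = 0`.
The vector
`h = -(Φ U - T U) / sin² ν` is then normal to `L`, with `⟪Σ(Z, W), h⟫ = ⟪Z, W⟫ |h|²` and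
`|h|² = cot² ν |G|²` (`exists_normal_of_third_factor`).

*The inequality.* It follows that `‖Σ‖² = n₂ |h|² + ‖Σ - ⟪·, ·⟫_⊥ h‖²`
(`secondFundFormNormSq_eq_add`), where `⟪·, ·⟫_⊥` is the part of the metric coming from `L_⊥`. This
is the inequality, and equality forces `Σ = ⟪·, ·⟫_⊥ h`. The second fundamental forms of the leaves
are then read off from the Christoffel symbols: the leaves of `L_T` have mean curvature vector
`-grad (ln φ₁)`, those of `L_⊥` have mean curvature vector `h - grad (ln φ₂)`.
-/

set_option linter.unusedSectionVars false

noncomputable section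

namespace BiWarped
open Filter Topology

/-! ### Coordinate fields of the preferred charts -/

section Chart
variable {E : Type*} [NormedAddCommGroup E] [NormedSpace ℝ E]
  {H : Type*} [TopologicalSpace H] (I : ModelWithCorners ℝ E H)
  {M : Type*} [TopologicalSpace M] [ChartedSpace H M]

/-- The components, in the preferred chart at `x`, of tangent vectors at `y`. -/
def components (x y : M) : TangentSpace I y →L[ℝ] E := mvfderiv I (extChartAt I x) y

/-- The identification of the model space with the tangent space at `x` by the preferred chart. -/
def ofModel (x : M) : E →L[ℝ] TangentSpace I x := ContinuousLinearMap.id ℝ E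

/-- The inverse of `ofModel`. -/
def toModel (x : M) : TangentSpace I x →L[ℝ] E := ContinuousLinearMap.id ℝ E

lemma components_self [IsManifold I 1 M] (x : M) (v : TangentSpace I x) :
    components I x x v = v := by
  have := mfderiv_extChartAt_self (I := I) (x := x)
  exact congrArg (fun L => L v) this

lemma components_coordField [IsManifold I 1 M] {x y : M} (hy : y ∈ (extChartAt I x).source)
    (v : TangentSpace I x) : components I x y (coordField I x v y) = v := by
  have h := isInvertible_mfderiv_extChartAt hy
  exact congrArg (fun L => L v) h.self_comp_inverse

/-- `coordField`, as a linear function of the constant components. -/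
def coordFieldL (x y : M) : E →L[ℝ] TangentSpace I y :=
  (mfderiv I 𝓘(ℝ, E) (extChartAt I x) y).inverse

lemma coordField_components [IsManifold I 1 M] {x y : M} (hy : y ∈ (extChartAt I x).source)
    (v : TangentSpace I y) : coordFieldL I x y (components I x y v) = v := by
  have h := isInvertible_mfderiv_extChartAt hy
  exact congrArg (fun L => L v) h.inverse_comp_self

lemma coordField_self [IsManifold I 1 M] (x : M) (v : TangentSpace I x) :
    coordField I x v x = v := by
  have := components_coordField I (mem_extChartAt_source (I := I) x) v
  rwa [components_self] at this

lemma contMDiffAt_const_model (x₀ : E) (v : E) :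
    ContMDiffAt 𝓘(ℝ, E) (𝓘(ℝ, E).prod 𝓘(ℝ, E)) ∞
      (fun y : E => TotalSpace.mk' E (E := fun x : E => TangentSpace 𝓘(ℝ, E) x) y v) x₀ := by
  exact contMDiffAt_vectorSpace_iff_contDiffAt.2 contDiffAt_const

lemma contMDiffAt_coordField [FiniteDimensional ℝ E] [IsManifold I ∞ M] (x : M)
    (v : TangentSpace I x) :
    ContMDiffAt I (I.prod 𝓘(ℝ, E)) ∞
      (fun y : M => TotalSpace.mk' E (E := fun x : M => TangentSpace I x) y (coordField I x v y))
      x := by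
  have := FiniteDimensional.complete ℝ E
  refine ContMDiffAt.mpullback_vectorField_preimage (n := ∞) (m := ∞) ?_ ?_ ?_ (by simp)
  · exact contMDiffAt_const_model (E := E) _ (v : E)
  · exact contMDiffAt_extChartAt
  · exact isInvertible_mfderiv_extChartAt (mem_extChartAt_source x)

end Chart

/-! ### Derivatives of functions and vector fields along a map -/

section Along
variable {E : Type*} [NormedAddCommGroup E] [NormedSpace ℝ E]
  {H : Type*} [TopologicalSpace H] (I : ModelWithCorners ℝ E H)
  {M : Type*} [TopologicalSpace M] [ChartedSpace H M]
  {E' : Type*} [NormedAddCommGroup E'] [NormedSpace ℝ E']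
  {H' : Type*} [TopologicalSpace H'] (J : ModelWithCorners ℝ E' H')
  {N : Type*} [TopologicalSpace N] [ChartedSpace H' N]

variable {I J}

lemma mvfderiv_sum_smul {F : Type*} [NormedAddCommGroup F] [NormedSpace ℝ F] {κ : Type*}
    (s : Finset κ) {a : κ → N → ℝ} {b : κ → N → F} {p : N}
    (ha : ∀ i, MDifferentiableAt J 𝓘(ℝ, ℝ) (a i) p)
    (hb : ∀ i, MDifferentiableAt J 𝓘(ℝ, F) (b i) p) (u : TangentSpace J p) :
    MDifferentiableAt J 𝓘(ℝ, F) (fun q => ∑ i ∈ s, a i q • b i q) p ∧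
    mvfderiv J (fun q => ∑ i ∈ s, a i q • b i q) p u =
      ∑ i ∈ s, (mvfderiv J (a i) p u • b i p + a i p • mvfderiv J (b i) p u) := by
  classical
  induction s using Finset.induction_on with
  | empty =>
    simp only [Finset.sum_empty]
    exact ⟨mdifferentiableAt_const, by rw [mvfderiv_const]; rfl⟩
  | insert i s hi ih =>
    have h1 : MDifferentiableAt J 𝓘(ℝ, F) (fun q => a i q • b i q) p := (ha i).smul (hb i)
    simp only [Finset.sum_insert hi]
    refine ⟨h1.add ih.1, ?_⟩
    rw [mvfderiv_fun_add h1 ih.1, mvfderiv_fun_smul (ha i) (hb i)]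
    simp only [add_apply, ih.2, smul_apply,
      ContinuousLinearMap.smulRight_apply]
    rw [add_comm (a i p • _)]

lemma mvfderiv_comp_along {F : Type*} [NormedAddCommGroup F] [NormedSpace ℝ F] {ι : N → M}
    {g : M → F} {p : N} (hg : MDifferentiableAt I 𝓘(ℝ, F) g (ι p))
    (hι : MDifferentiableAt J I ι p) (u : TangentSpace J p) :
    mvfderiv J (fun q => g (ι q)) p u = mvfderiv I g (ι p) (mfderiv J I ι p u) :=
  congrArg (fun L => L u) (mfderiv_comp p hg hι)

lemma eventually_mvfderiv_congr {F : Type*} [NormedAddCommGroup F] [NormedSpace ℝ F]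
    {g g' : N → F} {p : N} (h : g =ᶠ[𝓝 p] g') : mvfderiv J g p = mvfderiv J g' p := by
  have h1 := h.mfderiv_eq (I := J) (I' := 𝓘(ℝ, F))
  ext u
  exact congrArg (fun L => L u) h1

lemma mvfderiv_clm_comp {F F' : Type*} [NormedAddCommGroup F] [NormedSpace ℝ F]
    [NormedAddCommGroup F'] [NormedSpace ℝ F'] (L : F →L[ℝ] F')
    {g : N → F} {p : N} (hg : MDifferentiableAt J 𝓘(ℝ, F) g p) (u : TangentSpace J p) :
    MDifferentiableAt J 𝓘(ℝ, F') (fun q => L (g q)) p ∧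
    mvfderiv J (fun q => L (g q)) p u = L (mvfderiv J g p u) := by
  have hL : MDifferentiableAt 𝓘(ℝ, F) 𝓘(ℝ, F') L (g p) := L.differentiableAt.mdifferentiableAt
  refine ⟨hL.comp p hg, ?_⟩
  have h1 : mvfderiv J (fun q => L (g q)) p u
      = mvfderiv 𝓘(ℝ, F) L (g p) (mfderiv J 𝓘(ℝ, F) g p u) :=
    mvfderiv_comp_along (I := 𝓘(ℝ, F)) hL hg u
  rw [h1]
  have : mfderiv 𝓘(ℝ, F) 𝓘(ℝ, F') L (g p) = L := by rw [mfderiv_eq_fderiv]; exact L.fderiv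
  exact congrArg (fun L : F →L[ℝ] F' => L (mvfderiv J g p u)) this

variable [IsManifold I ∞ M]

variable (I J) in
/-- The vector field `V` along the map `ι` (and hence `ι` itself) is differentiable at `p`. -/
def DiffAlongAt (ι : N → M) (V : Π q : N, TangentSpace I (ι q)) (p : N) : Prop :=
  MDifferentiableAt J (I.prod 𝓘(ℝ, E))
    (fun q => TotalSpace.mk' E (E := fun x : M => TangentSpace I x) (ι q) (V q)) p

lemma diffAlongAt_iff {ι : N → M} {V : Π q : N, TangentSpace I (ι q)} {p : N} :
    DiffAlongAt I J ι V p ↔ MDifferentiableAt J I ι p ∧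
      MDifferentiableAt J 𝓘(ℝ, E) (fun q => components I (ι p) (ι q) (V q)) p := by
  unfold DiffAlongAt
  rw [mdifferentiableAt_totalSpace]
  refine and_congr_right fun hι => ?_
  refine Filter.EventuallyEq.mdifferentiableAt_iff ?_
  have : ∀ᶠ q in 𝓝 p, ι q ∈ (chartAt H (ι p)).source :=
    hι.continuousAt.eventually ((chartAt H (ι p)).open_source.mem_nhds (mem_chart_source H _))
  filter_upwards [this] with q hq
  have h := TangentBundle.continuousLinearMapAt_trivializationAt (I := I) hq
  have h2 := congrArg (fun L => L (V q)) h
  rw [Trivialization.continuousLinearMapAt_apply, Trivialization.linearMapAt_apply,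
    if_pos (by simpa using hq)] at h2
  exact h2

/-- A differentiable field along `ι` is a combination of coordinate fields with differentiable
coefficients. -/
lemma DiffAlongAt.eventually_eq_sum [FiniteDimensional ℝ E] {ι : N → M}
    {V : Π q : N, TangentSpace I (ι q)} {p : N} (hV : DiffAlongAt I J ι V p) :
    ∃ a : Fin (finrank ℝ E) → N → ℝ, (∀ i, MDifferentiableAt J 𝓘(ℝ, ℝ) (a i) p) ∧
      ∀ᶠ q in 𝓝 p, V q = ∑ i, a i q • coordFieldL I (ι p) (ι q) (finBasis ℝ E i) := by
  have h := diffAlongAt_iff.1 hV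
  refine ⟨fun i q => LinearMap.toContinuousLinearMap ((finBasis ℝ E).coord i)
    (components I (ι p) (ι q) (V q)), fun i => ?_, ?_⟩
  · exact (mvfderiv_clm_comp (J := J) _ h.2 0).1
  · have : ∀ᶠ q in 𝓝 p, ι q ∈ (extChartAt I (ι p)).source :=
      h.1.continuousAt.eventually (extChartAt_source_mem_nhds _)
    filter_upwards [this] with q hq
    conv_lhs => rw [← coordField_components I hq (V q)]
    simp only [← map_smul, ← map_sum]
    congr 1
    exact ((finBasis ℝ E).sum_repr _).symm

end Along

/-! ### Christoffel symbols and the covariant derivative along a map -/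

section Connection
variable {E : Type*} [NormedAddCommGroup E] [NormedSpace ℝ E] [FiniteDimensional ℝ E]
  {H : Type*} [TopologicalSpace H] {I : ModelWithCorners ℝ E H}
  {M : Type*} [TopologicalSpace M] [ChartedSpace H M] [IsManifold I ∞ M]
  {E' : Type*} [NormedAddCommGroup E'] [NormedSpace ℝ E']
  {H' : Type*} [TopologicalSpace H'] {J : ModelWithCorners ℝ E' H'}
  {N : Type*} [TopologicalSpace N] [ChartedSpace H' N]

lemma diffAlongAt_coordField (x : M) (v : TangentSpace I x) :
    DiffAlongAt I I (id : M → M) (fun y => coordField I x v y) x :=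
  (contMDiffAt_coordField I x v).mdifferentiableAt (by simp)

variable [RiemannianBundle (fun x : M => TangentSpace I x)]
  [IsContMDiffRiemannianBundle I ∞ E (fun x : M => TangentSpace I x)]

lemma DiffAlongAt.inner {ι : N → M} {V W : Π q : N, TangentSpace I (ι q)} {p : N}
    (hV : DiffAlongAt I J ι V p) (hW : DiffAlongAt I J ι W p) :
    MDifferentiableAt J 𝓘(ℝ, ℝ) (fun q => ⟪V q, W q⟫_ℝ) p :=
  MDifferentiableAt.inner_bundle (E := fun x : M => TangentSpace I x) hV hW

lemma mdifferentiableAt_metric (x : M) (v w : TangentSpace I x) :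
    MDifferentiableAt I 𝓘(ℝ, ℝ) (fun y => ⟪coordField I x v y, coordField I x w y⟫_ℝ) x :=
  (diffAlongAt_coordField x v).inner (diffAlongAt_coordField x w)

lemma metricDeriv_eq (x : M) (u v w : TangentSpace I x) : metricDeriv I x u v w =
    mvfderiv I (fun y => ⟪coordField I x v y, coordField I x w y⟫_ℝ) x u := rfl

lemma metricDeriv_comm (x : M) (u v w : TangentSpace I x) :
    metricDeriv I x u v w = metricDeriv I x u w v := by
  simp only [metricDeriv_eq, real_inner_comm]

lemma metricDeriv_add (x : M) (u v w w' : TangentSpace I x) :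
    metricDeriv I x u v (w + w') = metricDeriv I x u v w + metricDeriv I x u v w' := by
  simp only [metricDeriv_eq]
  rw [← add_apply, ← mvfderiv_fun_add (mdifferentiableAt_metric x v w)
    (mdifferentiableAt_metric x v w')]
  congr 2
  funext y
  rw [← inner_add_right]
  congr 1
  exact map_add (coordFieldL I x y) _ _

lemma metricDeriv_smul (x : M) (u v w : TangentSpace I x) (c : ℝ) :
    metricDeriv I x u v (c • w) = c * metricDeriv I x u v w := by
  simp only [metricDeriv_eq]
  have h := mvfderiv_clm_comp (J := I) (c • ContinuousLinearMap.id ℝ ℝ)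
    (mdifferentiableAt_metric x v w) u
  have h2 := h.2
  simp only [smul_apply, ContinuousLinearMap.id_apply, smul_eq_mul] at h2
  rw [← h2]
  congr 2
  funext y
  rw [← real_inner_smul_right]
  congr 1
  exact map_smul (coordFieldL I x y) _ _

/-- `metricDeriv` as a trilinear map. -/
def metricDerivL (x : M) : TangentSpace I x →ₗ[ℝ] TangentSpace I x →ₗ[ℝ] TangentSpace I x →ₗ[ℝ] ℝ :=
  LinearMap.mk₂ ℝ (fun u v =>
    { toFun := metricDeriv I x u v
      map_add' := metricDeriv_add x u v
      map_smul' := fun c w => metricDeriv_smul x u v w c })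
    (fun u u' v => by ext w; exact map_add (mvfderiv I _ x) _ _)
    (fun c u v => by ext w; exact map_smul (mvfderiv I _ x) _ _)
    (fun u v v' => by
      ext w
      simp only [LinearMap.coe_mk, AddHom.coe_mk, LinearMap.add_apply]
      rw [metricDeriv_comm, metricDeriv_add, metricDeriv_comm, metricDeriv_comm x u w v'])
    (fun c u v => by
      ext w
      simp only [LinearMap.coe_mk, AddHom.coe_mk, LinearMap.smul_apply, smul_eq_mul]
      rw [metricDeriv_comm, metricDeriv_smul, metricDeriv_comm])

lemma metricDerivL_apply (x : M) (u v w : TangentSpace I x) :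
    metricDerivL x u v w = metricDeriv I x u v w := rfl

/-- The Koszul formula for the coordinate fields, with arbitrary last argument. -/
lemma inner_christoffel (x : M) (v w z : TangentSpace I x) :
    ⟪christoffel I x v w, z⟫_ℝ = 1 / 2 *
      (metricDeriv I x v w z + metricDeriv I x w v z - metricDeriv I x z v w) := by
  let ℓ : TangentSpace I x →ₗ[ℝ] ℝ := (1 / 2 : ℝ) •
    (metricDerivL x v w + metricDerivL x w v - ((metricDerivL x).flip v).flip w)
  have hℓ : ∀ z, ℓ z = 1 / 2 *
      (metricDeriv I x v w z + metricDeriv I x w v z - metricDeriv I x z v w) := fun z => rfl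
  rw [← hℓ z]
  have h1 : christoffel I x v w = ∑ k, ℓ (stdOrthonormalBasis ℝ (TangentSpace I x) k) •
      stdOrthonormalBasis ℝ (TangentSpace I x) k := rfl
  rw [h1, sum_inner]
  conv_rhs => rw [← (stdOrthonormalBasis ℝ (TangentSpace I x)).sum_repr' z, map_sum]
  refine Finset.sum_congr rfl fun k _ => ?_
  rw [real_inner_smul_left, map_smul, smul_eq_mul, mul_comm]

lemma christoffel_comm (x : M) (v w : TangentSpace I x) :
    christoffel I x v w = christoffel I x w v := by
  refine ext_inner_right ℝ fun z => ?_
  rw [inner_christoffel, inner_christoffel, metricDeriv_comm x z w v]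
  ring

/-- `christoffel` as a bilinear map. -/
def christoffelL (x : M) : TangentSpace I x →ₗ[ℝ] TangentSpace I x →ₗ[ℝ] TangentSpace I x :=
  LinearMap.mk₂ ℝ (christoffel I x)
    (fun v v' w => ext_inner_right ℝ fun z => by
      simp only [inner_add_left, inner_christoffel, ← metricDerivL_apply, map_add,
        LinearMap.add_apply]
      ring)
    (fun c v w => ext_inner_right ℝ fun z => by
      simp only [real_inner_smul_left, inner_christoffel, ← metricDerivL_apply, map_smul,
        LinearMap.smul_apply, smul_eq_mul]
      ring)
    (fun v w w' => ext_inner_right ℝ fun z => by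
      simp only [inner_add_left, inner_christoffel, ← metricDerivL_apply, map_add,
        LinearMap.add_apply]
      ring)
    (fun c v w => ext_inner_right ℝ fun z => by
      simp only [real_inner_smul_left, inner_christoffel, ← metricDerivL_apply, map_smul,
        LinearMap.smul_apply, smul_eq_mul]
      ring)

lemma christoffelL_apply (x : M) (v w : TangentSpace I x) :
    christoffelL x v w = christoffel I x v w := rfl

/-- In coordinates, the Christoffel symbols are compatible with the metric. -/
lemma metricDeriv_eq_christoffel (x : M) (u v w : TangentSpace I x) :
    metricDeriv I x u v w = ⟪christoffel I x u v, w⟫_ℝ + ⟪v, christoffel I x u w⟫_ℝ := by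
  rw [real_inner_comm (christoffel I x u w) v, inner_christoffel, inner_christoffel,
    metricDeriv_comm x v u w, metricDeriv_comm x w u v, metricDeriv_comm x u w v]
  ring

lemma covDerivAlong_eq (ι : N → M) (V : Π q : N, TangentSpace I (ι q)) (p : N)
    (u : TangentSpace J p) : covDerivAlong I J ι V p u =
      ofModel I (ι p) (mvfderiv J (fun q => components I (ι p) (ι q) (V q)) p u) +
      christoffel I (ι p) (mfderiv J I ι p u) (V p) := rfl

/-- The Leibniz rule for the covariant derivative of `∑ i, a i • Y i` along `ι`. -/
lemma covDerivAlong_sum {κ : Type*} [Fintype κ] {ι : N → M} {V : Π q : N, TangentSpace I (ι q)}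
    {p : N} (hι : MDifferentiableAt J I ι p) {a : κ → N → ℝ}
    (ha : ∀ i, MDifferentiableAt J 𝓘(ℝ, ℝ) (a i) p) {Y : κ → Π y : M, TangentSpace I y}
    (hY : ∀ i, DiffAlongAt I I (id : M → M) (fun y => Y i y) (ι p))
    (hV : ∀ᶠ q in 𝓝 p, V q = ∑ i, a i q • Y i (ι q)) (u : TangentSpace J p) :
    DiffAlongAt I J ι V p ∧ covDerivAlong I J ι V p u =
      ∑ i, (mvfderiv J (a i) p u • Y i (ι p) +
        a i p • covDeriv I (Y i) (ι p) (mfderiv J I ι p u)) := by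
  have hY' : ∀ i, MDifferentiableAt I 𝓘(ℝ, E)
    (fun y => components I (ι p) y (Y i y)) (ι p) := fun i => (diffAlongAt_iff.1 (hY i)).2
  have hb : ∀ i, MDifferentiableAt J 𝓘(ℝ, E) (fun q => components I (ι p) (ι q) (Y i (ι q))) p :=
    fun i => (hY' i).comp p hι
  have hev : (fun q => components I (ι p) (ι q) (V q)) =ᶠ[𝓝 p]
      fun q => ∑ i, a i q • components I (ι p) (ι q) (Y i (ι q)) := by
    filter_upwards [hV] with q hq
    rw [hq, map_sum]
    simp only [map_smul]
  have hs := mvfderiv_sum_smul (J := J) Finset.univ ha hb u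
  refine ⟨diffAlongAt_iff.2 ⟨hι, hev.mdifferentiableAt_iff.2 hs.1⟩, ?_⟩
  rw [covDerivAlong_eq, eventually_mvfderiv_congr hev, hs.2, hV.self_of_nhds,
    ← christoffelL_apply, map_sum]
  have h2 : ∀ i, mvfderiv J (fun q => components I (ι p) (ι q) (Y i (ι q))) p u =
      mvfderiv I (fun y => components I (ι p) y (Y i y)) (ι p) (mfderiv J I ι p u) := fun i =>
    mvfderiv_comp_along (hY' i) hι u
  have h3 : ∀ i, ofModel I (ι p) (components I (ι p) (ι p) (Y i (ι p))) = Y i (ι p) :=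
    fun i => components_self I _ _
  have h4 : mfderiv I I (id : M → M) (ι p) = ContinuousLinearMap.id ℝ _ := mfderiv_id
  simp only [map_sum, map_add, map_smul, h2, h3, ← Finset.sum_add_distrib, covDeriv,
    covDerivAlong_eq, christoffelL_apply, smul_add, ← add_assoc]
  rw [h4]
  rfl

end Connection

/-! ### The Levi-Civita connection along a map -/

section Connection
variable {E : Type*} [NormedAddCommGroup E] [NormedSpace ℝ E] [FiniteDimensional ℝ E]
  {H : Type*} [TopologicalSpace H] {I : ModelWithCorners ℝ E H}
  {M : Type*} [TopologicalSpace M] [ChartedSpace H M] [IsManifold I ∞ M]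
  {E' : Type*} [NormedAddCommGroup E'] [NormedSpace ℝ E']
  {H' : Type*} [TopologicalSpace H'] {J : ModelWithCorners ℝ E' H'}
  {N : Type*} [TopologicalSpace N] [ChartedSpace H' N]
  {E'' : Type*} [NormedAddCommGroup E''] [NormedSpace ℝ E'']
  {H'' : Type*} [TopologicalSpace H''] {J' : ModelWithCorners ℝ E'' H''}
  {N' : Type*} [TopologicalSpace N'] [ChartedSpace H'' N']
  [RiemannianBundle (fun x : M => TangentSpace I x)]
  [IsContMDiffRiemannianBundle I ∞ E (fun x : M => TangentSpace I x)]

lemma covDeriv_coordField (x : M) (v u : TangentSpace I x) :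
    covDeriv I (coordField I x v) x u = christoffel I x u v := by
  have hev : (fun y => components I x y (coordField I x v y)) =ᶠ[𝓝 x] fun _ => (v : E) := by
    filter_upwards [extChartAt_source_mem_nhds (I := I) x] with y hy
    exact components_coordField I hy v
  have h4 : mfderiv I I (id : M → M) x = ContinuousLinearMap.id ℝ _ := mfderiv_id
  rw [covDeriv, covDerivAlong_eq]
  simp only [id]
  rw [eventually_mvfderiv_congr hev, h4]
  have hc : mvfderiv I (fun _ : M => (v : E)) x = 0 := mvfderiv_const _
  have hc' : mvfderiv I (fun _ : M => (v : E)) x u = 0 := congrArg (fun L => L u) hc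
  refine (congrArg (fun w : E => ofModel I x w +
    christoffel I x u (coordField I x v x)) hc').trans ?_
  rw [coordField_self]
  change ofModel I x 0 + _ = _
  rw [map_zero, zero_add]

/-- The Levi-Civita connection is metric, for vector fields along a map. -/
lemma DiffAlongAt.mvfderiv_inner {ι : N → M} {V W : Π q : N, TangentSpace I (ι q)} {p : N}
    (hV : DiffAlongAt I J ι V p) (hW : DiffAlongAt I J ι W p) (u : TangentSpace J p) :
    mvfderiv J (fun q => ⟪V q, W q⟫_ℝ) p u =
      ⟪covDerivAlong I J ι V p u, W p⟫_ℝ + ⟪V p, covDerivAlong I J ι W p u⟫_ℝ := by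
  have hι := (diffAlongAt_iff.1 hV).1
  obtain ⟨a, ha, hVa⟩ := hV.eventually_eq_sum
  obtain ⟨b, hb, hWb⟩ := hW.eventually_eq_sum
  let e : Fin (finrank ℝ E) → TangentSpace I (ι p) := fun i => ofModel I (ι p) (finBasis ℝ E i)
  let Y : Fin (finrank ℝ E) → Π y : M, TangentSpace I y := fun i y => coordField I (ι p) (e i) y
  have hVa' : ∀ᶠ q in 𝓝 p, V q = ∑ i, a i q • Y i (ι q) := hVa
  have hWb' : ∀ᶠ q in 𝓝 p, W q = ∑ i, b i q • Y i (ι q) := hWb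
  have hY : ∀ i, DiffAlongAt I I (id : M → M) (fun y => Y i y) (ι p) := fun i =>
    diffAlongAt_coordField (ι p) (e i)
  have hYp : ∀ i, Y i (ι p) = e i := fun i => coordField_self I _ _
  have hcY : ∀ i, covDeriv I (Y i) (ι p) (mfderiv J I ι p u) =
    christoffel I (ι p) (mfderiv J I ι p u) (e i) := fun i => covDeriv_coordField _ _ _
  have hdV := (covDerivAlong_sum hι ha hY hVa' u).2
  have hdW := (covDerivAlong_sum hι hb hY hWb' u).2
  have hg : ∀ k : Fin (finrank ℝ E) × Fin (finrank ℝ E), MDifferentiableAt I 𝓘(ℝ, ℝ)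
      (fun y => ⟪Y k.1 y, Y k.2 y⟫_ℝ) (ι p) := fun k => mdifferentiableAt_metric _ _ _
  have hg' : ∀ k : Fin (finrank ℝ E) × Fin (finrank ℝ E), MDifferentiableAt J 𝓘(ℝ, ℝ)
      (fun q => ⟪Y k.1 (ι q), Y k.2 (ι q)⟫_ℝ) p := fun k => (hg k).comp p hι
  have hab : ∀ k : Fin (finrank ℝ E) × Fin (finrank ℝ E), MDifferentiableAt J 𝓘(ℝ, ℝ)
      (fun q => a k.1 q * b k.2 q) p := fun k => (ha k.1).mul (hb k.2)
  have hev : (fun q => ⟪V q, W q⟫_ℝ) =ᶠ[𝓝 p] fun q =>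
      ∑ k : Fin (finrank ℝ E) × Fin (finrank ℝ E), (a k.1 q * b k.2 q) •
        ⟪Y k.1 (ι q), Y k.2 (ι q)⟫_ℝ := by
    filter_upwards [hVa', hWb'] with q h1 h2
    rw [h1, h2, sum_inner, Fintype.sum_prod_type]
    refine Finset.sum_congr rfl fun i _ => ?_
    rw [inner_sum]
    refine Finset.sum_congr rfl fun j _ => ?_
    rw [real_inner_smul_left, real_inner_smul_right, smul_eq_mul]
    ring
  rw [eventually_mvfderiv_congr hev, (mvfderiv_sum_smul (J := J) Finset.univ hab hg' u).2,
    Fintype.sum_prod_type, hdV, hdW, hVa'.self_of_nhds, hWb'.self_of_nhds, sum_inner, sum_inner,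
    ← Finset.sum_add_distrib]
  refine Finset.sum_congr rfl fun i _ => ?_
  rw [inner_sum, inner_sum, ← Finset.sum_add_distrib]
  refine Finset.sum_congr rfl fun j _ => ?_
  have h1 : mvfderiv J (fun q => ⟪Y i (ι q), Y j (ι q)⟫_ℝ) p u =
      metricDeriv I (ι p) (mfderiv J I ι p u) (e i) (e j) := mvfderiv_comp_along (hg (i, j)) hι u
  simp only [h1, metricDeriv_eq_christoffel, hYp, hcY]
  rw [mvfderiv_fun_mul (ha i) (hb j)]
  simp only [add_apply, smul_apply, smul_eq_mul, inner_add_left, inner_add_right,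
    real_inner_smul_left, real_inner_smul_right]
  ring

/-- The covariant derivative along `ι` of the restriction of a vector field of `M`. -/
lemma covDerivAlong_restrict {ι : N → M} {p : N} (hι : MDifferentiableAt J I ι p)
    {Y : Π y : M, TangentSpace I y} (hY : DiffAlongAt I I (id : M → M) (fun y => Y y) (ι p))
    (u : TangentSpace J p) : DiffAlongAt I J ι (fun q => Y (ι q)) p ∧
      covDerivAlong I J ι (fun q => Y (ι q)) p u = covDeriv I Y (ι p) (mfderiv J I ι p u) := by
  have h := covDerivAlong_sum (κ := Unit) (V := fun q => Y (ι q)) hι (a := fun _ _ => 1)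
    (fun _ => mdifferentiableAt_const) (Y := fun _ => Y) (fun _ => hY) (by simp) u
  refine ⟨h.1, h.2.trans ?_⟩
  rw [mvfderiv_const]
  simp

/-- The chain rule for the covariant derivative along a map. -/
lemma DiffAlongAt.covDerivAlong_comp {ι : N → M} {V : Π q : N, TangentSpace I (ι q)} {j : N' → N}
    {p : N'} (hV : DiffAlongAt I J ι V (j p)) (hj : MDifferentiableAt J' J j p)
    (u : TangentSpace J' p) : covDerivAlong I J' (fun q => ι (j q)) (fun q => V (j q)) p u =
      covDerivAlong I J ι V (j p) (mfderiv J' J j p u) := by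
  have h := diffAlongAt_iff.1 hV
  have h1 : mfderiv J' I (fun q => ι (j q)) p u = mfderiv J I ι (j p) (mfderiv J' J j p u) :=
    congrArg (fun L => L u) (mfderiv_comp p h.1 hj)
  have h2 := mvfderiv_comp_along h.2 hj u
  rw [covDerivAlong_eq, covDerivAlong_eq, h2, h1]

end Connection

/-! ### The structure equations along a map -/

section AlmostContact
variable {E : Type*} [NormedAddCommGroup E] [NormedSpace ℝ E] [FiniteDimensional ℝ E]
  {M : Type*} [TopologicalSpace M] [ChartedSpace E M] [IsManifold 𝓘(ℝ, E) ∞ M]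
  [RiemannianBundle (fun x : M => TangentSpace 𝓘(ℝ, E) x)]
  {E' : Type*} [NormedAddCommGroup E'] [NormedSpace ℝ E']
  {H' : Type*} [TopologicalSpace H'] {J : ModelWithCorners ℝ E' H'}
  {N : Type*} [TopologicalSpace N] [ChartedSpace H' N]

namespace AlmostContactMetric
variable (S : AlmostContactMetric E M)

lemma η_eq_inner (x : M) (v : TangentSpace 𝓘(ℝ, E) x) : S.η x v = ⟪S.ξ x, v⟫_ℝ := by
  have h := S.inner_Φ_Φ x (S.ξ x) v
  rw [S.Φ_ξ, inner_zero_left, S.η_ξ] at h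
  linarith

lemma inner_Φ_left (x : M) (v w : TangentSpace 𝓘(ℝ, E) x) :
    ⟪S.Φ x v, w⟫_ℝ = -⟪v, S.Φ x w⟫_ℝ := by
  have h := S.inner_Φ_Φ x (S.Φ x v) w
  rw [S.Φ_Φ, S.η_Φ, inner_add_left, inner_neg_left, real_inner_smul_left, ← S.η_eq_inner,
    S.η_Φ] at h
  linarith

lemma inner_ξ_ξ (x : M) : ⟪S.ξ x, S.ξ x⟫_ℝ = 1 := by
  rw [← S.η_eq_inner, S.η_ξ]

lemma inner_Φ_self (x : M) (v : TangentSpace 𝓘(ℝ, E) x) : ⟪S.Φ x v, v⟫_ℝ = 0 := by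
  have h := S.inner_Φ_left x v v
  rw [real_inner_comm (S.Φ x v) v] at h
  linarith

variable [IsContMDiffRiemannianBundle 𝓘(ℝ, E) ∞ E (fun x : M => TangentSpace 𝓘(ℝ, E) x)]
variable {S} {β : M → ℝ}

/-- The identity for `∇Φ`, for a vector field along a map. Such a field need not be the restriction
of a vector field of `M`, but it is locally a combination of coordinate fields, and both sides obey
the Leibniz rule. -/
lemma IsLocallyConformalAlmostCosymplectic.covDerivAlong_Φ
    (hS : S.IsLocallyConformalAlmostCosymplectic β) {ι : N → M}
    {V : Π q : N, TangentSpace 𝓘(ℝ, E) (ι q)} {p : N} (hV : DiffAlongAt 𝓘(ℝ, E) J ι V p)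
    (u : TangentSpace J p) :
    DiffAlongAt 𝓘(ℝ, E) J ι (fun q => S.Φ (ι q) (V q)) p ∧
    covDerivAlong 𝓘(ℝ, E) J ι (fun q => S.Φ (ι q) (V q)) p u =
      S.Φ (ι p) (covDerivAlong 𝓘(ℝ, E) J ι V p u) +
        β (ι p) • (⟪S.Φ (ι p) (mfderiv J 𝓘(ℝ, E) ι p u), V p⟫_ℝ • S.ξ (ι p) -
          S.η (ι p) (V p) • S.Φ (ι p) (mfderiv J 𝓘(ℝ, E) ι p u)) := by
  have hι := (diffAlongAt_iff.1 hV).1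
  obtain ⟨a, ha, hVa⟩ := hV.eventually_eq_sum
  let e : Fin (finrank ℝ E) → TangentSpace 𝓘(ℝ, E) (ι p) := fun i =>
    ofModel 𝓘(ℝ, E) (ι p) (finBasis ℝ E i)
  let Y : Fin (finrank ℝ E) → Π y : M, TangentSpace 𝓘(ℝ, E) y := fun i y =>
    coordField 𝓘(ℝ, E) (ι p) (e i) y
  have hVa' : ∀ᶠ q in 𝓝 p, V q = ∑ i, a i q • Y i (ι q) := hVa
  have hY : ∀ i, DiffAlongAt 𝓘(ℝ, E) 𝓘(ℝ, E) (id : M → M) (fun y => Y i y) (ι p) := fun i =>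
    diffAlongAt_coordField (ι p) (e i)
  have hΦY : ∀ i, DiffAlongAt 𝓘(ℝ, E) 𝓘(ℝ, E) (id : M → M) (fun y => S.Φ y (Y i y)) (ι p) :=
    fun i => MDifferentiableAt.clm_bundle_apply (b := (id : M → M)) (F₁ := E) (F₂ := E)
      (E₁ := fun x : M => TangentSpace 𝓘(ℝ, E) x) (E₂ := fun x : M => TangentSpace 𝓘(ℝ, E) x)
      ((S.smooth_Φ (ι p)).mdifferentiableAt (by simp)) (hY i)
  have hVΦ : ∀ᶠ q in 𝓝 p, S.Φ (ι q) (V q) = ∑ i, a i q • S.Φ (ι q) (Y i (ι q)) := by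
    filter_upwards [hVa'] with q hq
    rw [hq, map_sum]
    simp only [map_smul]
  have h1 := covDerivAlong_sum hι ha hY hVa' u
  have h2 := covDerivAlong_sum hι ha hΦY hVΦ u
  refine ⟨h2.1, ?_⟩
  have h3 : ∀ i, covDeriv 𝓘(ℝ, E) (fun y => S.Φ y (Y i y)) (ι p) (mfderiv J 𝓘(ℝ, E) ι p u) =
      S.Φ (ι p) (covDeriv 𝓘(ℝ, E) (Y i) (ι p) (mfderiv J 𝓘(ℝ, E) ι p u)) +
      β (ι p) • (⟪S.Φ (ι p) (mfderiv J 𝓘(ℝ, E) ι p u), Y i (ι p)⟫_ℝ • S.ξ (ι p) -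
        S.η (ι p) (Y i (ι p)) • S.Φ (ι p) (mfderiv J 𝓘(ℝ, E) ι p u)) := fun i => by
    rw [← hS.cov_Φ (ι p) (mfderiv J 𝓘(ℝ, E) ι p u) (Y i) (contMDiffAt_coordField _ _ _)]
    abel
  rw [h2.2, h1.2, hVa'.self_of_nhds]
  simp only [h3, map_sum, map_add, map_smul, inner_sum, real_inner_smul_right, Finset.smul_sum,
    Finset.sum_smul, smul_add, smul_sub, Finset.sum_add_distrib, Finset.sum_sub_distrib, smul_smul,
    smul_eq_mul, add_assoc]
  congr 3
  · refine Finset.sum_congr rfl fun i _ => ?_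
    rw [mul_left_comm]
  · refine Finset.sum_congr rfl fun i _ => ?_
    rw [mul_left_comm]

lemma IsLocallyConformalAlmostCosymplectic.covDerivAlong_ξ
    (hS : S.IsLocallyConformalAlmostCosymplectic β) {ι : N → M} {p : N}
    (hι : MDifferentiableAt J 𝓘(ℝ, E) ι p) (u : TangentSpace J p) :
    DiffAlongAt 𝓘(ℝ, E) J ι (fun q => S.ξ (ι q)) p ∧
    covDerivAlong 𝓘(ℝ, E) J ι (fun q => S.ξ (ι q)) p u =
      β (ι p) • (mfderiv J 𝓘(ℝ, E) ι p u -
        S.η (ι p) (mfderiv J 𝓘(ℝ, E) ι p u) • S.ξ (ι p)) := by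
  rw [← hS.cov_ξ]
  exact covDerivAlong_restrict hι ((S.smooth_ξ (ι p)).mdifferentiableAt (by simp)) u

end AlmostContactMetric
end AlmostContact

/-! ### Charts of a product -/

section ProductChart
variable {E₁ : Type*} [NormedAddCommGroup E₁] [NormedSpace ℝ E₁]
  {H₁ : Type*} [TopologicalSpace H₁] (I₁ : ModelWithCorners ℝ E₁ H₁)
  {M₁ : Type*} [TopologicalSpace M₁] [ChartedSpace H₁ M₁] [IsManifold I₁ ∞ M₁]
  {E₂ : Type*} [NormedAddCommGroup E₂] [NormedSpace ℝ E₂]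
  {H₂ : Type*} [TopologicalSpace H₂] (I₂ : ModelWithCorners ℝ E₂ H₂)
  {M₂ : Type*} [TopologicalSpace M₂] [ChartedSpace H₂ M₂] [IsManifold I₂ ∞ M₂]

lemma components_prod {p q : M₁ × M₂} (hq : q ∈ (extChartAt (I₁.prod I₂) p).source)
    (v : TangentSpace (I₁.prod I₂) q) : components (I₁.prod I₂) p q v =
      (components I₁ p.1 q.1 (v : E₁ × E₂).1, components I₂ p.2 q.2 (v : E₁ × E₂).2) := by
  have hd : MDifferentiableAt (I₁.prod I₂) 𝓘(ℝ, E₁ × E₂) (extChartAt (I₁.prod I₂) p) q :=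
    mdifferentiableAt_extChartAt (by rwa [extChartAt_source] at hq)
  have hq' := hq
  rw [extChartAt_prod] at hq'
  have h1 : MDifferentiableAt I₁ 𝓘(ℝ, E₁) (extChartAt I₁ p.1) q.1 :=
    mdifferentiableAt_extChartAt (by rw [← extChartAt_source I₁]; exact hq'.1)
  have h2 : MDifferentiableAt I₂ 𝓘(ℝ, E₂) (extChartAt I₂ p.2) q.2 :=
    mdifferentiableAt_extChartAt (by rw [← extChartAt_source I₂]; exact hq'.2)
  refine Prod.ext ?_ ?_
  · refine ((mvfderiv_clm_comp (J := I₁.prod I₂)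
      (ContinuousLinearMap.fst ℝ E₁ E₂) hd v).2).symm.trans ?_
    have h3 : (fun q => (ContinuousLinearMap.fst ℝ E₁ E₂) (extChartAt (I₁.prod I₂) p q)) =
        fun q : M₁ × M₂ => extChartAt I₁ p.1 q.1 := by
      rw [extChartAt_prod]; rfl
    rw [h3, mvfderiv_comp_along (ι := Prod.fst) (I := I₁) h1 mdifferentiableAt_fst, mfderiv_fst]
    rfl
  · refine ((mvfderiv_clm_comp (J := I₁.prod I₂)
      (ContinuousLinearMap.snd ℝ E₁ E₂) hd v).2).symm.trans ?_
    have h3 : (fun q => (ContinuousLinearMap.snd ℝ E₁ E₂) (extChartAt (I₁.prod I₂) p q)) =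
        fun q : M₁ × M₂ => extChartAt I₂ p.2 q.2 := by
      rw [extChartAt_prod]; rfl
    rw [h3, mvfderiv_comp_along (ι := Prod.snd) (I := I₂) h2 mdifferentiableAt_snd, mfderiv_snd]
    rfl

lemma coordField_prod {p q : M₁ × M₂} (hq : q ∈ (extChartAt (I₁.prod I₂) p).source)
    (v : E₁) (w : E₂) : coordField (I₁.prod I₂) p ((v, w) : E₁ × E₂) q =
      ((coordField I₁ p.1 v q.1, coordField I₂ p.2 w q.2) : E₁ × E₂) := by
  have hq' := hq
  rw [extChartAt_prod] at hq'
  have h := coordField_components (I₁.prod I₂) hq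
    ((coordField I₁ p.1 v q.1, coordField I₂ p.2 w q.2) : E₁ × E₂)
  have h1 := components_coordField I₁ hq'.1 v
  have h2 := components_coordField I₂ hq'.2 w
  refine Eq.trans ?_ h
  exact congrArg (coordFieldL (I₁.prod I₂) p q)
    ((components_prod I₁ I₂ hq _).trans (Prod.ext h1 h2)).symm

end ProductChart

/-! ### The second covariant derivative of a map -/

section SecondDeriv

lemma two_le_infty : (1 : WithTop ℕ∞) + 1 ≤ ∞ := by
  rw [one_add_one_eq_two]
  exact WithTop.coe_le_coe.2 (le_top : (2 : ℕ∞) ≤ ⊤)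

variable {E : Type*} [NormedAddCommGroup E] [NormedSpace ℝ E] [FiniteDimensional ℝ E]
  {H : Type*} [TopologicalSpace H] {I : ModelWithCorners ℝ E H}
  {M : Type*} [TopologicalSpace M] [ChartedSpace H M] [IsManifold I ∞ M]
  {E' : Type*} [NormedAddCommGroup E'] [NormedSpace ℝ E'] [FiniteDimensional ℝ E']
  {H' : Type*} [TopologicalSpace H'] {J : ModelWithCorners ℝ E' H'} [J.Boundaryless]
  {N : Type*} [TopologicalSpace N] [ChartedSpace H' N] [IsManifold J ∞ N]
  [RiemannianBundle (fun x : M => TangentSpace I x)]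
  [IsContMDiffRiemannianBundle I ∞ E (fun x : M => TangentSpace I x)]

variable (I J) in
/-- The image `df (∂_w)` of the coordinate field `∂_w` of the preferred chart at `p`, a vector field
along `f`. -/
def pushField (f : N → M) (p : N) (w : TangentSpace J p) (q : N) : TangentSpace I (f q) :=
  mfderiv J I f q (coordField J p w q)

lemma pushField_self (f : N → M) (p : N) (w : TangentSpace J p) :
    pushField I J f p w p = mfderiv J I f p w := by
  rw [pushField, coordField_self]

lemma diffAlongAt_pushField {f : N → M} (hf : ContMDiff J I ∞ f) (p : N) (w : TangentSpace J p) :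
    DiffAlongAt I J f (pushField I J f p w) p := by
  have h1 : ContMDiff J.tangent I.tangent ∞ (tangentMap J I f) :=
    hf.contMDiff_tangentMap (by simp)
  have h2 := (h1 ⟨p, coordField J p w p⟩).comp p (contMDiffAt_coordField J p w)
  exact h2.mdifferentiableAt (by simp)

/-- Near `p`, the components of `df (∂_w)` are `y ↦ D F y w`, where `F` is `f` in charts. -/
lemma components_pushField {f : N → M} (hf : ContMDiff J I ∞ f) (p : N) (w : TangentSpace J p) :
    (fun q => components I (f p) (f q) (pushField I J f p w q)) =ᶠ[𝓝 p]
      fun q => fderiv ℝ (writtenInExtChartAt J I p f) (extChartAt J p q) (toModel J p w) := by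
  have hs : ∀ᶠ q in 𝓝 p, q ∈ (extChartAt J p).source := extChartAt_source_mem_nhds p
  have hfs : ∀ᶠ q in 𝓝 p, f q ∈ (extChartAt I (f p)).source :=
    hf.continuous.continuousAt.eventually (extChartAt_source_mem_nhds _)
  have hF : ContDiffAt ℝ ∞ (writtenInExtChartAt J I p f) (extChartAt J p p) := by
    have := (contMDiffAt_iff.1 (hf p)).2
    rwa [J.range_eq_univ, contDiffWithinAt_univ] at this
  have hFd : ∀ᶠ q in 𝓝 p,
      DifferentiableAt ℝ (writtenInExtChartAt J I p f) (extChartAt J p q) := by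
    refine (continuousAt_extChartAt (I := J) p).eventually ?_
    have : ContDiffAt ℝ 1 (writtenInExtChartAt J I p f) (extChartAt J p p) := hF.of_le (by simp)
    exact (this.eventually (by simp)).mono fun y hy => hy.differentiableAt (by simp)
  filter_upwards [hs.eventually_nhds, hs, hfs, hFd] with q hsq hq hfq hFq
  have hχ : MDifferentiableAt J 𝓘(ℝ, E') (extChartAt J p) q :=
    mdifferentiableAt_extChartAt (by rwa [extChartAt_source] at hq)
  have hχ' : MDifferentiableAt I 𝓘(ℝ, E) (extChartAt I (f p)) (f q) :=
    mdifferentiableAt_extChartAt (by rwa [extChartAt_source] at hfq)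
  have h1 := mvfderiv_comp_along (J := J) hχ' ((hf q).mdifferentiableAt (by simp))
    (coordField J p w q)
  have h2 : (fun q => extChartAt I (f p) (f q)) =ᶠ[𝓝 q]
      fun q => writtenInExtChartAt J I p f (extChartAt J p q) := by
    filter_upwards [hsq] with r hr
    simp only [writtenInExtChartAt, Function.comp_apply, (extChartAt J p).left_inv hr]
  rw [eventually_mvfderiv_congr h2] at h1
  have h3 := mvfderiv_comp_along (I := 𝓘(ℝ, E')) (J := J) hFq.mdifferentiableAt hχ
    (coordField J p w q)
  have h4 : mfderiv J 𝓘(ℝ, E') (extChartAt J p) q (coordField J p w q) = (toModel J p w) :=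
    components_coordField J hq w
  rw [h4] at h3
  refine (h1.symm.trans h3).trans ?_
  exact congrArg (fun L : E' →L[ℝ] E => L (toModel J p w)) (mfderiv_eq_fderiv (𝕜 := ℝ))

lemma mvfderiv_components_pushField {f : N → M} (hf : ContMDiff J I ∞ f) (p : N)
    (s w : TangentSpace J p) :
    mvfderiv J (fun q => components I (f p) (f q) (pushField I J f p w q)) p s =
      fderiv ℝ (fderiv ℝ (writtenInExtChartAt J I p f)) (extChartAt J p p) (toModel J p s)
        (toModel J p w) := by
  rw [eventually_mvfderiv_congr (components_pushField hf p w)]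
  have hF : ContDiffAt ℝ ∞ (writtenInExtChartAt J I p f) (extChartAt J p p) := by
    have := (contMDiffAt_iff.1 (hf p)).2
    rwa [J.range_eq_univ, contDiffWithinAt_univ] at this
  have hD : DifferentiableAt ℝ (fderiv ℝ (writtenInExtChartAt J I p f)) (extChartAt J p p) :=
    (hF.fderiv_right (m := 1) two_le_infty).differentiableAt (by simp)
  have hD' : DifferentiableAt ℝ (fun y => fderiv ℝ (writtenInExtChartAt J I p f) y (toModel J p w))
    (extChartAt J p p) := hD.clm_apply (differentiableAt_const _)
  have hχ : MDifferentiableAt J 𝓘(ℝ, E') (extChartAt J p) p :=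
    mdifferentiableAt_extChartAt (mem_chart_source _ _)
  have h1 := mvfderiv_comp_along (I := 𝓘(ℝ, E')) (J := J) hD'.mdifferentiableAt hχ s
  have h4 : mfderiv J 𝓘(ℝ, E') (extChartAt J p) p s = (toModel J p s) := components_self J p s
  rw [h4] at h1
  refine h1.trans ?_
  refine (congrArg (fun L : E' →L[ℝ] E => L (toModel J p s)) (mfderiv_eq_fderiv (𝕜 := ℝ))).trans ?_
  change fderiv ℝ (fun y => fderiv ℝ (writtenInExtChartAt J I p f) y (toModel J p w)) _
    (toModel J p s) = _
  rw [fderiv_clm_apply hD (differentiableAt_const _)]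
  simp

variable (I J) in
/-- The second covariant derivative `∇_s (df ∂_w)` of `f` at `p`, where `∂_w` is the coordinate
field of the preferred chart at `p` with value `w`. -/
def secondDeriv (f : N → M) (p : N) (s w : TangentSpace J p) : TangentSpace I (f p) :=
  covDerivAlong I J f (pushField I J f p w) p s

lemma secondDeriv_eq {f : N → M} (hf : ContMDiff J I ∞ f) (p : N) (s w : TangentSpace J p) :
    secondDeriv I J f p s w = ofModel I (f p)
      (fderiv ℝ (fderiv ℝ (writtenInExtChartAt J I p f)) (extChartAt J p p) (toModel J p s)
        (toModel J p w)) +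
      christoffelL (f p) (mfderiv J I f p s) (mfderiv J I f p w) := by
  rw [secondDeriv, covDerivAlong_eq, mvfderiv_components_pushField hf, pushField_self]
  rfl

/-- The Levi-Civita connection is torsion-free. -/
lemma secondDeriv_comm {f : N → M} (hf : ContMDiff J I ∞ f) (p : N) (s w : TangentSpace J p) :
    secondDeriv I J f p s w = secondDeriv I J f p w s := by
  have hF : ContDiffAt ℝ ∞ (writtenInExtChartAt J I p f) (extChartAt J p p) := by
    have := (contMDiffAt_iff.1 (hf p)).2
    rwa [J.range_eq_univ, contDiffWithinAt_univ] at this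
  have hsymm := hF.isSymmSndFDerivAt (by simpa [one_add_one_eq_two] using two_le_infty)
  rw [secondDeriv_eq hf, secondDeriv_eq hf, hsymm.eq, christoffelL_apply, christoffelL_apply,
    christoffel_comm]

/-- `secondDeriv` as a bilinear map. -/
def secondDerivL {f : N → M} (hf : ContMDiff J I ∞ f) (p : N) :
    TangentSpace J p →ₗ[ℝ] TangentSpace J p →ₗ[ℝ] TangentSpace I (f p) :=
  LinearMap.mk₂ ℝ (secondDeriv I J f p)
    (fun s s' w => by
      simp only [secondDeriv_eq hf, map_add, LinearMap.add_apply, add_apply]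
      abel)
    (fun c s w => by
      simp only [secondDeriv_eq hf, map_smul, LinearMap.smul_apply, smul_add, smul_apply])
    (fun s w w' => by
      simp only [secondDeriv_eq hf, map_add]
      abel)
    (fun c s w => by
      simp only [secondDeriv_eq hf, map_smul, smul_add])

lemma secondDerivL_apply {f : N → M} (hf : ContMDiff J I ∞ f) (p : N) (s w : TangentSpace J p) :
    secondDerivL hf p s w = secondDeriv I J f p s w := rfl

lemma secondFundForm_eq (f : N → M) (p : N) (s w : TangentSpace J p) :
    secondFundForm I J f p s w = (tangentImage I J f p)ᗮ.starProjection (secondDeriv I J f p s w) :=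
  rfl

end SecondDeriv

/-! ### Tangent vectors of a product of three manifolds -/

section ProductCalculus
variable {E₁ : Type*} [NormedAddCommGroup E₁] [NormedSpace ℝ E₁]
  {L₁ : Type*} [TopologicalSpace L₁] [ChartedSpace E₁ L₁]
  {E₂ : Type*} [NormedAddCommGroup E₂] [NormedSpace ℝ E₂]
  {L₂ : Type*} [TopologicalSpace L₂] [ChartedSpace E₂ L₂]
  {E₃ : Type*} [NormedAddCommGroup E₃] [NormedSpace ℝ E₃]
  {L₃ : Type*} [TopologicalSpace L₃] [ChartedSpace E₃ L₃]

/-- The inclusion of the tangent space of the first factor. -/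
def incl₁ (p : L₁ × L₂ × L₃) :
    TangentSpace 𝓘(ℝ, E₁) p.1 →L[ℝ] TangentSpace (prodModel E₁ E₂ E₃) p :=
  ContinuousLinearMap.inl ℝ E₁ (E₂ × E₃)

/-- The inclusion of the tangent space of the second factor. -/
def incl₂ (p : L₁ × L₂ × L₃) :
    TangentSpace 𝓘(ℝ, E₂) p.2.1 →L[ℝ] TangentSpace (prodModel E₁ E₂ E₃) p :=
  (ContinuousLinearMap.inr ℝ E₁ (E₂ × E₃)).comp (ContinuousLinearMap.inl ℝ E₂ E₃)

/-- The inclusion of the tangent space of the third factor. -/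
def incl₃ (p : L₁ × L₂ × L₃) :
    TangentSpace 𝓘(ℝ, E₃) p.2.2 →L[ℝ] TangentSpace (prodModel E₁ E₂ E₃) p :=
  (ContinuousLinearMap.inr ℝ E₁ (E₂ × E₃)).comp (ContinuousLinearMap.inr ℝ E₂ E₃)

lemma incl₁_eq (p : L₁ × L₂ × L₃) (u : TangentSpace 𝓘(ℝ, E₁) p.1) :
    incl₁ (E₂ := E₂) (E₃ := E₃) p u = tangentTriple p u 0 0 := rfl

lemma incl₂_eq (p : L₁ × L₂ × L₃) (x : TangentSpace 𝓘(ℝ, E₂) p.2.1) :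
    incl₂ (E₁ := E₁) (E₃ := E₃) p x = tangentTriple p 0 x 0 := rfl

lemma incl₃_eq (p : L₁ × L₂ × L₃) (z : TangentSpace 𝓘(ℝ, E₃) p.2.2) :
    incl₃ (E₁ := E₁) (E₂ := E₂) p z = tangentTriple p 0 0 z := rfl

lemma exists_eq_incl_add (p : L₁ × L₂ × L₃) (v : TangentSpace (prodModel E₁ E₂ E₃) p) :
    ∃ u x z, v = incl₁ p u + incl₂ p x + incl₃ p z := by
  refine ⟨(v : E₁ × E₂ × E₃).1, (v : E₁ × E₂ × E₃).2.1, (v : E₁ × E₂ × E₃).2.2, ?_⟩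
  change (v : E₁ × E₂ × E₃) = ((v : E₁ × E₂ × E₃).1, (0 : E₂), (0 : E₃)) +
    ((0 : E₁), (v : E₁ × E₂ × E₃).2.1, (0 : E₃)) + ((0 : E₁), (0 : E₂), (v : E₁ × E₂ × E₃).2.2)
  simp only [Prod.mk_add_mk, add_zero, zero_add]
  rfl

lemma hasMFDerivAt_slice₁ (p : L₁ × L₂ × L₃) :
    HasMFDerivAt 𝓘(ℝ, E₁) (prodModel E₁ E₂ E₃) (fun a => (a, p.2.1, p.2.2)) p.1 (incl₁ p) := by
  have h : MDifferentiableAt 𝓘(ℝ, E₁) (prodModel E₁ E₂ E₃)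
      (fun a : L₁ => (a, p.2.1, p.2.2)) p.1 :=
    mdifferentiableAt_id.prodMk mdifferentiableAt_const
  have h2 := h.hasMFDerivAt
  rwa [mfderiv_prod_left] at h2

lemma hasMFDerivAt_slice₂ (p : L₁ × L₂ × L₃) :
    HasMFDerivAt 𝓘(ℝ, E₂) (prodModel E₁ E₂ E₃) (fun b => (p.1, b, p.2.2)) p.2.1 (incl₂ p) := by
  have h1 : MDifferentiableAt 𝓘(ℝ, E₂) (𝓘(ℝ, E₂).prod 𝓘(ℝ, E₃))
      (fun b : L₂ => (b, p.2.2)) p.2.1 := mdifferentiableAt_id.prodMk mdifferentiableAt_const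
  have h2 : MDifferentiableAt (𝓘(ℝ, E₂).prod 𝓘(ℝ, E₃)) (prodModel E₁ E₂ E₃)
      (fun q : L₂ × L₃ => (p.1, q)) (p.2.1, p.2.2) :=
    mdifferentiableAt_const.prodMk mdifferentiableAt_id
  have h3 := h2.hasMFDerivAt.comp p.2.1 h1.hasMFDerivAt
  rwa [mfderiv_prod_left, mfderiv_prod_right] at h3

lemma hasMFDerivAt_slice₃ (p : L₁ × L₂ × L₃) :
    HasMFDerivAt 𝓘(ℝ, E₃) (prodModel E₁ E₂ E₃) (fun c => (p.1, p.2.1, c)) p.2.2 (incl₃ p) := by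
  have h1 : MDifferentiableAt 𝓘(ℝ, E₃) (𝓘(ℝ, E₂).prod 𝓘(ℝ, E₃))
      (fun c : L₃ => (p.2.1, c)) p.2.2 := mdifferentiableAt_const.prodMk mdifferentiableAt_id
  have h2 : MDifferentiableAt (𝓘(ℝ, E₂).prod 𝓘(ℝ, E₃)) (prodModel E₁ E₂ E₃)
      (fun q : L₂ × L₃ => (p.1, q)) (p.2.1, p.2.2) :=
    mdifferentiableAt_const.prodMk mdifferentiableAt_id
  have h3 := h2.hasMFDerivAt.comp p.2.2 h1.hasMFDerivAt
  rwa [mfderiv_prod_right, mfderiv_prod_right] at h3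

section slices
variable {F : L₁ × L₂ × L₃ → ℝ} {p : L₁ × L₂ × L₃}
  (hF : MDifferentiableAt (prodModel E₁ E₂ E₃) 𝓘(ℝ, ℝ) F p)
include hF

lemma mvfderiv_incl₁ (u : TangentSpace 𝓘(ℝ, E₁) p.1) :
    mvfderiv (prodModel E₁ E₂ E₃) F p (incl₁ p u) =
      mvfderiv 𝓘(ℝ, E₁) (fun a => F (a, p.2.1, p.2.2)) p.1 u := by
  have h := hasMFDerivAt_slice₁ (E₁ := E₁) (E₂ := E₂) (E₃ := E₃) p
  rw [mvfderiv_comp_along (ι := fun a => (a, p.2.1, p.2.2)) hF h.mdifferentiableAt, h.mfderiv]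

lemma mvfderiv_incl₂ (x : TangentSpace 𝓘(ℝ, E₂) p.2.1) :
    mvfderiv (prodModel E₁ E₂ E₃) F p (incl₂ p x) =
      mvfderiv 𝓘(ℝ, E₂) (fun b => F (p.1, b, p.2.2)) p.2.1 x := by
  have h := hasMFDerivAt_slice₂ (E₁ := E₁) (E₂ := E₂) (E₃ := E₃) p
  rw [mvfderiv_comp_along (ι := fun b => (p.1, b, p.2.2)) hF h.mdifferentiableAt, h.mfderiv]

lemma mvfderiv_incl₃ (z : TangentSpace 𝓘(ℝ, E₃) p.2.2) :
    mvfderiv (prodModel E₁ E₂ E₃) F p (incl₃ p z) =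
      mvfderiv 𝓘(ℝ, E₃) (fun c => F (p.1, p.2.1, c)) p.2.2 z := by
  have h := hasMFDerivAt_slice₃ (E₁ := E₁) (E₂ := E₂) (E₃ := E₃) p
  rw [mvfderiv_comp_along (ι := fun c => (p.1, p.2.1, c)) hF h.mdifferentiableAt, h.mfderiv]

end slices

variable [IsManifold 𝓘(ℝ, E₁) ∞ L₁] [IsManifold 𝓘(ℝ, E₂) ∞ L₂] [IsManifold 𝓘(ℝ, E₃) ∞ L₃]

lemma coordField_triple (p : L₁ × L₂ × L₃) {q : L₁ × L₂ × L₃}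
    (hq : q ∈ (extChartAt (prodModel E₁ E₂ E₃) p).source) (u : TangentSpace 𝓘(ℝ, E₁) p.1)
    (x : TangentSpace 𝓘(ℝ, E₂) p.2.1) (z : TangentSpace 𝓘(ℝ, E₃) p.2.2) :
    coordField (prodModel E₁ E₂ E₃) p (tangentTriple p u x z) q =
      tangentTriple q (coordField 𝓘(ℝ, E₁) p.1 u q.1) (coordField 𝓘(ℝ, E₂) p.2.1 x q.2.1)
        (coordField 𝓘(ℝ, E₃) p.2.2 z q.2.2) := by
  have hq' : q.2 ∈ (extChartAt (𝓘(ℝ, E₂).prod 𝓘(ℝ, E₃)) p.2).source := by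
    rw [extChartAt_prod] at hq
    exact hq.2
  refine (coordField_prod 𝓘(ℝ, E₁) (𝓘(ℝ, E₂).prod 𝓘(ℝ, E₃)) hq (u : E₁) ((x, z) : E₂ × E₃)).trans ?_
  exact Prod.ext rfl (coordField_prod 𝓘(ℝ, E₂) 𝓘(ℝ, E₃) hq' (x : E₂) (z : E₃))

lemma coordField_zero' {E : Type*} [NormedAddCommGroup E] [NormedSpace ℝ E]
    {H : Type*} [TopologicalSpace H] (I : ModelWithCorners ℝ E H)
    {M : Type*} [TopologicalSpace M] [ChartedSpace H M] (x y : M) :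
    coordField I x 0 y = 0 := map_zero (coordFieldL I x y)

lemma coordField_incl₁ (p : L₁ × L₂ × L₃) {q : L₁ × L₂ × L₃}
    (hq : q ∈ (extChartAt (prodModel E₁ E₂ E₃) p).source) (u : TangentSpace 𝓘(ℝ, E₁) p.1) :
    coordField (prodModel E₁ E₂ E₃) p (incl₁ p u) q =
      incl₁ q (coordField 𝓘(ℝ, E₁) p.1 u q.1) := by
  rw [incl₁_eq, coordField_triple p hq, coordField_zero', coordField_zero', incl₁_eq]

lemma coordField_incl₂ (p : L₁ × L₂ × L₃) {q : L₁ × L₂ × L₃}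
    (hq : q ∈ (extChartAt (prodModel E₁ E₂ E₃) p).source) (x : TangentSpace 𝓘(ℝ, E₂) p.2.1) :
    coordField (prodModel E₁ E₂ E₃) p (incl₂ p x) q =
      incl₂ q (coordField 𝓘(ℝ, E₂) p.2.1 x q.2.1) := by
  rw [incl₂_eq, coordField_triple p hq, coordField_zero', coordField_zero', incl₂_eq]

lemma coordField_incl₃ (p : L₁ × L₂ × L₃) {q : L₁ × L₂ × L₃}
    (hq : q ∈ (extChartAt (prodModel E₁ E₂ E₃) p).source) (z : TangentSpace 𝓘(ℝ, E₃) p.2.2) :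
    coordField (prodModel E₁ E₂ E₃) p (incl₃ p z) q =
      incl₃ q (coordField 𝓘(ℝ, E₃) p.2.2 z q.2.2) := by
  rw [incl₃_eq, coordField_triple p hq, coordField_zero', coordField_zero', incl₃_eq]

end ProductCalculus

/-! ### The induced metric -/

section Koszul
variable {E : Type*} [NormedAddCommGroup E] [NormedSpace ℝ E] [FiniteDimensional ℝ E]
  {M : Type*} [TopologicalSpace M] [ChartedSpace E M] [IsManifold 𝓘(ℝ, E) ∞ M]
  [RiemannianBundle (fun x : M => TangentSpace 𝓘(ℝ, E) x)]
  [IsContMDiffRiemannianBundle 𝓘(ℝ, E) ∞ E (fun x : M => TangentSpace 𝓘(ℝ, E) x)]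
  {E₁ : Type*} [NormedAddCommGroup E₁] [NormedSpace ℝ E₁] [FiniteDimensional ℝ E₁]
  {L₁ : Type*} [TopologicalSpace L₁] [ChartedSpace E₁ L₁] [IsManifold 𝓘(ℝ, E₁) ∞ L₁]
  {E₂ : Type*} [NormedAddCommGroup E₂] [NormedSpace ℝ E₂] [FiniteDimensional ℝ E₂]
  {L₂ : Type*} [TopologicalSpace L₂] [ChartedSpace E₂ L₂] [IsManifold 𝓘(ℝ, E₂) ∞ L₂]
  {E₃ : Type*} [NormedAddCommGroup E₃] [NormedSpace ℝ E₃] [FiniteDimensional ℝ E₃]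
  {L₃ : Type*} [TopologicalSpace L₃] [ChartedSpace E₃ L₃] [IsManifold 𝓘(ℝ, E₃) ∞ L₃]
  {f : L₁ × L₂ × L₃ → M} {φ₁ φ₂ : L₁ → ℝ}

variable (E E₁ E₂ E₃) in
/-- The differential of `f`, restricted to the tangent space of the first factor. -/
def D₁ (f : L₁ × L₂ × L₃ → M) (p : L₁ × L₂ × L₃) :
    TangentSpace 𝓘(ℝ, E₁) p.1 →L[ℝ] TangentSpace 𝓘(ℝ, E) (f p) :=
  (mfderiv (prodModel E₁ E₂ E₃) 𝓘(ℝ, E) f p).comp (incl₁ p)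

variable (E E₁ E₂ E₃) in
/-- The differential of `f`, restricted to the tangent space of the second factor. -/
def D₂ (f : L₁ × L₂ × L₃ → M) (p : L₁ × L₂ × L₃) :
    TangentSpace 𝓘(ℝ, E₂) p.2.1 →L[ℝ] TangentSpace 𝓘(ℝ, E) (f p) :=
  (mfderiv (prodModel E₁ E₂ E₃) 𝓘(ℝ, E) f p).comp (incl₂ p)

variable (E E₁ E₂ E₃) in
/-- The differential of `f`, restricted to the tangent space of the third factor. -/
def D₃ (f : L₁ × L₂ × L₃ → M) (p : L₁ × L₂ × L₃) :
    TangentSpace 𝓘(ℝ, E₃) p.2.2 →L[ℝ] TangentSpace 𝓘(ℝ, E) (f p) :=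
  (mfderiv (prodModel E₁ E₂ E₃) 𝓘(ℝ, E) f p).comp (incl₃ p)

variable (E E₁ E₂ E₃) in
/-- `⟪∇_s (df ∂_w), df v⟫`, the Christoffel symbols of the first kind of the induced metric. -/
def christoffelFirst (f : L₁ × L₂ × L₃ → M) (p : L₁ × L₂ × L₃)
    (s w v : TangentSpace (prodModel E₁ E₂ E₃) p) : ℝ :=
  ⟪secondDeriv 𝓘(ℝ, E) (prodModel E₁ E₂ E₃) f p s w,
    mfderiv (prodModel E₁ E₂ E₃) 𝓘(ℝ, E) f p v⟫_ℝ

variable (E E₁ E₂ E₃) in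
/-- The derivative at `p` in the direction `s` of the coefficient of the induced metric given by
the coordinate fields with values `w` and `w'`. -/
def inducedMetricDeriv (f : L₁ × L₂ × L₃ → M) (p : L₁ × L₂ × L₃)
    (s w w' : TangentSpace (prodModel E₁ E₂ E₃) p) : ℝ :=
  mvfderiv (prodModel E₁ E₂ E₃)
    (fun q => ⟪pushField 𝓘(ℝ, E) (prodModel E₁ E₂ E₃) f p w q,
      pushField 𝓘(ℝ, E) (prodModel E₁ E₂ E₃) f p w' q⟫_ℝ) p s

lemma inducedMetricDeriv_comm (p : L₁ × L₂ × L₃) (s w w' : TangentSpace (prodModel E₁ E₂ E₃) p) :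
    inducedMetricDeriv E E₁ E₂ E₃ f p s w w' = inducedMetricDeriv E E₁ E₂ E₃ f p s w' w := by
  simp only [inducedMetricDeriv, real_inner_comm]

lemma inducedMetricDeriv_eq (hf : ContMDiff (prodModel E₁ E₂ E₃) 𝓘(ℝ, E) ∞ f) (p : L₁ × L₂ × L₃)
    (s w w' : TangentSpace (prodModel E₁ E₂ E₃) p) :
    inducedMetricDeriv E E₁ E₂ E₃ f p s w w' =
      christoffelFirst E E₁ E₂ E₃ f p s w w' + christoffelFirst E E₁ E₂ E₃ f p s w' w := by
  rw [inducedMetricDeriv, DiffAlongAt.mvfderiv_inner (diffAlongAt_pushField hf p w)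
    (diffAlongAt_pushField hf p w'), pushField_self, pushField_self, christoffelFirst,
    christoffelFirst, real_inner_comm _ (secondDeriv 𝓘(ℝ, E) (prodModel E₁ E₂ E₃) f p s w')]
  rfl

/-- The Koszul formula. -/
lemma two_mul_christoffelFirst (hf : ContMDiff (prodModel E₁ E₂ E₃) 𝓘(ℝ, E) ∞ f)
    (p : L₁ × L₂ × L₃) (s w v : TangentSpace (prodModel E₁ E₂ E₃) p) :
    2 * christoffelFirst E E₁ E₂ E₃ f p s w v = inducedMetricDeriv E E₁ E₂ E₃ f p s w v +
      inducedMetricDeriv E E₁ E₂ E₃ f p w s v - inducedMetricDeriv E E₁ E₂ E₃ f p v s w := by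
  rw [inducedMetricDeriv_eq hf, inducedMetricDeriv_eq hf, inducedMetricDeriv_eq hf]
  have h : ∀ a b c, christoffelFirst E E₁ E₂ E₃ f p a b c =
      christoffelFirst E E₁ E₂ E₃ f p b a c := fun a b c => by
    rw [christoffelFirst, christoffelFirst, secondDeriv_comm hf]
  rw [h v s w, h s v w, h w s v, h v w s]
  ring

lemma mdifferentiableAt_inner_pushField (hf : ContMDiff (prodModel E₁ E₂ E₃) 𝓘(ℝ, E) ∞ f)
    (p : L₁ × L₂ × L₃) (w w' : TangentSpace (prodModel E₁ E₂ E₃) p) :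
    MDifferentiableAt (prodModel E₁ E₂ E₃) 𝓘(ℝ, ℝ)
      (fun q => ⟪pushField 𝓘(ℝ, E) (prodModel E₁ E₂ E₃) f p w q,
        pushField 𝓘(ℝ, E) (prodModel E₁ E₂ E₃) f p w' q⟫_ℝ) p :=
  (diffAlongAt_pushField hf p w).inner (diffAlongAt_pushField hf p w')

variable (E E₁ E₂ E₃ f) in
/-- The coordinate field of the product with a value tangent to the first factor is the coordinate
field of this factor. -/
lemma eventually_pushField_incl₁ (p : L₁ × L₂ × L₃) : ∀ᶠ q in 𝓝 p,
    ∀ u : TangentSpace 𝓘(ℝ, E₁) p.1,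
      pushField 𝓘(ℝ, E) (prodModel E₁ E₂ E₃) f p (incl₁ p u) q =
        D₁ E E₁ E₂ E₃ f q (coordField 𝓘(ℝ, E₁) p.1 u q.1) := by
  filter_upwards [extChartAt_source_mem_nhds (I := prodModel E₁ E₂ E₃) p] with q hq u
  rw [pushField, coordField_incl₁ p hq]
  rfl

variable (E E₁ E₂ E₃ f) in
lemma eventually_pushField_incl₂ (p : L₁ × L₂ × L₃) : ∀ᶠ q in 𝓝 p,
    ∀ x : TangentSpace 𝓘(ℝ, E₂) p.2.1,
      pushField 𝓘(ℝ, E) (prodModel E₁ E₂ E₃) f p (incl₂ p x) q =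
        D₂ E E₁ E₂ E₃ f q (coordField 𝓘(ℝ, E₂) p.2.1 x q.2.1) := by
  filter_upwards [extChartAt_source_mem_nhds (I := prodModel E₁ E₂ E₃) p] with q hq u
  rw [pushField, coordField_incl₂ p hq]
  rfl

variable (E E₁ E₂ E₃ f) in
lemma eventually_pushField_incl₃ (p : L₁ × L₂ × L₃) : ∀ᶠ q in 𝓝 p,
    ∀ z : TangentSpace 𝓘(ℝ, E₃) p.2.2,
      pushField 𝓘(ℝ, E) (prodModel E₁ E₂ E₃) f p (incl₃ p z) q =
        D₃ E E₁ E₂ E₃ f q (coordField 𝓘(ℝ, E₃) p.2.2 z q.2.2) := by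
  filter_upwards [extChartAt_source_mem_nhds (I := prodModel E₁ E₂ E₃) p] with q hq u
  rw [pushField, coordField_incl₃ p hq]
  rfl

/-- The derivative of the coefficient `φ²` of a warped metric. -/
lemma mvfderiv_sq_mul {φ : L₁ → ℝ} (hφ : ContMDiff 𝓘(ℝ, E₁) 𝓘(ℝ, ℝ) ∞ φ) (hpos : ∀ a, 0 < φ a)
    (c : ℝ) (a : L₁) (u : TangentSpace 𝓘(ℝ, E₁) a) :
    mvfderiv 𝓘(ℝ, E₁) (fun a => φ a ^ 2 * c) a u =
      2 * mvfderiv 𝓘(ℝ, E₁) (fun a => Real.log (φ a)) a u * (φ a ^ 2 * c) := by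
  have hd : MDifferentiableAt 𝓘(ℝ, E₁) 𝓘(ℝ, ℝ) φ a := (hφ a).mdifferentiableAt (by simp)
  have key : ∀ {g : ℝ → ℝ} {g' : ℝ}, HasDerivAt g g' (φ a) →
      mvfderiv 𝓘(ℝ, E₁) (fun a => g (φ a)) a u = g' * mvfderiv 𝓘(ℝ, E₁) φ a u := by
    intro g g' hg
    have h1 := mvfderiv_comp_along (I := 𝓘(ℝ, ℝ)) (J := 𝓘(ℝ, E₁)) (ι := φ) (p := a)
      hg.differentiableAt.mdifferentiableAt hd u
    refine h1.trans ?_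
    refine (congrArg (fun L : ℝ →L[ℝ] ℝ => L (mvfderiv 𝓘(ℝ, E₁) φ a u))
      (mfderiv_eq_fderiv (𝕜 := ℝ) (f := g))).trans ?_
    rw [hg.hasFDerivAt.fderiv]
    simp [mul_comm]
  have h2 : HasDerivAt (fun t : ℝ => t ^ 2 * c) (2 * φ a * c) (φ a) := by
    simpa using (hasDerivAt_pow 2 (φ a)).mul_const c
  rw [key h2, key (Real.hasDerivAt_log (hpos a).ne')]
  field_simp [(hpos a).ne']

/-- Points of the three leaves through `p` that are close to `p` in the leaf are close to `p`. -/
lemma eventually_slice {P : L₁ × L₂ × L₃ → Prop} {p : L₁ × L₂ × L₃} (h : ∀ᶠ q in 𝓝 p, P q) :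
    (∀ᶠ a in 𝓝 p.1, P (a, p.2.1, p.2.2)) ∧ (∀ᶠ b in 𝓝 p.2.1, P (p.1, b, p.2.2)) ∧
      (∀ᶠ c in 𝓝 p.2.2, P (p.1, p.2.1, c)) := by
  refine ⟨?_, ?_, ?_⟩
  · exact (Continuous.continuousAt (f := fun a => (a, p.2.1, p.2.2)) (by fun_prop)).eventually h
  · exact (Continuous.continuousAt (f := fun b => (p.1, b, p.2.2)) (by fun_prop)).eventually h
  · exact (Continuous.continuousAt (f := fun c => (p.1, p.2.1, c)) (by fun_prop)).eventually h

variable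
  [RiemannianBundle (fun x : L₁ => TangentSpace 𝓘(ℝ, E₁) x)]
  [RiemannianBundle (fun x : L₂ => TangentSpace 𝓘(ℝ, E₂) x)]
  [RiemannianBundle (fun x : L₃ => TangentSpace 𝓘(ℝ, E₃) x)]

namespace IsBiWarpedProductSubmanifold
variable (hf : IsBiWarpedProductSubmanifold (E := E) (E₁ := E₁) (E₂ := E₂) (E₃ := E₃) f φ₁ φ₂)
include hf

lemma inner_D₁_D₁ (p : L₁ × L₂ × L₃) (u v : TangentSpace 𝓘(ℝ, E₁) p.1) :
    ⟪D₁ E E₁ E₂ E₃ f p u, D₁ E E₁ E₂ E₃ f p v⟫_ℝ = ⟪u, v⟫_ℝ := by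
  have h := hf.isometric p u v 0 0 0 0
  simp only [inner_zero_left, mul_zero, add_zero] at h
  exact h

lemma inner_D₂_D₂ (p : L₁ × L₂ × L₃) (x y : TangentSpace 𝓘(ℝ, E₂) p.2.1) :
    ⟪D₂ E E₁ E₂ E₃ f p x, D₂ E E₁ E₂ E₃ f p y⟫_ℝ = φ₁ p.1 ^ 2 * ⟪x, y⟫_ℝ := by
  have h := hf.isometric p 0 0 x y 0 0
  simp only [inner_zero_left, mul_zero, add_zero, zero_add] at h
  exact h

lemma inner_D₃_D₃ (p : L₁ × L₂ × L₃) (z w : TangentSpace 𝓘(ℝ, E₃) p.2.2) :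
    ⟪D₃ E E₁ E₂ E₃ f p z, D₃ E E₁ E₂ E₃ f p w⟫_ℝ = φ₂ p.1 ^ 2 * ⟪z, w⟫_ℝ := by
  have h := hf.isometric p 0 0 0 0 z w
  simp only [inner_zero_left, mul_zero, add_zero, zero_add] at h
  exact h

lemma inner_D₁_D₂ (p : L₁ × L₂ × L₃) (u : TangentSpace 𝓘(ℝ, E₁) p.1)
    (x : TangentSpace 𝓘(ℝ, E₂) p.2.1) :
    ⟪D₁ E E₁ E₂ E₃ f p u, D₂ E E₁ E₂ E₃ f p x⟫_ℝ = 0 := by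
  have h := hf.isometric p u 0 0 x 0 0
  simp only [inner_zero_left, inner_zero_right, mul_zero, add_zero] at h
  exact h

lemma inner_D₁_D₃ (p : L₁ × L₂ × L₃) (u : TangentSpace 𝓘(ℝ, E₁) p.1)
    (z : TangentSpace 𝓘(ℝ, E₃) p.2.2) :
    ⟪D₁ E E₁ E₂ E₃ f p u, D₃ E E₁ E₂ E₃ f p z⟫_ℝ = 0 := by
  have h := hf.isometric p u 0 0 0 0 z
  simp only [inner_zero_left, inner_zero_right, mul_zero, add_zero] at h
  exact h

lemma inner_D₂_D₃ (p : L₁ × L₂ × L₃) (x : TangentSpace 𝓘(ℝ, E₂) p.2.1)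
    (z : TangentSpace 𝓘(ℝ, E₃) p.2.2) :
    ⟪D₂ E E₁ E₂ E₃ f p x, D₃ E E₁ E₂ E₃ f p z⟫_ℝ = 0 := by
  have h := hf.isometric p 0 0 x 0 0 z
  simp only [inner_zero_left, inner_zero_right, mul_zero, add_zero] at h
  exact h

/-- In this and the following lemmas, the subscripts number the factors to which the arguments are
tangent (only the last two arguments, if there are two subscripts). -/
lemma inducedMetricDeriv₁₂ (p : L₁ × L₂ × L₃) (s : TangentSpace (prodModel E₁ E₂ E₃) p)
    (u : TangentSpace 𝓘(ℝ, E₁) p.1) (x : TangentSpace 𝓘(ℝ, E₂) p.2.1) :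
    inducedMetricDeriv E E₁ E₂ E₃ f p s (incl₁ p u) (incl₂ p x) = 0 := by
  have h : (fun q => ⟪pushField 𝓘(ℝ, E) (prodModel E₁ E₂ E₃) f p (incl₁ p u) q,
      pushField 𝓘(ℝ, E) (prodModel E₁ E₂ E₃) f p (incl₂ p x) q⟫_ℝ) =ᶠ[𝓝 p] fun _ => (0 : ℝ) := by
    filter_upwards [eventually_pushField_incl₁ E E₁ E₂ E₃ f p,
      eventually_pushField_incl₂ E E₁ E₂ E₃ f p] with q h1 h2
    rw [h1, h2, hf.inner_D₁_D₂]
  rw [inducedMetricDeriv, eventually_mvfderiv_congr h, mvfderiv_const]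
  rfl

lemma inducedMetricDeriv₁₃ (p : L₁ × L₂ × L₃) (s : TangentSpace (prodModel E₁ E₂ E₃) p)
    (u : TangentSpace 𝓘(ℝ, E₁) p.1) (z : TangentSpace 𝓘(ℝ, E₃) p.2.2) :
    inducedMetricDeriv E E₁ E₂ E₃ f p s (incl₁ p u) (incl₃ p z) = 0 := by
  have h : (fun q => ⟪pushField 𝓘(ℝ, E) (prodModel E₁ E₂ E₃) f p (incl₁ p u) q,
      pushField 𝓘(ℝ, E) (prodModel E₁ E₂ E₃) f p (incl₃ p z) q⟫_ℝ) =ᶠ[𝓝 p] fun _ => (0 : ℝ) := by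
    filter_upwards [eventually_pushField_incl₁ E E₁ E₂ E₃ f p,
      eventually_pushField_incl₃ E E₁ E₂ E₃ f p] with q h1 h2
    rw [h1, h2, hf.inner_D₁_D₃]
  rw [inducedMetricDeriv, eventually_mvfderiv_congr h, mvfderiv_const]
  rfl

lemma inducedMetricDeriv₂₃ (p : L₁ × L₂ × L₃) (s : TangentSpace (prodModel E₁ E₂ E₃) p)
    (x : TangentSpace 𝓘(ℝ, E₂) p.2.1) (z : TangentSpace 𝓘(ℝ, E₃) p.2.2) :
    inducedMetricDeriv E E₁ E₂ E₃ f p s (incl₂ p x) (incl₃ p z) = 0 := by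
  have h : (fun q => ⟪pushField 𝓘(ℝ, E) (prodModel E₁ E₂ E₃) f p (incl₂ p x) q,
      pushField 𝓘(ℝ, E) (prodModel E₁ E₂ E₃) f p (incl₃ p z) q⟫_ℝ) =ᶠ[𝓝 p] fun _ => (0 : ℝ) := by
    filter_upwards [eventually_pushField_incl₂ E E₁ E₂ E₃ f p,
      eventually_pushField_incl₃ E E₁ E₂ E₃ f p] with q h1 h2
    rw [h1, h2, hf.inner_D₂_D₃]
  rw [inducedMetricDeriv, eventually_mvfderiv_congr h, mvfderiv_const]
  rfl

lemma inducedMetricDeriv₂₁₁ (p : L₁ × L₂ × L₃) (y : TangentSpace 𝓘(ℝ, E₂) p.2.1)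
    (u v : TangentSpace 𝓘(ℝ, E₁) p.1) :
    inducedMetricDeriv E E₁ E₂ E₃ f p (incl₂ p y) (incl₁ p u) (incl₁ p v) = 0 := by
  rw [inducedMetricDeriv,
    mvfderiv_incl₂ (mdifferentiableAt_inner_pushField hf.smooth_f p (incl₁ p u) (incl₁ p v)) y]
  have h : (fun b => ⟪pushField 𝓘(ℝ, E) (prodModel E₁ E₂ E₃) f p (incl₁ p u) (p.1, b, p.2.2),
      pushField 𝓘(ℝ, E) (prodModel E₁ E₂ E₃) f p (incl₁ p v) (p.1, b, p.2.2)⟫_ℝ) =ᶠ[𝓝 p.2.1]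
      fun _ => (⟪u, v⟫_ℝ : ℝ) := by
    filter_upwards [(eventually_slice (eventually_pushField_incl₁ E E₁ E₂ E₃ f p)).2.1] with b h1
    rw [h1, h1, hf.inner_D₁_D₁, coordField_self, coordField_self]
  rw [eventually_mvfderiv_congr h, mvfderiv_const]
  rfl

lemma inducedMetricDeriv₃₁₁ (p : L₁ × L₂ × L₃) (z : TangentSpace 𝓘(ℝ, E₃) p.2.2)
    (u v : TangentSpace 𝓘(ℝ, E₁) p.1) :
    inducedMetricDeriv E E₁ E₂ E₃ f p (incl₃ p z) (incl₁ p u) (incl₁ p v) = 0 := by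
  rw [inducedMetricDeriv,
    mvfderiv_incl₃ (mdifferentiableAt_inner_pushField hf.smooth_f p (incl₁ p u) (incl₁ p v)) z]
  have h : (fun c => ⟪pushField 𝓘(ℝ, E) (prodModel E₁ E₂ E₃) f p (incl₁ p u) (p.1, p.2.1, c),
      pushField 𝓘(ℝ, E) (prodModel E₁ E₂ E₃) f p (incl₁ p v) (p.1, p.2.1, c)⟫_ℝ) =ᶠ[𝓝 p.2.2]
      fun _ => (⟪u, v⟫_ℝ : ℝ) := by
    filter_upwards [(eventually_slice (eventually_pushField_incl₁ E E₁ E₂ E₃ f p)).2.2] with b h1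
    rw [h1, h1, hf.inner_D₁_D₁, coordField_self, coordField_self]
  rw [eventually_mvfderiv_congr h, mvfderiv_const]
  rfl

lemma inducedMetricDeriv₃₂₂ (p : L₁ × L₂ × L₃) (z : TangentSpace 𝓘(ℝ, E₃) p.2.2)
    (x y : TangentSpace 𝓘(ℝ, E₂) p.2.1) :
    inducedMetricDeriv E E₁ E₂ E₃ f p (incl₃ p z) (incl₂ p x) (incl₂ p y) = 0 := by
  rw [inducedMetricDeriv,
    mvfderiv_incl₃ (mdifferentiableAt_inner_pushField hf.smooth_f p (incl₂ p x) (incl₂ p y)) z]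
  have h : (fun c => ⟪pushField 𝓘(ℝ, E) (prodModel E₁ E₂ E₃) f p (incl₂ p x) (p.1, p.2.1, c),
      pushField 𝓘(ℝ, E) (prodModel E₁ E₂ E₃) f p (incl₂ p y) (p.1, p.2.1, c)⟫_ℝ) =ᶠ[𝓝 p.2.2]
      fun _ => (φ₁ p.1 ^ 2 * ⟪x, y⟫_ℝ : ℝ) := by
    filter_upwards [(eventually_slice (eventually_pushField_incl₂ E E₁ E₂ E₃ f p)).2.2] with b h1
    rw [h1, h1, hf.inner_D₂_D₂, coordField_self, coordField_self]
  rw [eventually_mvfderiv_congr h, mvfderiv_const]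
  rfl

lemma inducedMetricDeriv₂₃₃ (p : L₁ × L₂ × L₃) (x : TangentSpace 𝓘(ℝ, E₂) p.2.1)
    (z w : TangentSpace 𝓘(ℝ, E₃) p.2.2) :
    inducedMetricDeriv E E₁ E₂ E₃ f p (incl₂ p x) (incl₃ p z) (incl₃ p w) = 0 := by
  rw [inducedMetricDeriv,
    mvfderiv_incl₂ (mdifferentiableAt_inner_pushField hf.smooth_f p (incl₃ p z) (incl₃ p w)) x]
  have h : (fun b => ⟪pushField 𝓘(ℝ, E) (prodModel E₁ E₂ E₃) f p (incl₃ p z) (p.1, b, p.2.2),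
      pushField 𝓘(ℝ, E) (prodModel E₁ E₂ E₃) f p (incl₃ p w) (p.1, b, p.2.2)⟫_ℝ) =ᶠ[𝓝 p.2.1]
      fun _ => (φ₂ p.1 ^ 2 * ⟪z, w⟫_ℝ : ℝ) := by
    filter_upwards [(eventually_slice (eventually_pushField_incl₃ E E₁ E₂ E₃ f p)).2.1] with b h1
    rw [h1, h1, hf.inner_D₃_D₃, coordField_self, coordField_self]
  rw [eventually_mvfderiv_congr h, mvfderiv_const]
  rfl

lemma inducedMetricDeriv₁₂₂ (p : L₁ × L₂ × L₃) (u : TangentSpace 𝓘(ℝ, E₁) p.1)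
    (x y : TangentSpace 𝓘(ℝ, E₂) p.2.1) :
    inducedMetricDeriv E E₁ E₂ E₃ f p (incl₁ p u) (incl₂ p x) (incl₂ p y) =
      2 * mvfderiv 𝓘(ℝ, E₁) (fun a => Real.log (φ₁ a)) p.1 u *
        ⟪D₂ E E₁ E₂ E₃ f p x, D₂ E E₁ E₂ E₃ f p y⟫_ℝ := by
  rw [inducedMetricDeriv,
    mvfderiv_incl₁ (mdifferentiableAt_inner_pushField hf.smooth_f p (incl₂ p x) (incl₂ p y)) u]
  have h : (fun a => ⟪pushField 𝓘(ℝ, E) (prodModel E₁ E₂ E₃) f p (incl₂ p x) (a, p.2.1, p.2.2),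
      pushField 𝓘(ℝ, E) (prodModel E₁ E₂ E₃) f p (incl₂ p y) (a, p.2.1, p.2.2)⟫_ℝ) =ᶠ[𝓝 p.1]
      fun a => (φ₁ a ^ 2 * ⟪x, y⟫_ℝ : ℝ) := by
    filter_upwards [(eventually_slice (eventually_pushField_incl₂ E E₁ E₂ E₃ f p)).1] with a h1
    rw [h1, h1, hf.inner_D₂_D₂, coordField_self, coordField_self]
  rw [eventually_mvfderiv_congr h, mvfderiv_sq_mul hf.smooth_φ₁ hf.pos_φ₁, hf.inner_D₂_D₂]

lemma inducedMetricDeriv₁₃₃ (p : L₁ × L₂ × L₃) (u : TangentSpace 𝓘(ℝ, E₁) p.1)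
    (z w : TangentSpace 𝓘(ℝ, E₃) p.2.2) :
    inducedMetricDeriv E E₁ E₂ E₃ f p (incl₁ p u) (incl₃ p z) (incl₃ p w) =
      2 * mvfderiv 𝓘(ℝ, E₁) (fun a => Real.log (φ₂ a)) p.1 u *
        ⟪D₃ E E₁ E₂ E₃ f p z, D₃ E E₁ E₂ E₃ f p w⟫_ℝ := by
  rw [inducedMetricDeriv,
    mvfderiv_incl₁ (mdifferentiableAt_inner_pushField hf.smooth_f p (incl₃ p z) (incl₃ p w)) u]
  have h : (fun a => ⟪pushField 𝓘(ℝ, E) (prodModel E₁ E₂ E₃) f p (incl₃ p z) (a, p.2.1, p.2.2),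
      pushField 𝓘(ℝ, E) (prodModel E₁ E₂ E₃) f p (incl₃ p w) (a, p.2.1, p.2.2)⟫_ℝ) =ᶠ[𝓝 p.1]
      fun a => (φ₂ a ^ 2 * ⟪z, w⟫_ℝ : ℝ) := by
    filter_upwards [(eventually_slice (eventually_pushField_incl₃ E E₁ E₂ E₃ f p)).1] with a h1
    rw [h1, h1, hf.inner_D₃_D₃, coordField_self, coordField_self]
  rw [eventually_mvfderiv_congr h, mvfderiv_sq_mul hf.smooth_φ₂ hf.pos_φ₂, hf.inner_D₃_D₃]

end IsBiWarpedProductSubmanifold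
end Koszul

/-! ### The tangent spaces of the leaves -/

section Congr
variable {E : Type*} [NormedAddCommGroup E] [NormedSpace ℝ E] [FiniteDimensional ℝ E]
  {H : Type*} [TopologicalSpace H] {I : ModelWithCorners ℝ E H}
  {M : Type*} [TopologicalSpace M] [ChartedSpace H M]
  {E' : Type*} [NormedAddCommGroup E'] [NormedSpace ℝ E']
  {H' : Type*} [TopologicalSpace H'] {J : ModelWithCorners ℝ E' H'}
  {N : Type*} [TopologicalSpace N] [ChartedSpace H' N]
  [RiemannianBundle (fun x : M => TangentSpace I x)]
  [IsManifold I ∞ M] [IsContMDiffRiemannianBundle I ∞ E (fun x : M => TangentSpace I x)]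
  [FiniteDimensional ℝ E'] [J.Boundaryless] [IsManifold J ∞ N]

lemma covDerivAlong_congr {ι : N → M} {V W : Π q : N, TangentSpace I (ι q)} {p : N}
    (h : ∀ᶠ q in 𝓝 p, V q = W q) (u : TangentSpace J p) :
    covDerivAlong I J ι V p u = covDerivAlong I J ι W p u := by
  have h' : (fun q => components I (ι p) (ι q) (V q)) =ᶠ[𝓝 p]
      fun q => components I (ι p) (ι q) (W q) := h.mono fun q hq => by simp only [hq]
  rw [covDerivAlong_eq, covDerivAlong_eq, eventually_mvfderiv_congr h', h.self_of_nhds]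

lemma mem_tangentImage {ι : N → M} {p : N} {v : TangentSpace I (ι p)} :
    v ∈ tangentImage I J ι p ↔ ∃ u, mfderiv J I ι p u = v := Iff.rfl

lemma secondFundForm_eq_zero_iff {ι : N → M} {p : N} {u w : TangentSpace J p} :
    secondFundForm I J ι p u w = 0 ↔ secondDeriv I J ι p u w ∈ tangentImage I J ι p := by
  rw [secondFundForm_eq, Submodule.starProjection_apply_eq_zero_iff,
    Submodule.orthogonal_orthogonal]

end Congr

section Leaves
variable {E : Type*} [NormedAddCommGroup E] [NormedSpace ℝ E] [FiniteDimensional ℝ E]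
  {M : Type*} [TopologicalSpace M] [ChartedSpace E M] [IsManifold 𝓘(ℝ, E) ∞ M]
  [RiemannianBundle (fun x : M => TangentSpace 𝓘(ℝ, E) x)]
  [IsContMDiffRiemannianBundle 𝓘(ℝ, E) ∞ E (fun x : M => TangentSpace 𝓘(ℝ, E) x)]
  {E₁ : Type*} [NormedAddCommGroup E₁] [NormedSpace ℝ E₁] [FiniteDimensional ℝ E₁]
  {L₁ : Type*} [TopologicalSpace L₁] [ChartedSpace E₁ L₁] [IsManifold 𝓘(ℝ, E₁) ∞ L₁]
  {E₂ : Type*} [NormedAddCommGroup E₂] [NormedSpace ℝ E₂] [FiniteDimensional ℝ E₂]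
  {L₂ : Type*} [TopologicalSpace L₂] [ChartedSpace E₂ L₂] [IsManifold 𝓘(ℝ, E₂) ∞ L₂]
  {E₃ : Type*} [NormedAddCommGroup E₃] [NormedSpace ℝ E₃] [FiniteDimensional ℝ E₃]
  {L₃ : Type*} [TopologicalSpace L₃] [ChartedSpace E₃ L₃] [IsManifold 𝓘(ℝ, E₃) ∞ L₃]
  {f : L₁ × L₂ × L₃ → M}

lemma mem_tangentImage_iff (p : L₁ × L₂ × L₃) (v : TangentSpace 𝓘(ℝ, E) (f p)) :
    v ∈ tangentImage 𝓘(ℝ, E) (prodModel E₁ E₂ E₃) f p ↔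
      ∃ u x z, v = D₁ E E₁ E₂ E₃ f p u + D₂ E E₁ E₂ E₃ f p x + D₃ E E₁ E₂ E₃ f p z := by
  rw [mem_tangentImage]
  constructor
  · rintro ⟨w, rfl⟩
    obtain ⟨u, x, z, rfl⟩ := exists_eq_incl_add p w
    exact ⟨u, x, z, by rw [map_add, map_add]; rfl⟩
  · rintro ⟨u, x, z, rfl⟩
    exact ⟨incl₁ p u + incl₂ p x + incl₃ p z, by rw [map_add, map_add]; rfl⟩

lemma mem_tangentImage_orthogonal_iff (p : L₁ × L₂ × L₃) (v : TangentSpace 𝓘(ℝ, E) (f p)) :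
    v ∈ (tangentImage 𝓘(ℝ, E) (prodModel E₁ E₂ E₃) f p)ᗮ ↔
      (∀ u, ⟪D₁ E E₁ E₂ E₃ f p u, v⟫_ℝ = 0) ∧ (∀ x, ⟪D₂ E E₁ E₂ E₃ f p x, v⟫_ℝ = 0) ∧
        (∀ z, ⟪D₃ E E₁ E₂ E₃ f p z, v⟫_ℝ = 0) := by
  rw [Submodule.mem_orthogonal]
  constructor
  · exact fun h => ⟨fun u => h _ ⟨_, rfl⟩, fun x => h _ ⟨_, rfl⟩, fun z => h _ ⟨_, rfl⟩⟩
  · rintro ⟨h1, h2, h3⟩ w hw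
    obtain ⟨u, x, z, rfl⟩ := (mem_tangentImage_iff p w).1 hw
    rw [inner_add_left, inner_add_left, h1, h2, h3, add_zero, add_zero]

lemma eq_zero_of_mem_tangentImage {p : L₁ × L₂ × L₃} {v : TangentSpace 𝓘(ℝ, E) (f p)}
    (hv : v ∈ tangentImage 𝓘(ℝ, E) (prodModel E₁ E₂ E₃) f p)
    (h₁ : ∀ u, ⟪D₁ E E₁ E₂ E₃ f p u, v⟫_ℝ = 0) (h₂ : ∀ x, ⟪D₂ E E₁ E₂ E₃ f p x, v⟫_ℝ = 0)
    (h₃ : ∀ z, ⟪D₃ E E₁ E₂ E₃ f p z, v⟫_ℝ = 0) : v = 0 := by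
  have h := (mem_tangentImage_orthogonal_iff p v).2 ⟨h₁, h₂, h₃⟩
  exact inner_self_eq_zero.1 ((Submodule.mem_orthogonal _ _).1 h v hv)

variable (hf : ContMDiff (prodModel E₁ E₂ E₃) 𝓘(ℝ, E) ∞ f)
include hf

lemma mfderiv_leaf₁ (p : L₁ × L₂ × L₃) :
    mfderiv 𝓘(ℝ, E₁) 𝓘(ℝ, E) (leaf₁ f p.2.1 p.2.2) p.1 = D₁ E E₁ E₂ E₃ f p :=
  (((hf p).mdifferentiableAt (by simp)).hasMFDerivAt.comp p.1 (hasMFDerivAt_slice₁ p)).mfderiv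

lemma mfderiv_leaf₂ (p : L₁ × L₂ × L₃) :
    mfderiv 𝓘(ℝ, E₂) 𝓘(ℝ, E) (leaf₂ f p.1 p.2.2) p.2.1 = D₂ E E₁ E₂ E₃ f p :=
  (((hf p).mdifferentiableAt (by simp)).hasMFDerivAt.comp p.2.1 (hasMFDerivAt_slice₂ p)).mfderiv

lemma mfderiv_leaf₃ (p : L₁ × L₂ × L₃) :
    mfderiv 𝓘(ℝ, E₃) 𝓘(ℝ, E) (leaf₃ f p.1 p.2.1) p.2.2 = D₃ E E₁ E₂ E₃ f p :=
  (((hf p).mdifferentiableAt (by simp)).hasMFDerivAt.comp p.2.2 (hasMFDerivAt_slice₃ p)).mfderiv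

/-- The second derivatives of a leaf are those of `f`, and similarly for the other factors. -/
lemma secondDeriv_leaf₁ (p : L₁ × L₂ × L₃) (u v : TangentSpace 𝓘(ℝ, E₁) p.1) :
    secondDeriv 𝓘(ℝ, E) 𝓘(ℝ, E₁) (leaf₁ f p.2.1 p.2.2) p.1 u v =
      secondDeriv 𝓘(ℝ, E) (prodModel E₁ E₂ E₃) f p (incl₁ p u) (incl₁ p v) := by
  have hj := hasMFDerivAt_slice₁ (E₁ := E₁) (E₂ := E₂) (E₃ := E₃) p
  have h1 := (diffAlongAt_pushField hf p (incl₁ p v)).covDerivAlong_comp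
    (j := fun a => (a, p.2.1, p.2.2)) (p := p.1) hj.mdifferentiableAt u
  rw [hj.mfderiv] at h1
  refine Eq.trans ?_ h1
  refine covDerivAlong_congr ?_ u
  filter_upwards [(eventually_slice (eventually_pushField_incl₁ E E₁ E₂ E₃ f p)).1] with a ha
  rw [ha]
  exact congrArg
    (fun L : TangentSpace 𝓘(ℝ, E₁) a →L[ℝ] TangentSpace 𝓘(ℝ, E) (f (a, p.2.1, p.2.2)) =>
      L (coordField 𝓘(ℝ, E₁) p.1 v a)) (mfderiv_leaf₁ hf (a, p.2.1, p.2.2))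

lemma secondDeriv_leaf₂ (p : L₁ × L₂ × L₃) (x y : TangentSpace 𝓘(ℝ, E₂) p.2.1) :
    secondDeriv 𝓘(ℝ, E) 𝓘(ℝ, E₂) (leaf₂ f p.1 p.2.2) p.2.1 x y =
      secondDeriv 𝓘(ℝ, E) (prodModel E₁ E₂ E₃) f p (incl₂ p x) (incl₂ p y) := by
  have hj := hasMFDerivAt_slice₂ (E₁ := E₁) (E₂ := E₂) (E₃ := E₃) p
  have h1 := (diffAlongAt_pushField hf p (incl₂ p y)).covDerivAlong_comp
    (j := fun b => (p.1, b, p.2.2)) (p := p.2.1) hj.mdifferentiableAt x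
  rw [hj.mfderiv] at h1
  refine Eq.trans ?_ h1
  refine covDerivAlong_congr ?_ x
  filter_upwards [(eventually_slice (eventually_pushField_incl₂ E E₁ E₂ E₃ f p)).2.1] with a ha
  rw [ha]
  exact congrArg (fun L : TangentSpace 𝓘(ℝ, E₂) a →L[ℝ] TangentSpace 𝓘(ℝ, E) (f (p.1, a, p.2.2)) =>
    L (coordField 𝓘(ℝ, E₂) p.2.1 y a)) (mfderiv_leaf₂ hf (p.1, a, p.2.2))

lemma secondDeriv_leaf₃ (p : L₁ × L₂ × L₃) (z w : TangentSpace 𝓘(ℝ, E₃) p.2.2) :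
    secondDeriv 𝓘(ℝ, E) 𝓘(ℝ, E₃) (leaf₃ f p.1 p.2.1) p.2.2 z w =
      secondDeriv 𝓘(ℝ, E) (prodModel E₁ E₂ E₃) f p (incl₃ p z) (incl₃ p w) := by
  have hj := hasMFDerivAt_slice₃ (E₁ := E₁) (E₂ := E₂) (E₃ := E₃) p
  have h1 := (diffAlongAt_pushField hf p (incl₃ p w)).covDerivAlong_comp
    (j := fun c => (p.1, p.2.1, c)) (p := p.2.2) hj.mdifferentiableAt z
  rw [hj.mfderiv] at h1
  refine Eq.trans ?_ h1
  refine covDerivAlong_congr ?_ z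
  filter_upwards [(eventually_slice (eventually_pushField_incl₃ E E₁ E₂ E₃ f p)).2.2] with a ha
  rw [ha]
  exact congrArg (fun L : TangentSpace 𝓘(ℝ, E₃) a →L[ℝ] TangentSpace 𝓘(ℝ, E) (f (p.1, p.2.1, a)) =>
    L (coordField 𝓘(ℝ, E₃) p.2.2 w a)) (mfderiv_leaf₃ hf (p.1, p.2.1, a))

end Leaves

/-! ### The Christoffel symbols of the bi-warped product -/

section ChristoffelValues
variable {E : Type*} [NormedAddCommGroup E] [NormedSpace ℝ E] [FiniteDimensional ℝ E]
  {M : Type*} [TopologicalSpace M] [ChartedSpace E M] [IsManifold 𝓘(ℝ, E) ∞ M]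
  [RiemannianBundle (fun x : M => TangentSpace 𝓘(ℝ, E) x)]
  [IsContMDiffRiemannianBundle 𝓘(ℝ, E) ∞ E (fun x : M => TangentSpace 𝓘(ℝ, E) x)]
  {E₁ : Type*} [NormedAddCommGroup E₁] [NormedSpace ℝ E₁] [FiniteDimensional ℝ E₁]
  {L₁ : Type*} [TopologicalSpace L₁] [ChartedSpace E₁ L₁] [IsManifold 𝓘(ℝ, E₁) ∞ L₁]
  [RiemannianBundle (fun x : L₁ => TangentSpace 𝓘(ℝ, E₁) x)]
  {E₂ : Type*} [NormedAddCommGroup E₂] [NormedSpace ℝ E₂] [FiniteDimensional ℝ E₂]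
  {L₂ : Type*} [TopologicalSpace L₂] [ChartedSpace E₂ L₂] [IsManifold 𝓘(ℝ, E₂) ∞ L₂]
  [RiemannianBundle (fun x : L₂ => TangentSpace 𝓘(ℝ, E₂) x)]
  {E₃ : Type*} [NormedAddCommGroup E₃] [NormedSpace ℝ E₃] [FiniteDimensional ℝ E₃]
  {L₃ : Type*} [TopologicalSpace L₃] [ChartedSpace E₃ L₃] [IsManifold 𝓘(ℝ, E₃) ∞ L₃]
  [RiemannianBundle (fun x : L₃ => TangentSpace 𝓘(ℝ, E₃) x)]
  {f : L₁ × L₂ × L₃ → M} {φ₁ φ₂ : L₁ → ℝ}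

namespace IsBiWarpedProductSubmanifold
variable (hf : IsBiWarpedProductSubmanifold (E := E) (E₁ := E₁) (E₂ := E₂) (E₃ := E₃) f φ₁ φ₂)
include hf

/-- In this and the following lemmas, the subscripts number the factors to which the three arguments
are tangent. -/
lemma christoffelFirst₁₁₂ (p : L₁ × L₂ × L₃) (u v : TangentSpace 𝓘(ℝ, E₁) p.1)
    (y : TangentSpace 𝓘(ℝ, E₂) p.2.1) :
    christoffelFirst E E₁ E₂ E₃ f p (incl₁ p u) (incl₁ p v) (incl₂ p y) = 0 := by
  have h := two_mul_christoffelFirst hf.smooth_f p (incl₁ p u) (incl₁ p v) (incl₂ p y)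
  rw [hf.inducedMetricDeriv₂₁₁, hf.inducedMetricDeriv₁₂, hf.inducedMetricDeriv₁₂] at h
  linarith

lemma christoffelFirst₂₁₂ (p : L₁ × L₂ × L₃) (x : TangentSpace 𝓘(ℝ, E₂) p.2.1)
    (u : TangentSpace 𝓘(ℝ, E₁) p.1) (y : TangentSpace 𝓘(ℝ, E₂) p.2.1) :
    christoffelFirst E E₁ E₂ E₃ f p (incl₂ p x) (incl₁ p u) (incl₂ p y) =
      mvfderiv 𝓘(ℝ, E₁) (fun a => Real.log (φ₁ a)) p.1 u *
        ⟪D₂ E E₁ E₂ E₃ f p x, D₂ E E₁ E₂ E₃ f p y⟫_ℝ := by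
  have h := two_mul_christoffelFirst hf.smooth_f p (incl₂ p x) (incl₁ p u) (incl₂ p y)
  rw [hf.inducedMetricDeriv₁₂, inducedMetricDeriv_comm p _ (incl₂ p x) (incl₁ p u),
    hf.inducedMetricDeriv₁₂, hf.inducedMetricDeriv₁₂₂] at h
  linarith

lemma christoffelFirst₂₂₁ (p : L₁ × L₂ × L₃) (x y : TangentSpace 𝓘(ℝ, E₂) p.2.1)
    (u : TangentSpace 𝓘(ℝ, E₁) p.1) :
    christoffelFirst E E₁ E₂ E₃ f p (incl₂ p x) (incl₂ p y) (incl₁ p u) =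
      -(mvfderiv 𝓘(ℝ, E₁) (fun a => Real.log (φ₁ a)) p.1 u *
        ⟪D₂ E E₁ E₂ E₃ f p x, D₂ E E₁ E₂ E₃ f p y⟫_ℝ) := by
  have h := two_mul_christoffelFirst hf.smooth_f p (incl₂ p x) (incl₂ p y) (incl₁ p u)
  rw [inducedMetricDeriv_comm p _ (incl₂ p y), inducedMetricDeriv_comm p _ (incl₂ p x) (incl₁ p u),
    hf.inducedMetricDeriv₁₂, hf.inducedMetricDeriv₁₂, hf.inducedMetricDeriv₁₂₂] at h
  linarith

lemma christoffelFirst₂₂₃ (p : L₁ × L₂ × L₃) (x y : TangentSpace 𝓘(ℝ, E₂) p.2.1)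
    (z : TangentSpace 𝓘(ℝ, E₃) p.2.2) :
    christoffelFirst E E₁ E₂ E₃ f p (incl₂ p x) (incl₂ p y) (incl₃ p z) = 0 := by
  have h := two_mul_christoffelFirst hf.smooth_f p (incl₂ p x) (incl₂ p y) (incl₃ p z)
  rw [hf.inducedMetricDeriv₂₃, hf.inducedMetricDeriv₂₃, hf.inducedMetricDeriv₃₂₂] at h
  linarith

lemma christoffelFirst₃₁₁ (p : L₁ × L₂ × L₃) (z : TangentSpace 𝓘(ℝ, E₃) p.2.2)
    (u v : TangentSpace 𝓘(ℝ, E₁) p.1) :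
    christoffelFirst E E₁ E₂ E₃ f p (incl₃ p z) (incl₁ p u) (incl₁ p v) = 0 := by
  have h := two_mul_christoffelFirst hf.smooth_f p (incl₃ p z) (incl₁ p u) (incl₁ p v)
  rw [hf.inducedMetricDeriv₃₁₁, inducedMetricDeriv_comm p _ (incl₃ p z),
    inducedMetricDeriv_comm p _ (incl₃ p z), hf.inducedMetricDeriv₁₃,
    hf.inducedMetricDeriv₁₃] at h
  linarith

lemma christoffelFirst₁₁₃ (p : L₁ × L₂ × L₃) (u v : TangentSpace 𝓘(ℝ, E₁) p.1)
    (z : TangentSpace 𝓘(ℝ, E₃) p.2.2) :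
    christoffelFirst E E₁ E₂ E₃ f p (incl₁ p u) (incl₁ p v) (incl₃ p z) = 0 := by
  have h := two_mul_christoffelFirst hf.smooth_f p (incl₁ p u) (incl₁ p v) (incl₃ p z)
  rw [hf.inducedMetricDeriv₃₁₁, hf.inducedMetricDeriv₁₃, hf.inducedMetricDeriv₁₃] at h
  linarith

lemma christoffelFirst₃₁₂ (p : L₁ × L₂ × L₃) (z : TangentSpace 𝓘(ℝ, E₃) p.2.2)
    (u : TangentSpace 𝓘(ℝ, E₁) p.1) (x : TangentSpace 𝓘(ℝ, E₂) p.2.1) :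
    christoffelFirst E E₁ E₂ E₃ f p (incl₃ p z) (incl₁ p u) (incl₂ p x) = 0 := by
  have h := two_mul_christoffelFirst hf.smooth_f p (incl₃ p z) (incl₁ p u) (incl₂ p x)
  rw [inducedMetricDeriv_comm p _ (incl₃ p z) (incl₁ p u),
    inducedMetricDeriv_comm p _ (incl₃ p z) (incl₂ p x), hf.inducedMetricDeriv₁₃,
    hf.inducedMetricDeriv₂₃, hf.inducedMetricDeriv₁₂] at h
  linarith

lemma christoffelFirst₃₁₃ (p : L₁ × L₂ × L₃) (z : TangentSpace 𝓘(ℝ, E₃) p.2.2)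
    (u : TangentSpace 𝓘(ℝ, E₁) p.1) (w : TangentSpace 𝓘(ℝ, E₃) p.2.2) :
    christoffelFirst E E₁ E₂ E₃ f p (incl₃ p z) (incl₁ p u) (incl₃ p w) =
      mvfderiv 𝓘(ℝ, E₁) (fun a => Real.log (φ₂ a)) p.1 u *
        ⟪D₃ E E₁ E₂ E₃ f p z, D₃ E E₁ E₂ E₃ f p w⟫_ℝ := by
  have h := two_mul_christoffelFirst hf.smooth_f p (incl₃ p z) (incl₁ p u) (incl₃ p w)
  rw [hf.inducedMetricDeriv₁₃, inducedMetricDeriv_comm p _ (incl₃ p z) (incl₁ p u),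
    hf.inducedMetricDeriv₁₃, hf.inducedMetricDeriv₁₃₃] at h
  linarith

lemma christoffelFirst₃₃₁ (p : L₁ × L₂ × L₃) (z w : TangentSpace 𝓘(ℝ, E₃) p.2.2)
    (u : TangentSpace 𝓘(ℝ, E₁) p.1) :
    christoffelFirst E E₁ E₂ E₃ f p (incl₃ p z) (incl₃ p w) (incl₁ p u) =
      -(mvfderiv 𝓘(ℝ, E₁) (fun a => Real.log (φ₂ a)) p.1 u *
        ⟪D₃ E E₁ E₂ E₃ f p z, D₃ E E₁ E₂ E₃ f p w⟫_ℝ) := by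
  have h := two_mul_christoffelFirst hf.smooth_f p (incl₃ p z) (incl₃ p w) (incl₁ p u)
  rw [inducedMetricDeriv_comm p _ (incl₃ p w), inducedMetricDeriv_comm p _ (incl₃ p z) (incl₁ p u),
    hf.inducedMetricDeriv₁₃, hf.inducedMetricDeriv₁₃, hf.inducedMetricDeriv₁₃₃] at h
  linarith

lemma christoffelFirst₃₃₂ (p : L₁ × L₂ × L₃) (z w : TangentSpace 𝓘(ℝ, E₃) p.2.2)
    (x : TangentSpace 𝓘(ℝ, E₂) p.2.1) :
    christoffelFirst E E₁ E₂ E₃ f p (incl₃ p z) (incl₃ p w) (incl₂ p x) = 0 := by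
  have h := two_mul_christoffelFirst hf.smooth_f p (incl₃ p z) (incl₃ p w) (incl₂ p x)
  rw [inducedMetricDeriv_comm p _ (incl₃ p z) (incl₂ p x),
    inducedMetricDeriv_comm p _ (incl₃ p w) (incl₂ p x),
    hf.inducedMetricDeriv₂₃, hf.inducedMetricDeriv₂₃, hf.inducedMetricDeriv₂₃₃] at h
  linarith

end IsBiWarpedProductSubmanifold
end ChristoffelValues

/-! ### Functions with vanishing derivative -/

section LocallyConstant

lemma eventually_eq_of_mvfderiv_eq_zero {E : Type*} [NormedAddCommGroup E] [NormedSpace ℝ E]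
    {M : Type*} [TopologicalSpace M] [ChartedSpace E M] [IsManifold 𝓘(ℝ, E) ∞ M] {g : M → ℝ}
    (hg : ∀ x, MDifferentiableAt 𝓘(ℝ, E) 𝓘(ℝ, ℝ) g x)
    (h0 : ∀ x (v : TangentSpace 𝓘(ℝ, E) x), mvfderiv 𝓘(ℝ, E) g x v = 0) (x : M) :
    ∀ᶠ y in 𝓝 x, g y = g x := by
  set χ := extChartAt 𝓘(ℝ, E) x with hχ
  have ht : χ.target ∈ 𝓝 (χ x) := extChartAt_target_mem_nhds x
  obtain ⟨ε, hε, hball⟩ := Metric.mem_nhds_iff.1 ht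
  have hd : ∀ y ∈ Metric.ball (χ x) ε, HasFDerivAt (fun y => g (χ.symm y)) (0 : E →L[ℝ] ℝ) y := by
    intro y hy
    have hs : MDifferentiableAt 𝓘(ℝ, E) 𝓘(ℝ, E) χ.symm y := by
      have h1 := mdifferentiableWithinAt_extChartAt_symm (I := 𝓘(ℝ, E)) (hball hy)
      rwa [modelWithCornersSelf_coe, Set.range_id, mdifferentiableWithinAt_univ] at h1
    have h1 := ((hg (χ.symm y)).comp y hs)
    have h2 : mfderiv 𝓘(ℝ, E) 𝓘(ℝ, ℝ) (fun y => g (χ.symm y)) y = 0 := by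
      ext v
      exact (mvfderiv_comp_along (ι := χ.symm) (p := y) (hg (χ.symm y)) hs v).trans (h0 _ _)
    have h3 := h1.differentiableAt.hasFDerivAt
    rwa [← mfderiv_eq_fderiv, show mfderiv 𝓘(ℝ, E) 𝓘(ℝ, ℝ) (g ∘ χ.symm) y = 0 from h2] at h3
  have hc : ∀ y ∈ Metric.ball (χ x) ε, g (χ.symm y) = g (χ.symm (χ x)) := fun y hy =>
    (convex_ball (χ x) ε).is_const_of_fderivWithin_eq_zero (𝕜 := ℝ)
      (fun y hy => (hd y hy).differentiableAt.differentiableWithinAt)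
      (fun y hy => (hd y hy).hasFDerivWithinAt.fderivWithin
        (Metric.isOpen_ball.uniqueDiffWithinAt hy)) hy (Metric.mem_ball_self hε)
  filter_upwards [(continuousAt_extChartAt (I := 𝓘(ℝ, E)) x).eventually (Metric.ball_mem_nhds _ hε),
    extChartAt_source_mem_nhds (I := 𝓘(ℝ, E)) x] with y hy hys
  have h := hc (χ y) hy
  rwa [χ.left_inv hys, χ.left_inv (mem_extChartAt_source x)] at h

end LocallyConstant

/-! ### Differentiating the structure tensors on a submanifold -/

section PushFieldCalculus
variable {E : Type*} [NormedAddCommGroup E] [NormedSpace ℝ E] [FiniteDimensional ℝ E]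
  {M : Type*} [TopologicalSpace M] [ChartedSpace E M] [IsManifold 𝓘(ℝ, E) ∞ M]
  [RiemannianBundle (fun x : M => TangentSpace 𝓘(ℝ, E) x)]
  [IsContMDiffRiemannianBundle 𝓘(ℝ, E) ∞ E (fun x : M => TangentSpace 𝓘(ℝ, E) x)]
  {E' : Type*} [NormedAddCommGroup E'] [NormedSpace ℝ E'] [FiniteDimensional ℝ E']
  {H' : Type*} [TopologicalSpace H'] {J : ModelWithCorners ℝ E' H'} [J.Boundaryless]
  {N : Type*} [TopologicalSpace N] [ChartedSpace H' N] [IsManifold J ∞ N]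
  {S : AlmostContactMetric E M} {β : M → ℝ}

namespace AlmostContactMetric.IsLocallyConformalAlmostCosymplectic
variable (hS : S.IsLocallyConformalAlmostCosymplectic β) {f : N → M}
  (hf : ContMDiff J 𝓘(ℝ, E) ∞ f) (p : N)
include hS hf

lemma mdifferentiableAt_inner_Φ_pushField (w w' : TangentSpace J p) :
    MDifferentiableAt J 𝓘(ℝ, ℝ) (fun q => ⟪S.Φ (f q) (pushField 𝓘(ℝ, E) J f p w q),
      pushField 𝓘(ℝ, E) J f p w' q⟫_ℝ) p :=
  ((hS.covDerivAlong_Φ (diffAlongAt_pushField hf p w) 0).1).inner (diffAlongAt_pushField hf p w')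

lemma mvfderiv_inner_Φ_pushField (s w w' : TangentSpace J p) :
    mvfderiv J (fun q => ⟪S.Φ (f q) (pushField 𝓘(ℝ, E) J f p w q),
      pushField 𝓘(ℝ, E) J f p w' q⟫_ℝ) p s =
    ⟪S.Φ (f p) (secondDeriv 𝓘(ℝ, E) J f p s w), mfderiv J 𝓘(ℝ, E) f p w'⟫_ℝ +
      β (f p) * (⟪S.Φ (f p) (mfderiv J 𝓘(ℝ, E) f p s), mfderiv J 𝓘(ℝ, E) f p w⟫_ℝ *
          ⟪S.ξ (f p), mfderiv J 𝓘(ℝ, E) f p w'⟫_ℝ -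
        ⟪S.ξ (f p), mfderiv J 𝓘(ℝ, E) f p w⟫_ℝ *
          ⟪S.Φ (f p) (mfderiv J 𝓘(ℝ, E) f p s), mfderiv J 𝓘(ℝ, E) f p w'⟫_ℝ) +
      ⟪S.Φ (f p) (mfderiv J 𝓘(ℝ, E) f p w), secondDeriv 𝓘(ℝ, E) J f p s w'⟫_ℝ := by
  have h := hS.covDerivAlong_Φ (diffAlongAt_pushField hf p w) s
  rw [h.1.mvfderiv_inner (diffAlongAt_pushField hf p w'), h.2, pushField_self, pushField_self,
    inner_add_left, real_inner_smul_left, inner_sub_left, real_inner_smul_left,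
    real_inner_smul_left, S.η_eq_inner]
  rfl

lemma mdifferentiableAt_inner_ξ_pushField (w : TangentSpace J p) :
    MDifferentiableAt J 𝓘(ℝ, ℝ) (fun q => ⟪S.ξ (f q), pushField 𝓘(ℝ, E) J f p w q⟫_ℝ) p :=
  (hS.covDerivAlong_ξ ((hf p).mdifferentiableAt (by simp)) 0).1.inner (diffAlongAt_pushField hf p w)

lemma mvfderiv_inner_ξ_pushField (s w : TangentSpace J p) :
    mvfderiv J (fun q => ⟪S.ξ (f q), pushField 𝓘(ℝ, E) J f p w q⟫_ℝ) p s =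
      β (f p) * (⟪mfderiv J 𝓘(ℝ, E) f p s, mfderiv J 𝓘(ℝ, E) f p w⟫_ℝ -
        ⟪S.ξ (f p), mfderiv J 𝓘(ℝ, E) f p s⟫_ℝ * ⟪S.ξ (f p), mfderiv J 𝓘(ℝ, E) f p w⟫_ℝ) +
      ⟪S.ξ (f p), secondDeriv 𝓘(ℝ, E) J f p s w⟫_ℝ := by
  have h := hS.covDerivAlong_ξ ((hf p).mdifferentiableAt (by simp)) s
  rw [h.1.mvfderiv_inner (diffAlongAt_pushField hf p w), h.2, pushField_self,
    real_inner_smul_left, inner_sub_left, real_inner_smul_left, S.η_eq_inner]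
  rfl

end AlmostContactMetric.IsLocallyConformalAlmostCosymplectic
end PushFieldCalculus

/-! ### Gradients -/

section RieszVector
variable {V : Type*} [NormedAddCommGroup V] [InnerProductSpace ℝ V] [FiniteDimensional ℝ V]

/-- The vector representing a linear form with respect to the inner product. -/
def rieszVector (G : V →L[ℝ] ℝ) : V :=
  ∑ i, G (stdOrthonormalBasis ℝ V i) • stdOrthonormalBasis ℝ V i

lemma inner_rieszVector (G : V →L[ℝ] ℝ) (v : V) : ⟪rieszVector G, v⟫_ℝ = G v := by
  conv_rhs => rw [← (stdOrthonormalBasis ℝ V).sum_repr' v, map_sum]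
  rw [rieszVector, sum_inner]
  refine Finset.sum_congr rfl fun i _ => ?_
  rw [real_inner_smul_left, map_smul, smul_eq_mul, mul_comm]

lemma sum_sq_eq_inner_rieszVector (G : V →L[ℝ] ℝ) :
    ∑ i, G (stdOrthonormalBasis ℝ V i) ^ 2 = ⟪rieszVector G, rieszVector G⟫_ℝ := by
  rw [inner_rieszVector]
  conv_rhs => rw [rieszVector, map_sum]
  refine Finset.sum_congr rfl fun i _ => ?_
  rw [map_smul, smul_eq_mul, sq]

end RieszVector

/-! ### The invariant factor -/

section Contact
variable {E : Type*} [NormedAddCommGroup E] [NormedSpace ℝ E] [FiniteDimensional ℝ E]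
  {M : Type*} [TopologicalSpace M] [ChartedSpace E M] [IsManifold 𝓘(ℝ, E) ∞ M]
  [RiemannianBundle (fun x : M => TangentSpace 𝓘(ℝ, E) x)]
  [IsContMDiffRiemannianBundle 𝓘(ℝ, E) ∞ E (fun x : M => TangentSpace 𝓘(ℝ, E) x)]
  {E₁ : Type*} [NormedAddCommGroup E₁] [NormedSpace ℝ E₁] [FiniteDimensional ℝ E₁]
  {L₁ : Type*} [TopologicalSpace L₁] [ChartedSpace E₁ L₁] [IsManifold 𝓘(ℝ, E₁) ∞ L₁]
  [RiemannianBundle (fun x : L₁ => TangentSpace 𝓘(ℝ, E₁) x)]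
  {E₂ : Type*} [NormedAddCommGroup E₂] [NormedSpace ℝ E₂] [FiniteDimensional ℝ E₂]
  {L₂ : Type*} [TopologicalSpace L₂] [ChartedSpace E₂ L₂] [IsManifold 𝓘(ℝ, E₂) ∞ L₂]
  [RiemannianBundle (fun x : L₂ => TangentSpace 𝓘(ℝ, E₂) x)]
  {E₃ : Type*} [NormedAddCommGroup E₃] [NormedSpace ℝ E₃] [FiniteDimensional ℝ E₃]
  {L₃ : Type*} [TopologicalSpace L₃] [ChartedSpace E₃ L₃] [IsManifold 𝓘(ℝ, E₃) ∞ L₃]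
  [RiemannianBundle (fun x : L₃ => TangentSpace 𝓘(ℝ, E₃) x)]
  {f : L₁ × L₂ × L₃ → M} {φ₁ φ₂ : L₁ → ℝ} {S : AlmostContactMetric E M} {β : M → ℝ} {ν : ℝ}

lemma gradNormSq_eq (φ : L₁ → ℝ) (a : L₁) : gradNormSq 𝓘(ℝ, E₁) φ a =
    ⟪rieszVector (mvfderiv 𝓘(ℝ, E₁) φ a), rieszVector (mvfderiv 𝓘(ℝ, E₁) φ a)⟫_ℝ :=
  sum_sq_eq_inner_rieszVector (V := TangentSpace 𝓘(ℝ, E₁) a) (mvfderiv 𝓘(ℝ, E₁) φ a)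

lemma exists_D₁_eq_ξ (hf : ContMDiff (prodModel E₁ E₂ E₃) 𝓘(ℝ, E) ∞ f)
    (hξ : ∀ b c, S.IsTangentToReeb E₁ (leaf₁ f b c)) (p : L₁ × L₂ × L₃) :
    ∃ r, D₁ E E₁ E₂ E₃ f p r = S.ξ (f p) := by
  obtain ⟨r, hr⟩ := hξ p.2.1 p.2.2 p.1
  refine ⟨r, ?_⟩
  rw [← mfderiv_leaf₁ hf p]
  exact hr

lemma exists_D₂_eq_Φ (hf : ContMDiff (prodModel E₁ E₂ E₃) 𝓘(ℝ, E) ∞ f)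
    (hT : ∀ a c, S.IsInvariant E₂ (leaf₂ f a c)) (p : L₁ × L₂ × L₃)
    (x : TangentSpace 𝓘(ℝ, E₂) p.2.1) :
    ∃ y, D₂ E E₁ E₂ E₃ f p y = S.Φ (f p) (D₂ E E₁ E₂ E₃ f p x) := by
  obtain ⟨y, hy⟩ := hT p.1 p.2.2 p.2.1 (D₂ E E₁ E₂ E₃ f p x)
    (by rw [← mfderiv_leaf₂ hf p]; exact ⟨x, rfl⟩)
  refine ⟨y, ?_⟩
  rw [← mfderiv_leaf₂ hf p]
  rw [← mfderiv_leaf₂ hf p] at hy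
  exact hy

namespace IsBiWarpedProductSubmanifold
variable (hf : IsBiWarpedProductSubmanifold (E := E) (E₁ := E₁) (E₂ := E₂) (E₃ := E₃) f φ₁ φ₂)
include hf

lemma inner_ξ_D₂ (hξ : ∀ b c, S.IsTangentToReeb E₁ (leaf₁ f b c)) (p : L₁ × L₂ × L₃)
    (x : TangentSpace 𝓘(ℝ, E₂) p.2.1) : ⟪S.ξ (f p), D₂ E E₁ E₂ E₃ f p x⟫_ℝ = 0 := by
  obtain ⟨r, hr⟩ := exists_D₁_eq_ξ hf.smooth_f hξ p
  rw [← hr, hf.inner_D₁_D₂]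

lemma inner_ξ_D₃ (hξ : ∀ b c, S.IsTangentToReeb E₁ (leaf₁ f b c)) (p : L₁ × L₂ × L₃)
    (z : TangentSpace 𝓘(ℝ, E₃) p.2.2) : ⟪S.ξ (f p), D₃ E E₁ E₂ E₃ f p z⟫_ℝ = 0 := by
  obtain ⟨r, hr⟩ := exists_D₁_eq_ξ hf.smooth_f hξ p
  rw [← hr, hf.inner_D₁_D₃]

lemma inner_Φ_D₁_D₂ (hT : ∀ a c, S.IsInvariant E₂ (leaf₂ f a c)) (p : L₁ × L₂ × L₃)
    (u : TangentSpace 𝓘(ℝ, E₁) p.1) (x : TangentSpace 𝓘(ℝ, E₂) p.2.1) :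
    ⟪S.Φ (f p) (D₁ E E₁ E₂ E₃ f p u), D₂ E E₁ E₂ E₃ f p x⟫_ℝ = 0 := by
  obtain ⟨y, hy⟩ := exists_D₂_eq_Φ hf.smooth_f hT p x
  rw [S.inner_Φ_left, ← hy, hf.inner_D₁_D₂, neg_zero]

/-- The derivative of `⟪Φ U, X⟫ = 0` along the invariant leaf. -/
lemma invariant_leaf_identity (hS : S.IsLocallyConformalAlmostCosymplectic β)
    (hξ : ∀ b c, S.IsTangentToReeb E₁ (leaf₁ f b c))
    (hT : ∀ a c, S.IsInvariant E₂ (leaf₂ f a c)) (p : L₁ × L₂ × L₃)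
    (u : TangentSpace 𝓘(ℝ, E₁) p.1) (x y : TangentSpace 𝓘(ℝ, E₂) p.2.1) :
    (mvfderiv 𝓘(ℝ, E₁) (fun a => Real.log (φ₁ a)) p.1 u -
        β (f p) * ⟪S.ξ (f p), D₁ E E₁ E₂ E₃ f p u⟫_ℝ) *
      ⟪S.Φ (f p) (D₂ E E₁ E₂ E₃ f p y), D₂ E E₁ E₂ E₃ f p x⟫_ℝ +
    ⟪S.Φ (f p) (D₁ E E₁ E₂ E₃ f p u),
      secondDeriv 𝓘(ℝ, E) (prodModel E₁ E₂ E₃) f p (incl₂ p y) (incl₂ p x)⟫_ℝ = 0 := by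
  have h := hS.mvfderiv_inner_Φ_pushField hf.smooth_f p (incl₂ p y) (incl₁ p u) (incl₂ p x)
  have h0 : (fun q => ⟪S.Φ (f q) (pushField 𝓘(ℝ, E) (prodModel E₁ E₂ E₃) f p (incl₁ p u) q),
      pushField 𝓘(ℝ, E) (prodModel E₁ E₂ E₃) f p (incl₂ p x) q⟫_ℝ) =ᶠ[𝓝 p] fun _ => (0 : ℝ) := by
    filter_upwards [eventually_pushField_incl₁ E E₁ E₂ E₃ f p,
      eventually_pushField_incl₂ E E₁ E₂ E₃ f p] with q h1 h2
    rw [h1, h2, hf.inner_Φ_D₁_D₂ hT]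
  rw [eventually_mvfderiv_congr h0, mvfderiv_const] at h
  obtain ⟨x', hx'⟩ := exists_D₂_eq_Φ hf.smooth_f hT p x
  have h1 := hf.christoffelFirst₂₁₂ p y u x'
  have h2 := hf.inner_ξ_D₂ hξ p x
  have h3 : ⟪S.Φ (f p) (secondDeriv 𝓘(ℝ, E) (prodModel E₁ E₂ E₃) f p (incl₂ p y) (incl₁ p u)),
      D₂ E E₁ E₂ E₃ f p x⟫_ℝ = mvfderiv 𝓘(ℝ, E₁) (fun a => Real.log (φ₁ a)) p.1 u *
      ⟪S.Φ (f p) (D₂ E E₁ E₂ E₃ f p y), D₂ E E₁ E₂ E₃ f p x⟫_ℝ := by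
    rw [S.inner_Φ_left, S.inner_Φ_left, ← hx']
    refine (congrArg Neg.neg h1).trans ?_
    ring
  change (0 : ℝ) = ⟪S.Φ (f p) (secondDeriv 𝓘(ℝ, E) (prodModel E₁ E₂ E₃) f p (incl₂ p y)
    (incl₁ p u)), D₂ E E₁ E₂ E₃ f p x⟫_ℝ + β (f p) * (⟪S.Φ (f p) (D₂ E E₁ E₂ E₃ f p y),
      D₁ E E₁ E₂ E₃ f p u⟫_ℝ * ⟪S.ξ (f p), D₂ E E₁ E₂ E₃ f p x⟫_ℝ -
      ⟪S.ξ (f p), D₁ E E₁ E₂ E₃ f p u⟫_ℝ *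
      ⟪S.Φ (f p) (D₂ E E₁ E₂ E₃ f p y), D₂ E E₁ E₂ E₃ f p x⟫_ℝ) +
      ⟪S.Φ (f p) (D₁ E E₁ E₂ E₃ f p u),
      secondDeriv 𝓘(ℝ, E) (prodModel E₁ E₂ E₃) f p (incl₂ p y) (incl₂ p x)⟫_ℝ at h
  rw [h3, h2] at h
  linarith

/-- If there is an invariant factor, then `d (ln φ₁) = β η` on the slant leaves: the second
fundamental form being symmetric, the identity `invariant_leaf_identity` can be antisymmetrized. -/
lemma mvfderiv_log_φ₁ (hS : S.IsLocallyConformalAlmostCosymplectic β)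
    (hξ : ∀ b c, S.IsTangentToReeb E₁ (leaf₁ f b c))
    (hT : ∀ a c, S.IsInvariant E₂ (leaf₂ f a c)) (hn : 0 < finrank ℝ E₂) (p : L₁ × L₂ × L₃)
    (u : TangentSpace 𝓘(ℝ, E₁) p.1) :
    mvfderiv 𝓘(ℝ, E₁) (fun a => Real.log (φ₁ a)) p.1 u =
      β (f p) * ⟪S.ξ (f p), D₁ E E₁ E₂ E₃ f p u⟫_ℝ := by
  have hn' : 0 < finrank ℝ (TangentSpace 𝓘(ℝ, E₂) p.2.1) := hn
  have : Nontrivial (TangentSpace 𝓘(ℝ, E₂) p.2.1) := Module.finrank_pos_iff.1 hn'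
  obtain ⟨y, hy⟩ := exists_ne (0 : TangentSpace 𝓘(ℝ, E₂) p.2.1)
  obtain ⟨x, hx⟩ := exists_D₂_eq_Φ hf.smooth_f hT p y
  have h1 := hf.invariant_leaf_identity hS hξ hT p u x y
  have h2 := hf.invariant_leaf_identity hS hξ hT p u y x
  rw [secondDeriv_comm hf.smooth_f p (incl₂ p x), S.inner_Φ_left (f p) (D₂ E E₁ E₂ E₃ f p x),
    real_inner_comm (S.Φ (f p) (D₂ E E₁ E₂ E₃ f p y))] at h2
  have h3 : ⟪S.Φ (f p) (D₂ E E₁ E₂ E₃ f p y), D₂ E E₁ E₂ E₃ f p x⟫_ℝ ≠ 0 := by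
    rw [hx, S.inner_Φ_Φ, S.η_eq_inner, hf.inner_ξ_D₂ hξ, hf.inner_D₂_D₂, mul_zero, sub_zero]
    exact mul_ne_zero (pow_ne_zero _ (hf.pos_φ₁ _).ne') (inner_self_eq_zero.not.2 hy)
  have h4 : (mvfderiv 𝓘(ℝ, E₁) (fun a => Real.log (φ₁ a)) p.1 u -
      β (f p) * ⟪S.ξ (f p), D₁ E E₁ E₂ E₃ f p u⟫_ℝ) *
      ⟪S.Φ (f p) (D₂ E E₁ E₂ E₃ f p y), D₂ E E₁ E₂ E₃ f p x⟫_ℝ = 0 := by linarith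
  exact sub_eq_zero.1 ((mul_eq_zero.1 h4).resolve_right h3)

/-- If there is an invariant factor, then the first term of the inequality vanishes. -/
lemma gradNormSq_log_φ₁ (hS : S.IsLocallyConformalAlmostCosymplectic β)
    (hξ : ∀ b c, S.IsTangentToReeb E₁ (leaf₁ f b c))
    (hT : ∀ a c, S.IsInvariant E₂ (leaf₂ f a c)) (hn : 0 < finrank ℝ E₂) (p : L₁ × L₂ × L₃) :
    gradNormSq 𝓘(ℝ, E₁) (fun a => Real.log (φ₁ a)) p.1 = β (f p) ^ 2 := by
  obtain ⟨r, hr⟩ := exists_D₁_eq_ξ hf.smooth_f hξ p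
  have h : ∀ v, ⟪rieszVector (mvfderiv 𝓘(ℝ, E₁) (fun a => Real.log (φ₁ a)) p.1), v⟫_ℝ =
      β (f p) * ⟪r, v⟫_ℝ := fun v => by
    rw [inner_rieszVector, hf.mvfderiv_log_φ₁ hS hξ hT hn p, ← hr, hf.inner_D₁_D₁]
  have hrr : ⟪r, r⟫_ℝ = 1 := by rw [← hf.inner_D₁_D₁, hr, S.inner_ξ_ξ]
  rw [gradNormSq_eq, h, real_inner_comm, h, hrr]
  ring

/-- If there is a third factor, then `β = ξ (ln φ₂)`. -/
lemma mvfderiv_log_φ₂_ξ (hS : S.IsLocallyConformalAlmostCosymplectic β)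
    (hξ : ∀ b c, S.IsTangentToReeb E₁ (leaf₁ f b c)) (hn : 0 < finrank ℝ E₃) (p : L₁ × L₂ × L₃)
    {r : TangentSpace 𝓘(ℝ, E₁) p.1} (hr : D₁ E E₁ E₂ E₃ f p r = S.ξ (f p)) :
    mvfderiv 𝓘(ℝ, E₁) (fun a => Real.log (φ₂ a)) p.1 r = β (f p) := by
  have hn' : 0 < finrank ℝ (TangentSpace 𝓘(ℝ, E₃) p.2.2) := hn
  have : Nontrivial (TangentSpace 𝓘(ℝ, E₃) p.2.2) := Module.finrank_pos_iff.1 hn'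
  obtain ⟨z, hz⟩ := exists_ne (0 : TangentSpace 𝓘(ℝ, E₃) p.2.2)
  have h := hS.mvfderiv_inner_ξ_pushField hf.smooth_f p (incl₃ p z) (incl₃ p z)
  have h0 : (fun q => ⟪S.ξ (f q), pushField 𝓘(ℝ, E) (prodModel E₁ E₂ E₃) f p (incl₃ p z) q⟫_ℝ)
      =ᶠ[𝓝 p] fun _ => (0 : ℝ) := by
    filter_upwards [eventually_pushField_incl₃ E E₁ E₂ E₃ f p] with q h1
    rw [h1, hf.inner_ξ_D₃ hξ]
  rw [eventually_mvfderiv_congr h0, mvfderiv_const] at h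
  have h1 := hf.christoffelFirst₃₃₁ p z z r
  change ⟪_, D₁ E E₁ E₂ E₃ f p r⟫_ℝ = _ at h1
  rw [hr, real_inner_comm] at h1
  change (0 : ℝ) = β (f p) * (⟪D₃ E E₁ E₂ E₃ f p z, D₃ E E₁ E₂ E₃ f p z⟫_ℝ -
    ⟪S.ξ (f p), D₃ E E₁ E₂ E₃ f p z⟫_ℝ * ⟪S.ξ (f p), D₃ E E₁ E₂ E₃ f p z⟫_ℝ) + _ at h
  rw [h1, hf.inner_ξ_D₃ hξ] at h
  have h3 : ⟪D₃ E E₁ E₂ E₃ f p z, D₃ E E₁ E₂ E₃ f p z⟫_ℝ ≠ 0 := by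
    rw [hf.inner_D₃_D₃]
    exact mul_ne_zero (pow_ne_zero _ (hf.pos_φ₂ _).ne') (inner_self_eq_zero.not.2 hz)
  have h4 : (mvfderiv 𝓘(ℝ, E₁) (fun a => Real.log (φ₂ a)) p.1 r - β (f p)) *
    ⟪D₃ E E₁ E₂ E₃ f p z, D₃ E E₁ E₂ E₃ f p z⟫_ℝ = 0 := by linarith
  exact sub_eq_zero.1 ((mul_eq_zero.1 h4).resolve_right h3)

end IsBiWarpedProductSubmanifold
end Contact

/-! ### The slant factor -/

section Slant
variable {E : Type*} [NormedAddCommGroup E] [NormedSpace ℝ E] [FiniteDimensional ℝ E]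
  {M : Type*} [TopologicalSpace M] [ChartedSpace E M] [IsManifold 𝓘(ℝ, E) ∞ M]
  [RiemannianBundle (fun x : M => TangentSpace 𝓘(ℝ, E) x)]
  [IsContMDiffRiemannianBundle 𝓘(ℝ, E) ∞ E (fun x : M => TangentSpace 𝓘(ℝ, E) x)]
  {E₁ : Type*} [NormedAddCommGroup E₁] [NormedSpace ℝ E₁] [FiniteDimensional ℝ E₁]
  {L₁ : Type*} [TopologicalSpace L₁] [ChartedSpace E₁ L₁] [IsManifold 𝓘(ℝ, E₁) ∞ L₁]
  [RiemannianBundle (fun x : L₁ => TangentSpace 𝓘(ℝ, E₁) x)]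
  {E₂ : Type*} [NormedAddCommGroup E₂] [NormedSpace ℝ E₂] [FiniteDimensional ℝ E₂]
  {L₂ : Type*} [TopologicalSpace L₂] [ChartedSpace E₂ L₂] [IsManifold 𝓘(ℝ, E₂) ∞ L₂]
  [RiemannianBundle (fun x : L₂ => TangentSpace 𝓘(ℝ, E₂) x)]
  {E₃ : Type*} [NormedAddCommGroup E₃] [NormedSpace ℝ E₃] [FiniteDimensional ℝ E₃]
  {L₃ : Type*} [TopologicalSpace L₃] [ChartedSpace E₃ L₃] [IsManifold 𝓘(ℝ, E₃) ∞ L₃]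
  [RiemannianBundle (fun x : L₃ => TangentSpace 𝓘(ℝ, E₃) x)]
  {f : L₁ × L₂ × L₃ → M} {φ₁ φ₂ : L₁ → ℝ} {S : AlmostContactMetric E M} {β : M → ℝ} {ν : ℝ}

variable (S E₁ E₂ E₃ f) in
/-- The tangential part of `Φ` on the slant leaves: `D₁ (slantOperator u)` is the orthogonal
projection of `Φ (D₁ u)` to the tangent space of the leaf. -/
def slantOperator (p : L₁ × L₂ × L₃) (u : TangentSpace 𝓘(ℝ, E₁) p.1) : TangentSpace 𝓘(ℝ, E₁) p.1 :=
  rieszVector ((innerSL ℝ (S.Φ (f p) (D₁ E E₁ E₂ E₃ f p u))).comp (D₁ E E₁ E₂ E₃ f p))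

lemma inner_slantOperator (p : L₁ × L₂ × L₃) (u v : TangentSpace 𝓘(ℝ, E₁) p.1) :
    ⟪slantOperator E₁ E₂ E₃ f S p u, v⟫_ℝ =
      ⟪S.Φ (f p) (D₁ E E₁ E₂ E₃ f p u), D₁ E E₁ E₂ E₃ f p v⟫_ℝ :=
  inner_rieszVector (V := TangentSpace 𝓘(ℝ, E₁) p.1) _ v

lemma inner_slantOperator_left (p : L₁ × L₂ × L₃) (u v : TangentSpace 𝓘(ℝ, E₁) p.1) :
    ⟪slantOperator E₁ E₂ E₃ f S p u, v⟫_ℝ = -⟪u, slantOperator E₁ E₂ E₃ f S p v⟫_ℝ := by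
  rw [real_inner_comm, real_inner_comm _ u, inner_slantOperator, real_inner_comm,
    inner_slantOperator, S.inner_Φ_left, real_inner_comm]

lemma inner_ξ_D₁_slantOperator (hf : ContMDiff (prodModel E₁ E₂ E₃) 𝓘(ℝ, E) ∞ f)
    (hξ : ∀ b c, S.IsTangentToReeb E₁ (leaf₁ f b c)) (p : L₁ × L₂ × L₃)
    (u : TangentSpace 𝓘(ℝ, E₁) p.1)
    (hD : ∀ u v, ⟪D₁ E E₁ E₂ E₃ f p u, D₁ E E₁ E₂ E₃ f p v⟫_ℝ = ⟪u, v⟫_ℝ) :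
    ⟪S.ξ (f p), D₁ E E₁ E₂ E₃ f p (slantOperator E₁ E₂ E₃ f S p u)⟫_ℝ = 0 := by
  obtain ⟨r, hr⟩ := exists_D₁_eq_ξ hf hξ p
  rw [← hr, hD, real_inner_comm, inner_slantOperator, hr, real_inner_comm, ← S.η_eq_inner, S.η_Φ]

namespace IsBiWarpedProductSubmanifold
variable (hf : IsBiWarpedProductSubmanifold (E := E) (E₁ := E₁) (E₂ := E₂) (E₃ := E₃) f φ₁ φ₂)
include hf

lemma inner_Φ_sub_D₁_slantOperator (p : L₁ × L₂ × L₃) (u v : TangentSpace 𝓘(ℝ, E₁) p.1) :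
    ⟪S.Φ (f p) (D₁ E E₁ E₂ E₃ f p u) - D₁ E E₁ E₂ E₃ f p (slantOperator E₁ E₂ E₃ f S p u),
      D₁ E E₁ E₂ E₃ f p v⟫_ℝ = 0 := by
  rw [inner_sub_left, hf.inner_D₁_D₁, inner_slantOperator, sub_self]

lemma starProjection_Φ_D₁ (p : L₁ × L₂ × L₃) (u : TangentSpace 𝓘(ℝ, E₁) p.1) :
    (tangentImage 𝓘(ℝ, E) 𝓘(ℝ, E₁) (leaf₁ f p.2.1 p.2.2) p.1).starProjection
      (S.Φ (f p) (D₁ E E₁ E₂ E₃ f p u)) =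
        D₁ E E₁ E₂ E₃ f p (slantOperator E₁ E₂ E₃ f S p u) := by
  refine Submodule.eq_starProjection_of_mem_of_inner_eq_zero ?_ ?_
  · exact ⟨_, congrArg (fun L : TangentSpace 𝓘(ℝ, E₁) p.1 →L[ℝ] TangentSpace 𝓘(ℝ, E) (f p) =>
      L (slantOperator E₁ E₂ E₃ f S p u)) (mfderiv_leaf₁ hf.smooth_f p)⟩
  · rintro _ ⟨v, rfl⟩
    refine Eq.trans ?_ (hf.inner_Φ_sub_D₁_slantOperator (S := S) p u v)
    exact congrArg (fun L : TangentSpace 𝓘(ℝ, E₁) p.1 →L[ℝ] TangentSpace 𝓘(ℝ, E) (f p) =>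
      ⟪S.Φ (f p) (D₁ E E₁ E₂ E₃ f p u) - D₁ E E₁ E₂ E₃ f p (slantOperator E₁ E₂ E₃ f S p u),
        L v⟫_ℝ) (mfderiv_leaf₁ hf.smooth_f p)

/-- The slant condition, as an identity for the tangential part of `Φ`. -/
lemma inner_slantOperator_self (hsl : ∀ b c, S.IsSlant E₁ (leaf₁ f b c) ν) (p : L₁ × L₂ × L₃)
    (u : TangentSpace 𝓘(ℝ, E₁) p.1) :
    ⟪slantOperator E₁ E₂ E₃ f S p u, slantOperator E₁ E₂ E₃ f S p u⟫_ℝ =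
      Real.cos ν ^ 2 * (⟪u, u⟫_ℝ - ⟪S.ξ (f p), D₁ E E₁ E₂ E₃ f p u⟫_ℝ ^ 2) := by
  have hΦ : ⟪S.Φ (f p) (D₁ E E₁ E₂ E₃ f p u), S.Φ (f p) (D₁ E E₁ E₂ E₃ f p u)⟫_ℝ =
      ⟪u, u⟫_ℝ - ⟪S.ξ (f p), D₁ E E₁ E₂ E₃ f p u⟫_ℝ ^ 2 := by
    rw [S.inner_Φ_Φ, hf.inner_D₁_D₁, S.η_eq_inner, sq]
  set Pu := slantOperator E₁ E₂ E₃ f S p u with hPu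
  by_cases hli : LinearIndependent ℝ ![D₁ E E₁ E₂ E₃ f p u, S.ξ (f p)]
  · have hmem : D₁ E E₁ E₂ E₃ f p u ∈
        tangentImage 𝓘(ℝ, E) 𝓘(ℝ, E₁) (leaf₁ f p.2.1 p.2.2) p.1 :=
      ⟨u, congrArg (fun L : TangentSpace 𝓘(ℝ, E₁) p.1 →L[ℝ] TangentSpace 𝓘(ℝ, E) (f p) => L u)
        (mfderiv_leaf₁ hf.smooth_f p)⟩
    have hang : InnerProductGeometry.angle (S.Φ (f p) (D₁ E E₁ E₂ E₃ f p u))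
        (D₁ E E₁ E₂ E₃ f p Pu) = ν := by
      rw [hPu, ← hf.starProjection_Φ_D₁ p u]
      exact (hsl p.2.1 p.2.2).2.2 p.1 _ hmem hli
    have h1 := InnerProductGeometry.cos_angle_mul_norm_mul_norm (S.Φ (f p) (D₁ E E₁ E₂ E₃ f p u))
        (D₁ E E₁ E₂ E₃ f p Pu)
    have h2 : ⟪S.Φ (f p) (D₁ E E₁ E₂ E₃ f p u), D₁ E E₁ E₂ E₃ f p Pu⟫_ℝ =
        ‖D₁ E E₁ E₂ E₃ f p Pu‖ ^ 2 := by
      rw [← inner_slantOperator, ← real_inner_self_eq_norm_sq, hf.inner_D₁_D₁]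
    rw [hang, h2] at h1
    rw [← hΦ, real_inner_self_eq_norm_sq (S.Φ (f p) (D₁ E E₁ E₂ E₃ f p u)), ← hf.inner_D₁_D₁ p,
      real_inner_self_eq_norm_sq, ← mul_pow]
    by_cases h0 : ‖D₁ E E₁ E₂ E₃ f p Pu‖ = 0
    · -- here the projection vanishes, and the angle is `π / 2`
      have h3 : D₁ E E₁ E₂ E₃ f p Pu = 0 := norm_eq_zero.1 h0
      rw [h3, InnerProductGeometry.angle_zero_right] at hang
      rw [h0, ← hang, Real.cos_pi_div_two]
      ring
    · have h3 : (Real.cos ν * ‖S.Φ (f p) (D₁ E E₁ E₂ E₃ f p u)‖ - ‖D₁ E E₁ E₂ E₃ f p Pu‖) *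
          ‖D₁ E E₁ E₂ E₃ f p Pu‖ = 0 := by linarith
      rw [sub_eq_zero.1 ((mul_eq_zero.1 h3).resolve_right h0)]
  · -- a tangent vector proportional to `ξ` is annihilated by `Φ`
    have hξ0 : S.ξ (f p) ≠ 0 := fun h => by
      have := S.inner_ξ_ξ (f p)
      rw [h, inner_zero_left] at this
      exact zero_ne_one this
    rw [LinearIndependent.pair_symm_iff, LinearIndependent.pair_iff' hξ0] at hli
    push Not at hli
    obtain ⟨t, ht⟩ := hli
    have h1 : S.Φ (f p) (D₁ E E₁ E₂ E₃ f p u) = 0 := by rw [← ht, map_smul, S.Φ_ξ, smul_zero]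
    have h2 : ⟪Pu, Pu⟫_ℝ = 0 := by rw [hPu, inner_slantOperator, h1, inner_zero_left]
    rw [h1, inner_zero_left] at hΦ
    rw [h2, ← hΦ, mul_zero]

/-- The slant condition, as an identity for the normal part of `Φ`. -/
lemma inner_Φ_sub_D₁_slantOperator_self (hsl : ∀ b c, S.IsSlant E₁ (leaf₁ f b c) ν)
    (p : L₁ × L₂ × L₃) (u : TangentSpace 𝓘(ℝ, E₁) p.1) :
    ⟪S.Φ (f p) (D₁ E E₁ E₂ E₃ f p u) - D₁ E E₁ E₂ E₃ f p (slantOperator E₁ E₂ E₃ f S p u),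
      S.Φ (f p) (D₁ E E₁ E₂ E₃ f p u) - D₁ E E₁ E₂ E₃ f p (slantOperator E₁ E₂ E₃ f S p u)⟫_ℝ =
      Real.sin ν ^ 2 * (⟪u, u⟫_ℝ - ⟪S.ξ (f p), D₁ E E₁ E₂ E₃ f p u⟫_ℝ ^ 2) := by
  rw [inner_sub_right, hf.inner_Φ_sub_D₁_slantOperator, sub_zero, inner_sub_left,
    real_inner_comm (S.Φ (f p) (D₁ E E₁ E₂ E₃ f p u))
      (D₁ E E₁ E₂ E₃ f p (slantOperator E₁ E₂ E₃ f S p u)), ← inner_slantOperator,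
    hf.inner_slantOperator_self hsl, S.inner_Φ_Φ, hf.inner_D₁_D₁, S.η_eq_inner, Real.sin_sq]
  ring

lemma cos_ne_zero_of_isProperSlant {b : L₂} {c : L₃} (hsl : ∀ b c, S.IsSlant E₁ (leaf₁ f b c) ν)
    (hna : ¬ S.IsAntiInvariant E₁ (leaf₁ f b c)) : Real.cos ν ≠ 0 := by
  intro h0
  refine hna fun a v hv => ?_
  have hm := mfderiv_leaf₁ hf.smooth_f (a, b, c)
  obtain ⟨u, hu⟩ := hv
  have hu' : D₁ E E₁ E₂ E₃ f (a, b, c) u = v := by rw [← hm]; exact hu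
  have h1 := hf.inner_slantOperator_self hsl (a, b, c) u
  rw [h0, zero_pow two_ne_zero, zero_mul] at h1
  have h2 := inner_self_eq_zero.1 h1
  rw [Submodule.mem_orthogonal']
  rintro _ ⟨w, rfl⟩
  have h3 := inner_slantOperator (S := S) (E₁ := E₁) (E₂ := E₂) (E₃ := E₃) (f := f) (a, b, c) u w
  rw [h2, inner_zero_left] at h3
  rw [← hu']
  rw [← hm] at h3 ⊢
  exact h3.symm

lemma sin_ne_zero_of_isProperSlant {b : L₂} {c : L₃} (hsl : ∀ b c, S.IsSlant E₁ (leaf₁ f b c) ν)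
    (hni : ¬ S.IsInvariant E₁ (leaf₁ f b c)) : Real.sin ν ≠ 0 := by
  intro h0
  refine hni fun a v hv => ?_
  have hm := mfderiv_leaf₁ hf.smooth_f (a, b, c)
  obtain ⟨u, hu⟩ := hv
  have hu' : D₁ E E₁ E₂ E₃ f (a, b, c) u = v := by rw [← hm]; exact hu
  have h1 := hf.inner_Φ_sub_D₁_slantOperator_self hsl (a, b, c) u
  rw [h0, zero_pow two_ne_zero, zero_mul] at h1
  have h2 := sub_eq_zero.1 (inner_self_eq_zero.1 h1)
  refine ⟨slantOperator E₁ E₂ E₃ f S (a, b, c) u, ?_⟩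
  refine (congrArg (fun L : TangentSpace 𝓘(ℝ, E₁) a →L[ℝ] TangentSpace 𝓘(ℝ, E) (f (a, b, c)) =>
    L (slantOperator E₁ E₂ E₃ f S (a, b, c) u)) hm).trans ?_
  exact h2.symm.trans (congrArg (S.Φ (f (a, b, c))) hu')

end IsBiWarpedProductSubmanifold
end Slant

/-! ### Differentiation along the third factor -/

section AntiInvariantLeaf
variable {E : Type*} [NormedAddCommGroup E] [NormedSpace ℝ E] [FiniteDimensional ℝ E]
  {M : Type*} [TopologicalSpace M] [ChartedSpace E M] [IsManifold 𝓘(ℝ, E) ∞ M]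
  [RiemannianBundle (fun x : M => TangentSpace 𝓘(ℝ, E) x)]
  [IsContMDiffRiemannianBundle 𝓘(ℝ, E) ∞ E (fun x : M => TangentSpace 𝓘(ℝ, E) x)]
  {E₁ : Type*} [NormedAddCommGroup E₁] [NormedSpace ℝ E₁] [FiniteDimensional ℝ E₁]
  {L₁ : Type*} [TopologicalSpace L₁] [ChartedSpace E₁ L₁] [IsManifold 𝓘(ℝ, E₁) ∞ L₁]
  [RiemannianBundle (fun x : L₁ => TangentSpace 𝓘(ℝ, E₁) x)]
  {E₂ : Type*} [NormedAddCommGroup E₂] [NormedSpace ℝ E₂] [FiniteDimensional ℝ E₂]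
  {L₂ : Type*} [TopologicalSpace L₂] [ChartedSpace E₂ L₂] [IsManifold 𝓘(ℝ, E₂) ∞ L₂]
  [RiemannianBundle (fun x : L₂ => TangentSpace 𝓘(ℝ, E₂) x)]
  {E₃ : Type*} [NormedAddCommGroup E₃] [NormedSpace ℝ E₃] [FiniteDimensional ℝ E₃]
  {L₃ : Type*} [TopologicalSpace L₃] [ChartedSpace E₃ L₃] [IsManifold 𝓘(ℝ, E₃) ∞ L₃]
  [RiemannianBundle (fun x : L₃ => TangentSpace 𝓘(ℝ, E₃) x)]
  {f : L₁ × L₂ × L₃ → M} {φ₁ φ₂ : L₁ → ℝ} {S : AlmostContactMetric E M} {β : M → ℝ} {ν : ℝ}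

/-- The derivative of `⟪Φ U, V⟫` along the third factor. -/
lemma mvfderiv_leaf₃_inner_Φ (hf : ContMDiff (prodModel E₁ E₂ E₃) 𝓘(ℝ, E) ∞ f)
    (hS : S.IsLocallyConformalAlmostCosymplectic β) (p : L₁ × L₂ × L₃)
    (u v : TangentSpace 𝓘(ℝ, E₁) p.1) :
    MDifferentiableAt 𝓘(ℝ, E₃) 𝓘(ℝ, ℝ) (fun c => ⟪S.Φ (f (p.1, p.2.1, c))
      (D₁ E E₁ E₂ E₃ f (p.1, p.2.1, c) u), D₁ E E₁ E₂ E₃ f (p.1, p.2.1, c) v⟫_ℝ) p.2.2 ∧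
    ∀ z, mvfderiv 𝓘(ℝ, E₃) (fun c => ⟪S.Φ (f (p.1, p.2.1, c))
      (D₁ E E₁ E₂ E₃ f (p.1, p.2.1, c) u), D₁ E E₁ E₂ E₃ f (p.1, p.2.1, c) v⟫_ℝ) p.2.2 z =
      ⟪S.Φ (f p) (secondDeriv 𝓘(ℝ, E) (prodModel E₁ E₂ E₃) f p (incl₃ p z) (incl₁ p u)),
        D₁ E E₁ E₂ E₃ f p v⟫_ℝ +
      β (f p) * (⟪S.Φ (f p) (D₃ E E₁ E₂ E₃ f p z), D₁ E E₁ E₂ E₃ f p u⟫_ℝ *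
          ⟪S.ξ (f p), D₁ E E₁ E₂ E₃ f p v⟫_ℝ -
        ⟪S.ξ (f p), D₁ E E₁ E₂ E₃ f p u⟫_ℝ *
          ⟪S.Φ (f p) (D₃ E E₁ E₂ E₃ f p z), D₁ E E₁ E₂ E₃ f p v⟫_ℝ) +
      ⟪S.Φ (f p) (D₁ E E₁ E₂ E₃ f p u),
        secondDeriv 𝓘(ℝ, E) (prodModel E₁ E₂ E₃) f p (incl₃ p z) (incl₁ p v)⟫_ℝ := by
  have hd := hS.mdifferentiableAt_inner_Φ_pushField hf p (incl₁ p u) (incl₁ p v)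
  have hev : (fun c => ⟪S.Φ (f (p.1, p.2.1, c)) (D₁ E E₁ E₂ E₃ f (p.1, p.2.1, c) u),
      D₁ E E₁ E₂ E₃ f (p.1, p.2.1, c) v⟫_ℝ) =ᶠ[𝓝 p.2.2]
      fun c => ⟪S.Φ (f (p.1, p.2.1, c)) (pushField 𝓘(ℝ, E) (prodModel E₁ E₂ E₃) f p (incl₁ p u)
        (p.1, p.2.1, c)), pushField 𝓘(ℝ, E) (prodModel E₁ E₂ E₃) f p (incl₁ p v)
        (p.1, p.2.1, c)⟫_ℝ := by
    filter_upwards [(eventually_slice (eventually_pushField_incl₁ E E₁ E₂ E₃ f p)).2.2] with c hc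
    rw [hc, hc, coordField_self, coordField_self]
  refine ⟨?_, fun z => ?_⟩
  · refine MDifferentiableAt.congr_of_eventuallyEq ?_ hev
    exact MDifferentiableAt.comp (f := fun c => (p.1, p.2.1, c)) p.2.2 hd
      (hasMFDerivAt_slice₃ p).mdifferentiableAt
  · rw [eventually_mvfderiv_congr hev, ← mvfderiv_incl₃ hd z]
    exact hS.mvfderiv_inner_Φ_pushField hf p (incl₃ p z) (incl₁ p u) (incl₁ p v)

namespace IsBiWarpedProductSubmanifold
variable (hf : IsBiWarpedProductSubmanifold (E := E) (E₁ := E₁) (E₂ := E₂) (E₃ := E₃) f φ₁ φ₂)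
include hf

/-- In the mixed totally geodesic case, `∇_Z U = U (ln φ₂) Z` for `U` orthogonal to `ξ`. -/
lemma secondDeriv_of_isMixedTotallyGeodesic
    (hmixed : IsMixedTotallyGeodesic (E₁ := E₁) (E₂ := E₂) (E₃ := E₃) S f) (p : L₁ × L₂ × L₃)
    (z : TangentSpace 𝓘(ℝ, E₃) p.2.2) {u : TangentSpace 𝓘(ℝ, E₁) p.1}
    (hu : ⟪S.ξ (f p), D₁ E E₁ E₂ E₃ f p u⟫_ℝ = 0) :
    secondDeriv 𝓘(ℝ, E) (prodModel E₁ E₂ E₃) f p (incl₃ p z) (incl₁ p u) =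
      mvfderiv 𝓘(ℝ, E₁) (fun a => Real.log (φ₂ a)) p.1 u • D₃ E E₁ E₂ E₃ f p z := by
  have h := hmixed p (incl₃ p z) ⟨z, rfl⟩ (incl₁ p u)
    ⟨⟨u, rfl⟩, by rw [real_inner_comm]; exact hu⟩
  rw [secondFundForm_eq_zero_iff] at h
  rw [← sub_eq_zero]
  refine eq_zero_of_mem_tangentImage (E₁ := E₁) (E₂ := E₂) (E₃ := E₃) (p := p)
    (Submodule.sub_mem _ h (Submodule.smul_mem _ _ ⟨incl₃ p z, rfl⟩)) ?_ ?_ ?_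
  · intro v
    rw [inner_sub_right, real_inner_smul_right, hf.inner_D₁_D₃, real_inner_comm]
    rw [show ⟪_, D₁ E E₁ E₂ E₃ f p v⟫_ℝ = _ from hf.christoffelFirst₃₁₁ p z u v]
    ring
  · intro x
    rw [inner_sub_right, real_inner_smul_right, hf.inner_D₂_D₃, real_inner_comm]
    rw [show ⟪_, D₂ E E₁ E₂ E₃ f p x⟫_ℝ = _ from hf.christoffelFirst₃₁₂ p z u x]
    ring
  · intro w
    rw [inner_sub_right, real_inner_smul_right, real_inner_comm]
    rw [show ⟪_, D₃ E E₁ E₂ E₃ f p w⟫_ℝ = _ from hf.christoffelFirst₃₁₃ p z u w,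
      real_inner_comm (D₃ E E₁ E₂ E₃ f p z)]
    ring

variable (hS : S.IsLocallyConformalAlmostCosymplectic β)
  (hξ : ∀ b c, S.IsTangentToReeb E₁ (leaf₁ f b c))
include hS hξ

/-- `η (U)` is constant along the third factor. -/
lemma mvfderiv_leaf₃_inner_ξ (p : L₁ × L₂ × L₃) (u : TangentSpace 𝓘(ℝ, E₁) p.1) :
    MDifferentiableAt 𝓘(ℝ, E₃) 𝓘(ℝ, ℝ) (fun c => ⟪S.ξ (f (p.1, p.2.1, c)),
      D₁ E E₁ E₂ E₃ f (p.1, p.2.1, c) u⟫_ℝ) p.2.2 ∧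
    ∀ z, mvfderiv 𝓘(ℝ, E₃) (fun c => ⟪S.ξ (f (p.1, p.2.1, c)),
      D₁ E E₁ E₂ E₃ f (p.1, p.2.1, c) u⟫_ℝ) p.2.2 z = 0 := by
  have hd := hS.mdifferentiableAt_inner_ξ_pushField hf.smooth_f p (incl₁ p u)
  have hev : (fun c => ⟪S.ξ (f (p.1, p.2.1, c)), D₁ E E₁ E₂ E₃ f (p.1, p.2.1, c) u⟫_ℝ) =ᶠ[𝓝 p.2.2]
      fun c => ⟪S.ξ (f (p.1, p.2.1, c)), pushField 𝓘(ℝ, E) (prodModel E₁ E₂ E₃) f p (incl₁ p u)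
        (p.1, p.2.1, c)⟫_ℝ := by
    filter_upwards [(eventually_slice (eventually_pushField_incl₁ E E₁ E₂ E₃ f p)).2.2] with c hc
    rw [hc, coordField_self]
  refine ⟨?_, fun z => ?_⟩
  · refine MDifferentiableAt.congr_of_eventuallyEq ?_ hev
    exact MDifferentiableAt.comp (f := fun c => (p.1, p.2.1, c)) p.2.2 hd
      (hasMFDerivAt_slice₃ p).mdifferentiableAt
  · rw [eventually_mvfderiv_congr hev, ← mvfderiv_incl₃ hd z]
    refine (hS.mvfderiv_inner_ξ_pushField hf.smooth_f p (incl₃ p z) (incl₁ p u)).trans ?_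
    obtain ⟨r, hr⟩ := exists_D₁_eq_ξ hf.smooth_f hξ p
    have h1 := hf.christoffelFirst₃₁₁ p z u r
    change ⟪_, D₁ E E₁ E₂ E₃ f p r⟫_ℝ = _ at h1
    rw [hr, real_inner_comm] at h1
    change β (f p) * (⟪D₃ E E₁ E₂ E₃ f p z, D₁ E E₁ E₂ E₃ f p u⟫_ℝ -
      ⟪S.ξ (f p), D₃ E E₁ E₂ E₃ f p z⟫_ℝ * ⟪S.ξ (f p), D₁ E E₁ E₂ E₃ f p u⟫_ℝ) + _ = _
    rw [h1, hf.inner_ξ_D₃ hξ, real_inner_comm, hf.inner_D₁_D₃]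
    ring

lemma eventually_inner_ξ_D₁ (p : L₁ × L₂ × L₃) (u : TangentSpace 𝓘(ℝ, E₁) p.1) :
    ∀ᶠ c in 𝓝 p.2.2, ⟪S.ξ (f (p.1, p.2.1, c)), D₁ E E₁ E₂ E₃ f (p.1, p.2.1, c) u⟫_ℝ =
      ⟪S.ξ (f p), D₁ E E₁ E₂ E₃ f p u⟫_ℝ :=
  eventually_eq_of_mvfderiv_eq_zero
    (g := fun c => ⟪S.ξ (f (p.1, p.2.1, c)), D₁ E E₁ E₂ E₃ f (p.1, p.2.1, c) u⟫_ℝ)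
    (fun c => (hf.mvfderiv_leaf₃_inner_ξ hS hξ (p.1, p.2.1, c) u).1)
    (fun c => (hf.mvfderiv_leaf₃_inner_ξ hS hξ (p.1, p.2.1, c) u).2) p.2.2

variable (hsl : ∀ b c, S.IsSlant E₁ (leaf₁ f b c) ν)
  (hmixed : IsMixedTotallyGeodesic (E₁ := E₁) (E₂ := E₂) (E₃ := E₃) S f)
include hsl hmixed

/-- The length of the tangential part of `Φ U` is constant along the third factor, hence the
derivative of this tangential part is orthogonal to it. -/
lemma mvfderiv_log_φ₂_mul_inner_Φ (p : L₁ × L₂ × L₃) {u : TangentSpace 𝓘(ℝ, E₁) p.1}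
    (hu : ⟪S.ξ (f p), D₁ E E₁ E₂ E₃ f p u⟫_ℝ = 0)
    (hu' : mvfderiv 𝓘(ℝ, E₁) (fun a => Real.log (φ₂ a)) p.1 u = 0)
    (z : TangentSpace 𝓘(ℝ, E₃) p.2.2) :
    mvfderiv 𝓘(ℝ, E₁) (fun a => Real.log (φ₂ a)) p.1 (slantOperator E₁ E₂ E₃ f S p u) *
      ⟪S.Φ (f p) (D₁ E E₁ E₂ E₃ f p u), D₃ E E₁ E₂ E₃ f p z⟫_ℝ = 0 := by
  set e := stdOrthonormalBasis ℝ (TangentSpace 𝓘(ℝ, E₁) p.1) with he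
  let F : TangentSpace 𝓘(ℝ, E₁) p.1 → L₃ → ℝ := fun v c => ⟪S.Φ (f (p.1, p.2.1, c))
      (D₁ E E₁ E₂ E₃ f (p.1, p.2.1, c) u), D₁ E E₁ E₂ E₃ f (p.1, p.2.1, c) v⟫_ℝ
  have hF : ∀ v, MDifferentiableAt 𝓘(ℝ, E₃) 𝓘(ℝ, ℝ) (F v) p.2.2 := fun v =>
    (mvfderiv_leaf₃_inner_Φ hf.smooth_f hS p u v).1
  set Pu := slantOperator E₁ E₂ E₃ f S p u with hPu
  -- the derivative of the constant `∑ i, F (e i) ^ 2`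
  have h1 : ∑ i, F (e i) p.2.2 * mvfderiv 𝓘(ℝ, E₃) (F (e i)) p.2.2 z = 0 := by
    have h2 := (mvfderiv_sum_smul (J := 𝓘(ℝ, E₃)) Finset.univ (fun i => hF (e i))
      (fun i => hF (e i)) z).2
    have h3 : (fun c => ∑ i, F (e i) c • F (e i) c) =ᶠ[𝓝 p.2.2]
        fun _ => Real.cos ν ^ 2 * ⟪u, u⟫_ℝ := by
      filter_upwards [hf.eventually_inner_ξ_D₁ hS hξ p u] with c hc
      have h4 := hf.inner_slantOperator_self hsl (p.1, p.2.1, c) u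
      rw [hc, hu, zero_pow two_ne_zero, sub_zero] at h4
      rw [← h4, ← e.sum_inner_mul_inner]
      refine Finset.sum_congr rfl fun i _ => ?_
      have h5 : F (e i) c = ⟪slantOperator E₁ E₂ E₃ f S (p.1, p.2.1, c) u, e i⟫_ℝ :=
        (inner_slantOperator (p.1, p.2.1, c) u (e i)).symm
      rw [h5, smul_eq_mul, real_inner_comm _ (e i)]
    rw [eventually_mvfderiv_congr h3, mvfderiv_const] at h2
    have h6 : (0 : ℝ) = ∑ i, (mvfderiv 𝓘(ℝ, E₃) (F (e i)) p.2.2 z • F (e i) p.2.2 +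
      F (e i) p.2.2 • mvfderiv 𝓘(ℝ, E₃) (F (e i)) p.2.2 z) := h2
    have h7 : (0 : ℝ) = 2 * ∑ i, F (e i) p.2.2 * mvfderiv 𝓘(ℝ, E₃) (F (e i)) p.2.2 z := by
      rw [h6, Finset.mul_sum]
      refine Finset.sum_congr rfl fun i _ => ?_
      simp only [smul_eq_mul]
      ring
    linarith
  -- it is the derivative of `F Pu`, where `Pu = ∑ i, F (e i) p.2.2 • e i` is kept fixed
  have h8 : mvfderiv 𝓘(ℝ, E₃) (F Pu) p.2.2 z = 0 := by
    have h9 : F Pu = fun c => ∑ i, F (e i) p.2.2 • F (e i) c := by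
      funext c
      have h10 : Pu = ∑ i, F (e i) p.2.2 • e i := rfl
      change ⟪S.Φ (f (p.1, p.2.1, c)) (D₁ E E₁ E₂ E₃ f (p.1, p.2.1, c) u),
        D₁ E E₁ E₂ E₃ f (p.1, p.2.1, c) Pu⟫_ℝ = _
      rw [h10, map_sum, inner_sum]
      refine Finset.sum_congr rfl fun i _ => ?_
      rw [map_smul, real_inner_smul_right, smul_eq_mul]
    rw [h9, (mvfderiv_sum_smul (J := 𝓘(ℝ, E₃)) (a := fun i _ => F (e i) p.2.2)
      (b := fun i => F (e i)) Finset.univ (fun _ => mdifferentiableAt_const)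
      (fun i => hF (e i)) z).2, ← h1]
    refine Finset.sum_congr rfl fun i _ => ?_
    rw [mvfderiv_const]
    simp
  have h11 := h8.symm.trans ((mvfderiv_leaf₃_inner_Φ hf.smooth_f hS p u Pu).2 z)
  have hPξ := inner_ξ_D₁_slantOperator hf.smooth_f hξ p u (hf.inner_D₁_D₁ p)
  rw [hf.secondDeriv_of_isMixedTotallyGeodesic hmixed p z hu,
    hf.secondDeriv_of_isMixedTotallyGeodesic hmixed p z hPξ, hu', hu, hPξ, zero_smul, map_zero,
    inner_zero_left, real_inner_smul_right] at h11
  linarith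

end IsBiWarpedProductSubmanifold
end AntiInvariantLeaf

/-! ### The normal vector of the third factor -/

section NormalVector
variable {E : Type*} [NormedAddCommGroup E] [NormedSpace ℝ E] [FiniteDimensional ℝ E]
  {M : Type*} [TopologicalSpace M] [ChartedSpace E M] [IsManifold 𝓘(ℝ, E) ∞ M]
  [RiemannianBundle (fun x : M => TangentSpace 𝓘(ℝ, E) x)]
  [IsContMDiffRiemannianBundle 𝓘(ℝ, E) ∞ E (fun x : M => TangentSpace 𝓘(ℝ, E) x)]
  {E₁ : Type*} [NormedAddCommGroup E₁] [NormedSpace ℝ E₁] [FiniteDimensional ℝ E₁]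
  {L₁ : Type*} [TopologicalSpace L₁] [ChartedSpace E₁ L₁] [IsManifold 𝓘(ℝ, E₁) ∞ L₁]
  [RiemannianBundle (fun x : L₁ => TangentSpace 𝓘(ℝ, E₁) x)]
  {E₂ : Type*} [NormedAddCommGroup E₂] [NormedSpace ℝ E₂] [FiniteDimensional ℝ E₂]
  {L₂ : Type*} [TopologicalSpace L₂] [ChartedSpace E₂ L₂] [IsManifold 𝓘(ℝ, E₂) ∞ L₂]
  [RiemannianBundle (fun x : L₂ => TangentSpace 𝓘(ℝ, E₂) x)]
  {E₃ : Type*} [NormedAddCommGroup E₃] [NormedSpace ℝ E₃] [FiniteDimensional ℝ E₃]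
  {L₃ : Type*} [TopologicalSpace L₃] [ChartedSpace E₃ L₃] [IsManifold 𝓘(ℝ, E₃) ∞ L₃]
  [RiemannianBundle (fun x : L₃ => TangentSpace 𝓘(ℝ, E₃) x)]
  {f : L₁ × L₂ × L₃ → M} {φ₁ φ₂ : L₁ → ℝ} {S : AlmostContactMetric E M} {β : M → ℝ} {ν : ℝ}

namespace IsBiWarpedProductSubmanifold
variable (hf : IsBiWarpedProductSubmanifold (E := E) (E₁ := E₁) (E₂ := E₂) (E₃ := E₃) f φ₁ φ₂)
  (hS : S.IsLocallyConformalAlmostCosymplectic β)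
  (hξ : ∀ b c, S.IsTangentToReeb E₁ (leaf₁ f b c))
  (hmixed : IsMixedTotallyGeodesic (E₁ := E₁) (E₂ := E₂) (E₃ := E₃) S f)
include hf hS hξ hmixed

/-- If `Φ U` stays orthogonal to the third factor, then it is orthogonal to `∇_Z W`. -/
lemma inner_Φ_secondDeriv_eq_zero (p : L₁ × L₂ × L₃) {u : TangentSpace 𝓘(ℝ, E₁) p.1}
    (hu : ⟪S.ξ (f p), D₁ E E₁ E₂ E₃ f p u⟫_ℝ = 0)
    (hu' : mvfderiv 𝓘(ℝ, E₁) (fun a => Real.log (φ₂ a)) p.1 u = 0)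
    (hperp : ∀ᶠ c in 𝓝 p.2.2, ∀ w : TangentSpace 𝓘(ℝ, E₃) c, ⟪S.Φ (f (p.1, p.2.1, c))
      (D₁ E E₁ E₂ E₃ f (p.1, p.2.1, c) u), D₃ E E₁ E₂ E₃ f (p.1, p.2.1, c) w⟫_ℝ = 0)
    (z w : TangentSpace 𝓘(ℝ, E₃) p.2.2) :
    ⟪S.Φ (f p) (D₁ E E₁ E₂ E₃ f p u),
      secondDeriv 𝓘(ℝ, E) (prodModel E₁ E₂ E₃) f p (incl₃ p z) (incl₃ p w)⟫_ℝ = 0 := by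
  have hd := hS.mdifferentiableAt_inner_Φ_pushField hf.smooth_f p (incl₁ p u) (incl₃ p w)
  have h := hS.mvfderiv_inner_Φ_pushField hf.smooth_f p (incl₃ p z) (incl₁ p u) (incl₃ p w)
  have hev : (fun c => ⟪S.Φ (f (p.1, p.2.1, c)) (pushField 𝓘(ℝ, E) (prodModel E₁ E₂ E₃) f p
      (incl₁ p u) (p.1, p.2.1, c)), pushField 𝓘(ℝ, E) (prodModel E₁ E₂ E₃) f p (incl₃ p w)
      (p.1, p.2.1, c)⟫_ℝ) =ᶠ[𝓝 p.2.2] fun _ => (0 : ℝ) := by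
    filter_upwards [(eventually_slice (eventually_pushField_incl₁ E E₁ E₂ E₃ f p)).2.2,
      (eventually_slice (eventually_pushField_incl₃ E E₁ E₂ E₃ f p)).2.2, hperp] with c h1 h3 h0
    rw [h1, h3, coordField_self]
    exact h0 _
  rw [mvfderiv_incl₃ hd z, eventually_mvfderiv_congr hev, mvfderiv_const,
    hf.secondDeriv_of_isMixedTotallyGeodesic hmixed p z hu, hu', zero_smul, map_zero,
    inner_zero_left, zero_add] at h
  change (0 : ℝ) = β (f p) * (⟪S.Φ (f p) (D₃ E E₁ E₂ E₃ f p z), D₁ E E₁ E₂ E₃ f p u⟫_ℝ *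
      ⟪S.ξ (f p), D₃ E E₁ E₂ E₃ f p w⟫_ℝ - ⟪S.ξ (f p), D₁ E E₁ E₂ E₃ f p u⟫_ℝ * _) + _ at h
  rw [hu, hf.inner_ξ_D₃ hξ, mul_zero, zero_mul, sub_zero, mul_zero, zero_add] at h
  exact h.symm

variable (hsl : ∀ b c, S.IsSlant E₁ (leaf₁ f b c) ν)
include hsl

/-- A vector `U` of the slant leaf that is orthogonal to `ξ` and to the gradient of `ln φ₂`, but
whose image under the slant operator is not orthogonal to this gradient, is mapped by `Φ` to a
vector orthogonal to the third factor, near the given point of the third factor. -/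
lemma eventually_inner_Φ_D₁_D₃ (p : L₁ × L₂ × L₃) {u : TangentSpace 𝓘(ℝ, E₁) p.1}
    (hu : ⟪S.ξ (f p), D₁ E E₁ E₂ E₃ f p u⟫_ℝ = 0)
    (hu' : mvfderiv 𝓘(ℝ, E₁) (fun a => Real.log (φ₂ a)) p.1 u = 0)
    (hPu : mvfderiv 𝓘(ℝ, E₁) (fun a => Real.log (φ₂ a)) p.1
      (slantOperator E₁ E₂ E₃ f S p u) ≠ 0) :
    ∀ᶠ c in 𝓝 p.2.2, ∀ w : TangentSpace 𝓘(ℝ, E₃) c, ⟪S.Φ (f (p.1, p.2.1, c))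
      (D₁ E E₁ E₂ E₃ f (p.1, p.2.1, c) u), D₃ E E₁ E₂ E₃ f (p.1, p.2.1, c) w⟫_ℝ = 0 := by
  set e := stdOrthonormalBasis ℝ (TangentSpace 𝓘(ℝ, E₁) p.1) with he
  let F : L₃ → ℝ := fun c => ∑ i, mvfderiv 𝓘(ℝ, E₁) (fun a => Real.log (φ₂ a)) p.1 (e i) *
    ⟪S.Φ (f (p.1, p.2.1, c)) (D₁ E E₁ E₂ E₃ f (p.1, p.2.1, c) u),
      D₁ E E₁ E₂ E₃ f (p.1, p.2.1, c) (e i)⟫_ℝ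
  have hFeq : ∀ c, F c = mvfderiv 𝓘(ℝ, E₁) (fun a => Real.log (φ₂ a)) p.1
      (slantOperator E₁ E₂ E₃ f S (p.1, p.2.1, c) u) := fun c => by
    change F c = mvfderiv 𝓘(ℝ, E₁) (fun a => Real.log (φ₂ a)) p.1 (∑ i, ⟪S.Φ (f (p.1, p.2.1, c))
      (D₁ E E₁ E₂ E₃ f (p.1, p.2.1, c) u), D₁ E E₁ E₂ E₃ f (p.1, p.2.1, c) (e i)⟫_ℝ • e i)
    rw [map_sum]
    refine Finset.sum_congr rfl fun i _ => ?_
    rw [map_smul, smul_eq_mul, mul_comm]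
  have hFc : ContinuousAt F p.2.2 := tendsto_finsetSum _ fun i _ =>
    tendsto_const_nhds.mul (mvfderiv_leaf₃_inner_Φ hf.smooth_f hS p u (e i)).1.continuousAt
  have hF0 : F p.2.2 ≠ 0 := by
    rw [hFeq]
    exact hPu
  filter_upwards [hFc.eventually_ne hF0, hf.eventually_inner_ξ_D₁ hS hξ p u] with c h1 h2 w
  rw [hFeq] at h1
  exact (mul_eq_zero.1 (hf.mvfderiv_log_φ₂_mul_inner_Φ hS hξ hsl hmixed (p.1, p.2.1, c)
    (h2.trans hu) hu' w)).resolve_left h1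

variable (hT : ∀ a c, S.IsInvariant E₂ (leaf₂ f a c))
include hT

/-- A normal vector `h` with `⟪Σ(Z, W), h⟫ = ⟪Z, W⟫ |h|²` on the third factor. It is the normal part
of `-Φ U / sin² ν` for `U = T (grad (ln φ₂) - β ξ)`, where `T` is the slant operator. -/
lemma exists_normal_of_third_factor (hn : 0 < finrank ℝ E₃) (hcos : Real.cos ν ≠ 0)
    (hsin : Real.sin ν ≠ 0) (p : L₁ × L₂ × L₃) :
    ∃ h ∈ (tangentImage 𝓘(ℝ, E) (prodModel E₁ E₂ E₃) f p)ᗮ,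
      ⟪h, h⟫_ℝ = ((1 / Real.sin ν) ^ 2 - 1) *
        (gradNormSq 𝓘(ℝ, E₁) (fun a => Real.log (φ₂ a)) p.1 - β (f p) ^ 2) ∧
      ∀ z w, ⟪secondDeriv 𝓘(ℝ, E) (prodModel E₁ E₂ E₃) f p (incl₃ p z) (incl₃ p w), h⟫_ℝ =
        ⟪D₃ E E₁ E₂ E₃ f p z, D₃ E E₁ E₂ E₃ f p w⟫_ℝ * ⟪h, h⟫_ℝ := by
  obtain ⟨r, hr⟩ := exists_D₁_eq_ξ hf.smooth_f hξ p
  set dψ := mvfderiv 𝓘(ℝ, E₁) (fun a => Real.log (φ₂ a)) p.1 with hdψ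
  have hβ : dψ r = β (f p) := hf.mvfderiv_log_φ₂_ξ hS hξ hn p hr
  have hrr : ⟪r, r⟫_ℝ = 1 := by rw [← hf.inner_D₁_D₁ p, hr, S.inner_ξ_ξ]
  set g : TangentSpace 𝓘(ℝ, E₁) p.1 := rieszVector dψ - β (f p) • r with hg
  have hgv : ∀ v, ⟪g, v⟫_ℝ = dψ v - β (f p) * ⟪r, v⟫_ℝ := fun v => by
    rw [hg, inner_sub_left, inner_rieszVector, real_inner_smul_left]
  have hgr : ⟪g, r⟫_ℝ = 0 := by rw [hgv, hβ, hrr]; ring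
  have hgg : ⟪g, g⟫_ℝ = gradNormSq 𝓘(ℝ, E₁) (fun a => Real.log (φ₂ a)) p.1 - β (f p) ^ 2 := by
    rw [gradNormSq_eq]
    conv_lhs => rw [hg, inner_sub_right, real_inner_smul_right, ← hg, hgr, hgv,
      real_inner_comm, inner_rieszVector, hβ]
    rw [inner_rieszVector]
    ring
  have hξv : ∀ v, ⟪S.ξ (f p), D₁ E E₁ E₂ E₃ f p v⟫_ℝ = ⟪r, v⟫_ℝ := fun v => by
    rw [← hr, hf.inner_D₁_D₁]
  set u := slantOperator E₁ E₂ E₃ f S p g with hu_def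
  set Pu := slantOperator E₁ E₂ E₃ f S p u with hPu_def
  have hu : ⟪S.ξ (f p), D₁ E E₁ E₂ E₃ f p u⟫_ℝ = 0 :=
    inner_ξ_D₁_slantOperator hf.smooth_f hξ p g (hf.inner_D₁_D₁ p)
  have hPuξ : ⟪S.ξ (f p), D₁ E E₁ E₂ E₃ f p Pu⟫_ℝ = 0 :=
    inner_ξ_D₁_slantOperator hf.smooth_f hξ p u (hf.inner_D₁_D₁ p)
  have hu' : dψ u = 0 := by
    have h1 := hgv u
    rw [← hξv, hu, real_inner_comm, hu_def, inner_slantOperator, S.inner_Φ_self] at h1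
    linarith
  have hPu : dψ Pu = -⟪u, u⟫_ℝ := by
    have h1 := hgv Pu
    rw [← hξv, hPuξ, real_inner_comm, hPu_def, inner_slantOperator_left, ← hu_def] at h1
    linarith
  have huu : ⟪u, u⟫_ℝ = Real.cos ν ^ 2 * ⟪g, g⟫_ℝ := by
    rw [hu_def, hf.inner_slantOperator_self hsl, hξv, real_inner_comm g r, hgr]
    ring
  have hsc := Real.sin_sq_add_cos_sq ν
  have hcot : (1 / Real.sin ν) ^ 2 - 1 = Real.cos ν ^ 2 / Real.sin ν ^ 2 := by
    field_simp
    linarith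
  -- if `u = 0`, then `g = 0`, and `h = 0` will do
  by_cases h0 : ⟪u, u⟫_ℝ = 0
  · have h1 : ⟪g, g⟫_ℝ = 0 :=
      (mul_eq_zero.1 (huu.symm.trans h0)).resolve_left (pow_ne_zero _ hcos)
    refine ⟨0, Submodule.zero_mem _, ?_, fun z w => ?_⟩
    · rw [← hgg, h1, inner_zero_left, mul_zero]
    · rw [inner_zero_right, inner_zero_right, mul_zero]
  have hperp := hf.eventually_inner_Φ_D₁_D₃ hS hξ hmixed hsl p hu hu'
    (by rw [← hPu_def, ← hdψ, hPu]; exact neg_ne_zero.2 h0)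
  set n := S.Φ (f p) (D₁ E E₁ E₂ E₃ f p u) - D₁ E E₁ E₂ E₃ f p Pu with hn_def
  have hnn : ⟪n, n⟫_ℝ = Real.sin ν ^ 2 * ⟪u, u⟫_ℝ := by
    rw [hn_def, hPu_def, hf.inner_Φ_sub_D₁_slantOperator_self hsl, hu]
    ring
  have hnorm : n ∈ (tangentImage 𝓘(ℝ, E) (prodModel E₁ E₂ E₃) f p)ᗮ := by
    refine (mem_tangentImage_orthogonal_iff p n).2 ⟨fun v => ?_, fun x => ?_, fun z => ?_⟩
    · rw [real_inner_comm]
      exact hf.inner_Φ_sub_D₁_slantOperator p u v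
    · rw [real_inner_comm, hn_def, inner_sub_left, hf.inner_Φ_D₁_D₂ hT, hf.inner_D₁_D₂, sub_zero]
    · rw [real_inner_comm, hn_def, inner_sub_left, hf.inner_D₁_D₃, sub_zero]
      exact hperp.self_of_nhds z
  have hAn : ∀ z w, ⟪secondDeriv 𝓘(ℝ, E) (prodModel E₁ E₂ E₃) f p (incl₃ p z) (incl₃ p w), n⟫_ℝ =
      -(⟪u, u⟫_ℝ * ⟪D₃ E E₁ E₂ E₃ f p z, D₃ E E₁ E₂ E₃ f p w⟫_ℝ) := fun z w => by
    have h1 : ⟪_, D₁ E E₁ E₂ E₃ f p Pu⟫_ℝ = _ := hf.christoffelFirst₃₃₁ p z w Pu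
    rw [hn_def, inner_sub_right, h1, real_inner_comm,
      hf.inner_Φ_secondDeriv_eq_zero hS hξ hmixed p hu hu' hperp, ← hdψ, hPu]
    ring
  have hHH : ⟪(-(Real.sin ν ^ 2)⁻¹) • n, (-(Real.sin ν ^ 2)⁻¹) • n⟫_ℝ =
      (Real.sin ν ^ 2)⁻¹ * ⟪u, u⟫_ℝ := by
    rw [real_inner_smul_left, real_inner_smul_right, hnn]
    field_simp
  refine ⟨(-(Real.sin ν ^ 2)⁻¹) • n, Submodule.smul_mem _ _ hnorm, ?_, fun z w => ?_⟩
  · rw [hHH, huu, hcot, ← hgg]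
    field_simp
  · rw [hHH, real_inner_smul_right, hAn]
    ring

end IsBiWarpedProductSubmanifold
end NormalVector

/-! ### Parseval frames -/

section Frame
variable {V : Type*} [AddCommGroup V] [Module ℝ V] {W : Type*} [NormedAddCommGroup W]
  [InnerProductSpace ℝ W] {X : Type*} [NormedAddCommGroup X] [InnerProductSpace ℝ X]
  {κ κ' : Type*} [Fintype κ] [Fintype κ']

/-- `e` is a Parseval frame for the inner product pulled back by `D`: every `v` is
`∑ i, ⟪e i, v⟫ e i`. This holds for orthonormal bases, and it is all that is needed to compute
traces in a basis-independent way. -/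
def IsParsevalFrame (D : V →ₗ[ℝ] W) (e : κ → V) : Prop :=
  ∀ v, v = ∑ i, ⟪D (e i), D v⟫_ℝ • e i

variable {D : V →ₗ[ℝ] W} {e : κ → V} {e' : κ' → V}

lemma IsParsevalFrame.sum_inner_eq (he : IsParsevalFrame D e) (he' : IsParsevalFrame D e')
    (T : V →ₗ[ℝ] X) : ∑ i, ⟪T (e i), T (e i)⟫_ℝ = ∑ k, ⟪T (e' k), T (e' k)⟫_ℝ := by
  have h1 : ∀ i, ⟪T (e i), T (e i)⟫_ℝ = ∑ k, ⟪D (e' k), D (e i)⟫_ℝ * ⟪T (e' k), T (e i)⟫_ℝ := by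
    intro i
    refine (congrArg (fun v => ⟪T v, T (e i)⟫_ℝ) (he' (e i))).trans ?_
    rw [map_sum, sum_inner]
    refine Finset.sum_congr rfl fun k _ => ?_
    rw [map_smul, real_inner_smul_left]
  have h2 : ∀ k, ⟪T (e' k), T (e' k)⟫_ℝ = ∑ i, ⟪D (e i), D (e' k)⟫_ℝ * ⟪T (e' k), T (e i)⟫_ℝ := by
    intro k
    refine (congrArg (fun v => ⟪T (e' k), T v⟫_ℝ) (he (e' k))).trans ?_
    rw [map_sum, inner_sum]
    refine Finset.sum_congr rfl fun i _ => ?_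
    rw [map_smul, real_inner_smul_right]
  simp only [h1, h2]
  rw [Finset.sum_comm]
  refine Finset.sum_congr rfl fun k _ => Finset.sum_congr rfl fun i _ => ?_
  rw [real_inner_comm (D (e i))]

lemma IsParsevalFrame.sum_sum_inner_eq (he : IsParsevalFrame D e) (he' : IsParsevalFrame D e')
    (B : V →ₗ[ℝ] V →ₗ[ℝ] X) : ∑ i, ∑ j, ⟪B (e i) (e j), B (e i) (e j)⟫_ℝ =
      ∑ k, ∑ l, ⟪B (e' k) (e' l), B (e' k) (e' l)⟫_ℝ := by
  have h1 : ∀ i, ∑ j, ⟪B (e i) (e j), B (e i) (e j)⟫_ℝ =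
      ∑ l, ⟪B (e i) (e' l), B (e i) (e' l)⟫_ℝ := fun i => he.sum_inner_eq he' (B (e i))
  simp only [h1]
  exact Finset.sum_comm.trans ((Finset.sum_congr rfl fun l _ =>
    he.sum_inner_eq he' (B.flip (e' l))).trans Finset.sum_comm)

lemma IsParsevalFrame.eq_zero_of_sum_sum_inner (he : IsParsevalFrame D e)
    {B : V →ₗ[ℝ] V →ₗ[ℝ] X} (h : ∑ i, ∑ j, ⟪B (e i) (e j), B (e i) (e j)⟫_ℝ = 0) (v w : V) :
    B v w = 0 := by
  have h1 : ∀ i j, B (e i) (e j) = 0 := fun i j => by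
    have h2 := (Finset.sum_eq_zero_iff_of_nonneg fun i _ =>
      Finset.sum_nonneg fun j _ => real_inner_self_nonneg).1 h i (Finset.mem_univ i)
    have h3 := (Finset.sum_eq_zero_iff_of_nonneg fun j _ => real_inner_self_nonneg).1 h2 j
      (Finset.mem_univ j)
    exact inner_self_eq_zero.1 h3
  rw [he v, he w]
  simp only [map_sum, LinearMap.sum_apply, map_smul, LinearMap.smul_apply, h1, smul_zero,
    Finset.sum_const_zero]

end Frame

/-! ### The norm of the second fundamental form -/

section InducedFrame
variable {E : Type*} [NormedAddCommGroup E] [NormedSpace ℝ E] [FiniteDimensional ℝ E]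
  {H : Type*} [TopologicalSpace H] {I : ModelWithCorners ℝ E H}
  {M : Type*} [TopologicalSpace M] [ChartedSpace H M] [IsManifold I ∞ M]
  {E' : Type*} [NormedAddCommGroup E'] [NormedSpace ℝ E'] [FiniteDimensional ℝ E']
  {H' : Type*} [TopologicalSpace H'] {J : ModelWithCorners ℝ E' H'} [J.Boundaryless]
  {N : Type*} [TopologicalSpace N] [ChartedSpace H' N] [IsManifold J ∞ N]
  [RiemannianBundle (fun x : M => TangentSpace I x)]
  [IsContMDiffRiemannianBundle I ∞ E (fun x : M => TangentSpace I x)]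

lemma mfderiv_inducedFrame (f : N → M) (p : N) (i : Fin (finrank ℝ (tangentImage I J f p))) :
    mfderiv J I f p (inducedFrame I J f p i) = stdOrthonormalBasis ℝ (tangentImage I J f p) i :=
  Function.invFun_eq (f := mfderiv J I f p) (stdOrthonormalBasis ℝ (tangentImage I J f p) i).2

lemma isParsevalFrame_inducedFrame {f : N → M} {p : N}
    (hinj : Function.Injective (mfderiv J I f p)) :
    IsParsevalFrame (mfderiv J I f p).toLinearMap (inducedFrame I J f p) := by
  intro v
  refine hinj ?_
  have h1 := (stdOrthonormalBasis ℝ (tangentImage I J f p)).sum_repr' ⟨mfderiv J I f p v, v, rfl⟩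
  have h2 := congrArg (Submodule.subtype _) h1
  rw [map_sum] at h2
  rw [map_sum]
  refine h2.symm.trans (Finset.sum_congr rfl fun i _ => ?_)
  rw [map_smul, map_smul]
  change ⟪((stdOrthonormalBasis ℝ (tangentImage I J f p) i : tangentImage I J f p) :
    TangentSpace I (f p)), mfderiv J I f p v⟫_ℝ •
    ((stdOrthonormalBasis ℝ (tangentImage I J f p) i : tangentImage I J f p) :
    TangentSpace I (f p)) = _
  rw [← mfderiv_inducedFrame]
  rfl

/-- The second fundamental form as a bilinear map. -/
def secondFundFormL {f : N → M} (hf : ContMDiff J I ∞ f) (p : N) :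
    TangentSpace J p →ₗ[ℝ] TangentSpace J p →ₗ[ℝ] TangentSpace I (f p) :=
  (secondDerivL hf p).compr₂ (tangentImage I J f p)ᗮ.starProjection.toLinearMap

/-- `‖Σ‖²` may be computed in any Parseval frame. -/
lemma secondFundFormNormSq_eq {f : N → M} (hf : ContMDiff J I ∞ f) {p : N}
    (hinj : Function.Injective (mfderiv J I f p)) {κ : Type*} [Fintype κ]
    {e : κ → TangentSpace J p} (he : IsParsevalFrame (mfderiv J I f p).toLinearMap e) :
    secondFundFormNormSq I J f p = ∑ i, ∑ j,
      ⟪secondFundForm I J f p (e i) (e j), secondFundForm I J f p (e i) (e j)⟫_ℝ :=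
  (isParsevalFrame_inducedFrame hinj).sum_sum_inner_eq he (secondFundFormL hf p)

lemma inner_secondFundForm_of_mem_orthogonal (f : N → M) (p : N) (v w : TangentSpace J p)
    {h : TangentSpace I (f p)} (hh : h ∈ (tangentImage I J f p)ᗮ) :
    ⟪secondFundForm I J f p v w, h⟫_ℝ = ⟪secondDeriv I J f p v w, h⟫_ℝ := by
  rw [secondFundForm_eq, Submodule.inner_starProjection_left_eq_right,
    Submodule.starProjection_eq_self_iff.2 hh]

/-- If `Σ(u, w) = ⟪u, w⟫ h`, then `h` is the mean curvature vector (in dimension `0`, both sides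
of the umbilicity equation vanish). -/
lemma isTotallyUmbilical_of_secondFundForm_eq {f : N → M} (h : Π p, TangentSpace I (f p))
    (hh : ∀ p u w, secondFundForm I J f p u w =
      ⟪mfderiv J I f p u, mfderiv J I f p w⟫_ℝ • h p) : IsTotallyUmbilical I J f := by
  intro p u w
  rw [hh]
  rcases Nat.eq_zero_or_pos (finrank ℝ (tangentImage I J f p)) with h0 | hpos
  · have h1 : tangentImage I J f p = ⊥ := Submodule.finrank_eq_zero.1 h0
    have h2 : mfderiv J I f p u = 0 := (Submodule.mem_bot ℝ).1 (h1 ▸ ⟨u, rfl⟩)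
    rw [h2, inner_zero_left, zero_smul, zero_smul]
  · congr 1
    have h1 : ∀ i, secondFundForm I J f p (inducedFrame I J f p i) (inducedFrame I J f p i) =
        h p := fun i => by
      rw [hh, mfderiv_inducedFrame, ← Submodule.coe_inner,
        (stdOrthonormalBasis ℝ (tangentImage I J f p)).inner_eq_one, one_smul]
    rw [meanCurvature, Finset.sum_congr rfl fun i _ => h1 i, Finset.sum_const, Finset.card_univ,
      Fintype.card_fin, ← Nat.cast_smul_eq_nsmul ℝ, smul_smul,
      one_div_mul_cancel (Nat.cast_ne_zero.2 hpos.ne'), one_smul]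

end InducedFrame

/-! ### The inequality -/

section Inequality
variable {E : Type*} [NormedAddCommGroup E] [NormedSpace ℝ E] [FiniteDimensional ℝ E]
  {M : Type*} [TopologicalSpace M] [ChartedSpace E M] [IsManifold 𝓘(ℝ, E) ∞ M]
  [RiemannianBundle (fun x : M => TangentSpace 𝓘(ℝ, E) x)]
  [IsContMDiffRiemannianBundle 𝓘(ℝ, E) ∞ E (fun x : M => TangentSpace 𝓘(ℝ, E) x)]
  {E₁ : Type*} [NormedAddCommGroup E₁] [NormedSpace ℝ E₁] [FiniteDimensional ℝ E₁]
  {L₁ : Type*} [TopologicalSpace L₁] [ChartedSpace E₁ L₁] [IsManifold 𝓘(ℝ, E₁) ∞ L₁]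
  [RiemannianBundle (fun x : L₁ => TangentSpace 𝓘(ℝ, E₁) x)]
  {E₂ : Type*} [NormedAddCommGroup E₂] [NormedSpace ℝ E₂] [FiniteDimensional ℝ E₂]
  {L₂ : Type*} [TopologicalSpace L₂] [ChartedSpace E₂ L₂] [IsManifold 𝓘(ℝ, E₂) ∞ L₂]
  [RiemannianBundle (fun x : L₂ => TangentSpace 𝓘(ℝ, E₂) x)]
  {E₃ : Type*} [NormedAddCommGroup E₃] [NormedSpace ℝ E₃] [FiniteDimensional ℝ E₃]
  {L₃ : Type*} [TopologicalSpace L₃] [ChartedSpace E₃ L₃] [IsManifold 𝓘(ℝ, E₃) ∞ L₃]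
  [RiemannianBundle (fun x : L₃ => TangentSpace 𝓘(ℝ, E₃) x)]
  {f : L₁ × L₂ × L₃ → M} {φ₁ φ₂ : L₁ → ℝ} {S : AlmostContactMetric E M} {β : M → ℝ} {ν : ℝ}

variable (E₁ E₂ E₃ φ₁ φ₂) in
/-- The orthonormal frame of the bi-warped product metric made of orthonormal bases of the tangent
spaces of the three factors. -/
def adaptedFrame (p : L₁ × L₂ × L₃) :
    Fin (finrank ℝ (TangentSpace 𝓘(ℝ, E₁) p.1)) ⊕ Fin (finrank ℝ (TangentSpace 𝓘(ℝ, E₂) p.2.1)) ⊕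
      Fin (finrank ℝ (TangentSpace 𝓘(ℝ, E₃) p.2.2)) → TangentSpace (prodModel E₁ E₂ E₃) p :=
  Sum.elim (fun i => incl₁ p (stdOrthonormalBasis ℝ (TangentSpace 𝓘(ℝ, E₁) p.1) i))
    (Sum.elim
      (fun j => (φ₁ p.1)⁻¹ • incl₂ p (stdOrthonormalBasis ℝ (TangentSpace 𝓘(ℝ, E₂) p.2.1) j))
      (fun k => (φ₂ p.1)⁻¹ • incl₃ p (stdOrthonormalBasis ℝ (TangentSpace 𝓘(ℝ, E₃) p.2.2) k)))

variable (E E₁ E₂ E₃ f) in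
/-- The differential of `f`, composed with the projection to the tangent space of the third
factor. -/
def thirdPart (p : L₁ × L₂ × L₃) :
    TangentSpace (prodModel E₁ E₂ E₃) p →ₗ[ℝ] TangentSpace 𝓘(ℝ, E) (f p) :=
  (D₃ E E₁ E₂ E₃ f p).toLinearMap ∘ₗ LinearMap.snd ℝ E₂ E₃ ∘ₗ LinearMap.snd ℝ E₁ (E₂ × E₃)

lemma thirdPart_incl₁ (p : L₁ × L₂ × L₃) (u : TangentSpace 𝓘(ℝ, E₁) p.1) :
    thirdPart E E₁ E₂ E₃ f p (incl₁ p u) = 0 :=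
  map_zero (D₃ E E₁ E₂ E₃ f p)

lemma thirdPart_incl₂ (p : L₁ × L₂ × L₃) (x : TangentSpace 𝓘(ℝ, E₂) p.2.1) :
    thirdPart E E₁ E₂ E₃ f p (incl₂ p x) = 0 :=
  map_zero (D₃ E E₁ E₂ E₃ f p)

lemma thirdPart_incl₃ (p : L₁ × L₂ × L₃) (z : TangentSpace 𝓘(ℝ, E₃) p.2.2) :
    thirdPart E E₁ E₂ E₃ f p (incl₃ p z) = D₃ E E₁ E₂ E₃ f p z := rfl

namespace IsBiWarpedProductSubmanifold
variable (hf : IsBiWarpedProductSubmanifold (E := E) (E₁ := E₁) (E₂ := E₂) (E₃ := E₃) f φ₁ φ₂)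
include hf

lemma isParsevalFrame_adaptedFrame (p : L₁ × L₂ × L₃) :
    IsParsevalFrame (mfderiv (prodModel E₁ E₂ E₃) 𝓘(ℝ, E) f p).toLinearMap
      (adaptedFrame E₁ E₂ E₃ φ₁ φ₂ p) := by
  intro v
  obtain ⟨u, x, z, rfl⟩ := exists_eq_incl_add p v
  have hD : mfderiv (prodModel E₁ E₂ E₃) 𝓘(ℝ, E) f p (incl₁ p u + incl₂ p x + incl₃ p z) =
      D₁ E E₁ E₂ E₃ f p u + D₂ E E₁ E₂ E₃ f p x + D₃ E E₁ E₂ E₃ f p z := by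
    rw [map_add, map_add]; rfl
  have h1 : ∀ u', ⟪D₁ E E₁ E₂ E₃ f p u', D₁ E E₁ E₂ E₃ f p u + D₂ E E₁ E₂ E₃ f p x +
      D₃ E E₁ E₂ E₃ f p z⟫_ℝ = ⟪u', u⟫_ℝ := fun u' => by
    rw [inner_add_right, inner_add_right, hf.inner_D₁_D₁, hf.inner_D₁_D₂, hf.inner_D₁_D₃]
    ring
  have h2 : ∀ x', ⟪D₂ E E₁ E₂ E₃ f p x', D₁ E E₁ E₂ E₃ f p u + D₂ E E₁ E₂ E₃ f p x +
      D₃ E E₁ E₂ E₃ f p z⟫_ℝ = φ₁ p.1 ^ 2 * ⟪x', x⟫_ℝ := fun x' => by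
    rw [inner_add_right, inner_add_right, real_inner_comm, hf.inner_D₁_D₂, hf.inner_D₂_D₂,
      hf.inner_D₂_D₃]
    ring
  have h3 : ∀ z', ⟪D₃ E E₁ E₂ E₃ f p z', D₁ E E₁ E₂ E₃ f p u + D₂ E E₁ E₂ E₃ f p x +
      D₃ E E₁ E₂ E₃ f p z⟫_ℝ = φ₂ p.1 ^ 2 * ⟪z', z⟫_ℝ := fun z' => by
    rw [inner_add_right, inner_add_right, real_inner_comm, hf.inner_D₁_D₃,
      real_inner_comm (D₂ E E₁ E₂ E₃ f p x), hf.inner_D₂_D₃, hf.inner_D₃_D₃]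
    ring
  rw [Fintype.sum_sum_type, Fintype.sum_sum_type, ← add_assoc]
  congr 1
  · congr 1
    · conv_lhs => rw [← (stdOrthonormalBasis ℝ (TangentSpace 𝓘(ℝ, E₁) p.1)).sum_repr' u, map_sum]
      refine Finset.sum_congr rfl fun i _ => ?_
      rw [map_smul, ← h1, ← hD]
      rfl
    · conv_lhs => rw [← (stdOrthonormalBasis ℝ (TangentSpace 𝓘(ℝ, E₂) p.2.1)).sum_repr' x, map_sum]
      refine Finset.sum_congr rfl fun i _ => ?_
      have h4 := h2 (stdOrthonormalBasis ℝ (TangentSpace 𝓘(ℝ, E₂) p.2.1) i)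
      rw [← hD] at h4
      change _ = ⟪mfderiv (prodModel E₁ E₂ E₃) 𝓘(ℝ, E) f p ((φ₁ p.1)⁻¹ • incl₂ p _), _⟫_ℝ •
        ((φ₁ p.1)⁻¹ • incl₂ p _)
      rw [map_smul, map_smul, real_inner_smul_left, smul_smul]
      refine congrArg (· • _) ?_
      refine Eq.trans ?_ (congrArg (fun t => (φ₁ p.1)⁻¹ * t * (φ₁ p.1)⁻¹) h4).symm
      field_simp [(hf.pos_φ₁ p.1).ne']
  · conv_lhs => rw [← (stdOrthonormalBasis ℝ (TangentSpace 𝓘(ℝ, E₃) p.2.2)).sum_repr' z, map_sum]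
    refine Finset.sum_congr rfl fun i _ => ?_
    have h4 := h3 (stdOrthonormalBasis ℝ (TangentSpace 𝓘(ℝ, E₃) p.2.2) i)
    rw [← hD] at h4
    change _ = ⟪mfderiv (prodModel E₁ E₂ E₃) 𝓘(ℝ, E) f p ((φ₂ p.1)⁻¹ • incl₃ p _), _⟫_ℝ •
      ((φ₂ p.1)⁻¹ • incl₃ p _)
    rw [map_smul, map_smul, real_inner_smul_left, smul_smul]
    refine congrArg (· • _) ?_
    refine Eq.trans ?_ (congrArg (fun t => (φ₂ p.1)⁻¹ * t * (φ₂ p.1)⁻¹) h4).symm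
    field_simp [(hf.pos_φ₂ p.1).ne']

lemma mfderiv_injective (p : L₁ × L₂ × L₃) :
    Function.Injective (mfderiv (prodModel E₁ E₂ E₃) 𝓘(ℝ, E) f p) := by
  refine (injective_iff_map_eq_zero _).2 fun v hv => ?_
  rw [hf.isParsevalFrame_adaptedFrame p v]
  refine Finset.sum_eq_zero fun i _ => ?_
  change ⟪_, mfderiv (prodModel E₁ E₂ E₃) 𝓘(ℝ, E) f p v⟫_ℝ • _ = _
  rw [hv, inner_zero_right, zero_smul]

variable {p : L₁ × L₂ × L₃} {h : TangentSpace 𝓘(ℝ, E) (f p)}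
  (hh : h ∈ (tangentImage 𝓘(ℝ, E) (prodModel E₁ E₂ E₃) f p)ᗮ)
  (hA : ∀ z w, ⟪secondDeriv 𝓘(ℝ, E) (prodModel E₁ E₂ E₃) f p (incl₃ p z) (incl₃ p w), h⟫_ℝ =
    ⟪D₃ E E₁ E₂ E₃ f p z, D₃ E E₁ E₂ E₃ f p w⟫_ℝ * ⟪h, h⟫_ℝ)
include hh hA

/-- `‖Σ‖² = n₃ |h|² + ‖Σ - ⟪·, ·⟫₃ h‖²`, where `⟪·, ·⟫₃` is the metric of the third factor. -/
lemma secondFundFormNormSq_eq_add :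
    ∃ B : TangentSpace (prodModel E₁ E₂ E₃) p →ₗ[ℝ] TangentSpace (prodModel E₁ E₂ E₃) p →ₗ[ℝ]
        TangentSpace 𝓘(ℝ, E) (f p),
      (∀ v w, B v w = secondFundForm 𝓘(ℝ, E) (prodModel E₁ E₂ E₃) f p v w -
        ⟪thirdPart E E₁ E₂ E₃ f p v, thirdPart E E₁ E₂ E₃ f p w⟫_ℝ • h) ∧
      secondFundFormNormSq 𝓘(ℝ, E) (prodModel E₁ E₂ E₃) f p = finrank ℝ E₃ * ⟪h, h⟫_ℝ +
        ∑ s, ∑ t, ⟪B (adaptedFrame E₁ E₂ E₃ φ₁ φ₂ p s) (adaptedFrame E₁ E₂ E₃ φ₁ φ₂ p t),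
          B (adaptedFrame E₁ E₂ E₃ φ₁ φ₂ p s) (adaptedFrame E₁ E₂ E₃ φ₁ φ₂ p t)⟫_ℝ := by
  set ε := adaptedFrame E₁ E₂ E₃ φ₁ φ₂ p with hε
  set C := thirdPart E E₁ E₂ E₃ f p with hC
  set e := stdOrthonormalBasis ℝ (TangentSpace 𝓘(ℝ, E₃) p.2.2) with he
  have hε₁ : ∀ i, C (ε (.inl i)) = 0 := fun i => thirdPart_incl₁ p _
  have hε₂ : ∀ j, C (ε (.inr (.inl j))) = 0 := fun j =>
    (map_smul C _ _).trans (by rw [hC, thirdPart_incl₂, smul_zero])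
  have hε₃ : ∀ k l, ⟪C (ε (.inr (.inr k))), C (ε (.inr (.inr l)))⟫_ℝ = ⟪e k, e l⟫_ℝ := fun k l => by
    change ⟪C ((φ₂ p.1)⁻¹ • incl₃ p (e k)), C ((φ₂ p.1)⁻¹ • incl₃ p (e l))⟫_ℝ = _
    rw [map_smul, map_smul, real_inner_smul_left, real_inner_smul_right, hC, thirdPart_incl₃,
      thirdPart_incl₃, hf.inner_D₃_D₃]
    field_simp [(hf.pos_φ₂ p.1).ne']
  have hsum : ∑ s, ∑ t, ⟪C (ε s), C (ε t)⟫_ℝ ^ 2 = finrank ℝ E₃ := by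
    simp only [Fintype.sum_sum_type, hε₁, hε₂, hε₃, inner_zero_left, inner_zero_right,
      zero_pow two_ne_zero, Finset.sum_const_zero, zero_add]
    simp only [he, OrthonormalBasis.inner_eq_ite, ite_pow, one_pow, zero_pow two_ne_zero,
      Finset.sum_ite_eq, Finset.mem_univ, if_true, Finset.sum_const, Finset.card_univ,
      Fintype.card_fin, nsmul_eq_mul, mul_one]
    rfl
  let Bc : TangentSpace (prodModel E₁ E₂ E₃) p →ₗ[ℝ] TangentSpace (prodModel E₁ E₂ E₃) p →ₗ[ℝ] ℝ :=
    (innerₗ (TangentSpace 𝓘(ℝ, E) (f p))).compl₁₂ C C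
  let B := secondFundFormL hf.smooth_f p -
    Bc.compr₂ (LinearMap.toSpanSingleton ℝ (TangentSpace 𝓘(ℝ, E) (f p)) h)
  have hB : ∀ v w, B v w = secondFundForm 𝓘(ℝ, E) (prodModel E₁ E₂ E₃) f p v w -
      ⟪C v, C w⟫_ℝ • h := fun v w => rfl
  refine ⟨B, hB, ?_⟩
  have hσ : ∀ s t, ⟪C (ε s), C (ε t)⟫_ℝ *
      ⟪secondFundForm 𝓘(ℝ, E) (prodModel E₁ E₂ E₃) f p (ε s) (ε t), h⟫_ℝ =
      ⟪C (ε s), C (ε t)⟫_ℝ ^ 2 * ⟪h, h⟫_ℝ := by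
    rintro (i | j | k) t
    · rw [hε₁, inner_zero_left]; ring
    · rw [hε₂, inner_zero_left]; ring
    rcases t with (i | j | l)
    · rw [hε₁, inner_zero_right]; ring
    · rw [hε₂, inner_zero_right]; ring
    · have h1 : ⟪secondFundForm 𝓘(ℝ, E) (prodModel E₁ E₂ E₃) f p (ε (.inr (.inr k)))
          (ε (.inr (.inr l))), h⟫_ℝ =
          ⟪C (ε (.inr (.inr k))), C (ε (.inr (.inr l)))⟫_ℝ * ⟪h, h⟫_ℝ := by
        rw [inner_secondFundForm_of_mem_orthogonal f p _ _ hh]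
        change ⟪secondDerivL hf.smooth_f p ((φ₂ p.1)⁻¹ • incl₃ p (e k))
          ((φ₂ p.1)⁻¹ • incl₃ p (e l)), h⟫_ℝ =
          ⟪C ((φ₂ p.1)⁻¹ • incl₃ p (e k)), C ((φ₂ p.1)⁻¹ • incl₃ p (e l))⟫_ℝ * ⟪h, h⟫_ℝ
        rw [map_smul, map_smul, map_smul, map_smul, LinearMap.smul_apply, real_inner_smul_left,
          real_inner_smul_left, real_inner_smul_left, real_inner_smul_right, secondDerivL_apply,
          hA, hC, thirdPart_incl₃, thirdPart_incl₃]
        ring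
      rw [h1]
      ring
  rw [secondFundFormNormSq_eq hf.smooth_f (hf.mfderiv_injective p)
    (hf.isParsevalFrame_adaptedFrame p), ← hsum, Finset.sum_mul, ← Finset.sum_add_distrib]
  refine Finset.sum_congr rfl fun s _ => ?_
  rw [Finset.sum_mul, ← Finset.sum_add_distrib]
  refine Finset.sum_congr rfl fun t _ => ?_
  rw [hB, inner_sub_left, inner_sub_right, inner_sub_right, real_inner_smul_left,
    real_inner_smul_left, real_inner_smul_right, real_inner_smul_right,
    real_inner_comm (secondFundForm 𝓘(ℝ, E) (prodModel E₁ E₂ E₃) f p (ε s) (ε t)) h]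
  have h2 := hσ s t
  linear_combination 2 * h2

lemma finrank_mul_le_secondFundFormNormSq :
    finrank ℝ E₃ * ⟪h, h⟫_ℝ ≤ secondFundFormNormSq 𝓘(ℝ, E) (prodModel E₁ E₂ E₃) f p := by
  obtain ⟨B, -, hB⟩ := hf.secondFundFormNormSq_eq_add hh hA
  rw [hB]
  exact le_add_of_nonneg_right
    (Finset.sum_nonneg fun s _ => Finset.sum_nonneg fun t _ => real_inner_self_nonneg)

lemma secondFundForm_eq_of_normSq_eq
    (heq : secondFundFormNormSq 𝓘(ℝ, E) (prodModel E₁ E₂ E₃) f p = finrank ℝ E₃ * ⟪h, h⟫_ℝ)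
    (v w : TangentSpace (prodModel E₁ E₂ E₃) p) :
    secondFundForm 𝓘(ℝ, E) (prodModel E₁ E₂ E₃) f p v w =
      ⟪thirdPart E E₁ E₂ E₃ f p v, thirdPart E E₁ E₂ E₃ f p w⟫_ℝ • h := by
  obtain ⟨B, hB, hB'⟩ := hf.secondFundFormNormSq_eq_add hh hA
  rw [heq] at hB'
  have h1 := (hf.isParsevalFrame_adaptedFrame p).eq_zero_of_sum_sum_inner
    (left_eq_add.1 hB') v w
  rw [hB] at h1
  exact sub_eq_zero.1 h1

end IsBiWarpedProductSubmanifold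
end Inequality

/-! ### The leaves in the case of equality -/

section Leaves
variable {E : Type*} [NormedAddCommGroup E] [NormedSpace ℝ E] [FiniteDimensional ℝ E]
  {M : Type*} [TopologicalSpace M] [ChartedSpace E M] [IsManifold 𝓘(ℝ, E) ∞ M]
  [RiemannianBundle (fun x : M => TangentSpace 𝓘(ℝ, E) x)]
  [IsContMDiffRiemannianBundle 𝓘(ℝ, E) ∞ E (fun x : M => TangentSpace 𝓘(ℝ, E) x)]
  {E₁ : Type*} [NormedAddCommGroup E₁] [NormedSpace ℝ E₁] [FiniteDimensional ℝ E₁]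
  {L₁ : Type*} [TopologicalSpace L₁] [ChartedSpace E₁ L₁] [IsManifold 𝓘(ℝ, E₁) ∞ L₁]
  [RiemannianBundle (fun x : L₁ => TangentSpace 𝓘(ℝ, E₁) x)]
  {E₂ : Type*} [NormedAddCommGroup E₂] [NormedSpace ℝ E₂] [FiniteDimensional ℝ E₂]
  {L₂ : Type*} [TopologicalSpace L₂] [ChartedSpace E₂ L₂] [IsManifold 𝓘(ℝ, E₂) ∞ L₂]
  [RiemannianBundle (fun x : L₂ => TangentSpace 𝓘(ℝ, E₂) x)]
  {E₃ : Type*} [NormedAddCommGroup E₃] [NormedSpace ℝ E₃] [FiniteDimensional ℝ E₃]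
  {L₃ : Type*} [TopologicalSpace L₃] [ChartedSpace E₃ L₃] [IsManifold 𝓘(ℝ, E₃) ∞ L₃]
  [RiemannianBundle (fun x : L₃ => TangentSpace 𝓘(ℝ, E₃) x)]
  {f : L₁ × L₂ × L₃ → M} {φ₁ φ₂ : L₁ → ℝ} {S : AlmostContactMetric E M} {β : M → ℝ} {ν : ℝ}

lemma starProjection_orthogonal_eq {W : Type*} [NormedAddCommGroup W] [InnerProductSpace ℝ W]
    [FiniteDimensional ℝ W] {K : Submodule ℝ W} {a n : W} (hn : n ∈ Kᗮ) (ha : a - n ∈ K) :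
    Kᗮ.starProjection a = n :=
  Submodule.eq_starProjection_of_mem_orthogonal hn (K.le_orthogonal_orthogonal ha)

namespace IsBiWarpedProductSubmanifold
variable (hf : IsBiWarpedProductSubmanifold (E := E) (E₁ := E₁) (E₂ := E₂) (E₃ := E₃) f φ₁ φ₂)
include hf

lemma mem_tangentImage_leaf₁ {p : L₁ × L₂ × L₃} {v : TangentSpace 𝓘(ℝ, E) (f p)}
    (hv : v ∈ tangentImage 𝓘(ℝ, E) (prodModel E₁ E₂ E₃) f p)
    (h₂ : ∀ x, ⟪v, D₂ E E₁ E₂ E₃ f p x⟫_ℝ = 0) (h₃ : ∀ z, ⟪v, D₃ E E₁ E₂ E₃ f p z⟫_ℝ = 0) :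
    v ∈ tangentImage 𝓘(ℝ, E) 𝓘(ℝ, E₁) (leaf₁ f p.2.1 p.2.2) p.1 := by
  obtain ⟨u, x, z, rfl⟩ := (mem_tangentImage_iff p v).1 hv
  have hx : D₂ E E₁ E₂ E₃ f p x = 0 := by
    have h := h₂ x
    rw [inner_add_left, inner_add_left, hf.inner_D₁_D₂,
      real_inner_comm _ (D₃ E E₁ E₂ E₃ f p z), hf.inner_D₂_D₃] at h
    simp only [add_zero, zero_add] at h
    exact inner_self_eq_zero.1 h
  have hz : D₃ E E₁ E₂ E₃ f p z = 0 := by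
    have h := h₃ z
    rw [inner_add_left, inner_add_left, hf.inner_D₁_D₃, hf.inner_D₂_D₃] at h
    simp only [add_zero, zero_add] at h
    exact inner_self_eq_zero.1 h
  rw [hx, hz, add_zero, add_zero, ← mfderiv_leaf₁ hf.smooth_f p]
  exact ⟨u, rfl⟩

lemma mem_tangentImage_leaf₂ {p : L₁ × L₂ × L₃} {v : TangentSpace 𝓘(ℝ, E) (f p)}
    (hv : v ∈ tangentImage 𝓘(ℝ, E) (prodModel E₁ E₂ E₃) f p)
    (h₁ : ∀ u, ⟪v, D₁ E E₁ E₂ E₃ f p u⟫_ℝ = 0) (h₃ : ∀ z, ⟪v, D₃ E E₁ E₂ E₃ f p z⟫_ℝ = 0) :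
    v ∈ tangentImage 𝓘(ℝ, E) 𝓘(ℝ, E₂) (leaf₂ f p.1 p.2.2) p.2.1 := by
  obtain ⟨u, x, z, rfl⟩ := (mem_tangentImage_iff p v).1 hv
  have hu : D₁ E E₁ E₂ E₃ f p u = 0 := by
    have h := h₁ u
    rw [inner_add_left, inner_add_left, real_inner_comm _ (D₂ E E₁ E₂ E₃ f p x),
      real_inner_comm _ (D₃ E E₁ E₂ E₃ f p z), hf.inner_D₁_D₂, hf.inner_D₁_D₃, add_zero,
      add_zero] at h
    exact inner_self_eq_zero.1 h
  have hz : D₃ E E₁ E₂ E₃ f p z = 0 := by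
    have h := h₃ z
    rw [inner_add_left, inner_add_left, hf.inner_D₁_D₃, hf.inner_D₂_D₃] at h
    simp only [add_zero, zero_add] at h
    exact inner_self_eq_zero.1 h
  rw [hu, hz, zero_add, add_zero, ← mfderiv_leaf₂ hf.smooth_f p]
  exact ⟨x, rfl⟩

lemma mem_tangentImage_leaf₃ {p : L₁ × L₂ × L₃} {v : TangentSpace 𝓘(ℝ, E) (f p)}
    (hv : v ∈ tangentImage 𝓘(ℝ, E) (prodModel E₁ E₂ E₃) f p)
    (h₁ : ∀ u, ⟪v, D₁ E E₁ E₂ E₃ f p u⟫_ℝ = 0) (h₂ : ∀ x, ⟪v, D₂ E E₁ E₂ E₃ f p x⟫_ℝ = 0) :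
    v ∈ tangentImage 𝓘(ℝ, E) 𝓘(ℝ, E₃) (leaf₃ f p.1 p.2.1) p.2.2 := by
  obtain ⟨u, x, z, rfl⟩ := (mem_tangentImage_iff p v).1 hv
  have hu : D₁ E E₁ E₂ E₃ f p u = 0 := by
    have h := h₁ u
    rw [inner_add_left, inner_add_left, real_inner_comm _ (D₂ E E₁ E₂ E₃ f p x),
      real_inner_comm _ (D₃ E E₁ E₂ E₃ f p z), hf.inner_D₁_D₂, hf.inner_D₁_D₃, add_zero,
      add_zero] at h
    exact inner_self_eq_zero.1 h
  have hx : D₂ E E₁ E₂ E₃ f p x = 0 := by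
    have h := h₂ x
    rw [inner_add_left, inner_add_left, hf.inner_D₁_D₂,
      real_inner_comm _ (D₃ E E₁ E₂ E₃ f p z), hf.inner_D₂_D₃] at h
    simp only [add_zero, zero_add] at h
    exact inner_self_eq_zero.1 h
  rw [hu, hx, zero_add, zero_add, ← mfderiv_leaf₃ hf.smooth_f p]
  exact ⟨z, rfl⟩

lemma secondDeriv_sub_mem {p : L₁ × L₂ × L₃} (v w : TangentSpace (prodModel E₁ E₂ E₃) p) :
    secondDeriv 𝓘(ℝ, E) (prodModel E₁ E₂ E₃) f p v w -
      secondFundForm 𝓘(ℝ, E) (prodModel E₁ E₂ E₃) f p v w ∈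
        tangentImage 𝓘(ℝ, E) (prodModel E₁ E₂ E₃) f p := by
  rw [secondFundForm_eq, Submodule.starProjection_orthogonal_val, sub_sub_cancel]
  exact Submodule.starProjection_apply_mem _ _

lemma isTotallyGeodesic_leaf₁
    (hII : ∀ p u v, secondFundForm 𝓘(ℝ, E) (prodModel E₁ E₂ E₃) f p (incl₁ p u) (incl₁ p v) = 0)
    (b : L₂) (c : L₃) : IsTotallyGeodesic 𝓘(ℝ, E) 𝓘(ℝ, E₁) (leaf₁ f b c) := by
  intro a u v
  have h := hf.secondDeriv_sub_mem (p := (a, b, c)) (incl₁ (a, b, c) u) (incl₁ (a, b, c) v)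
  rw [hII, sub_zero] at h
  rw [secondFundForm_eq_zero_iff]
  have h1 := secondDeriv_leaf₁ hf.smooth_f (a, b, c) u v
  change secondDeriv 𝓘(ℝ, E) 𝓘(ℝ, E₁) (leaf₁ f b c) a u v = _ at h1
  rw [h1]
  exact hf.mem_tangentImage_leaf₁ h (hf.christoffelFirst₁₁₂ (a, b, c) u v)
    (hf.christoffelFirst₁₁₃ (a, b, c) u v)

lemma secondDeriv₂₂_sub_mem {p : L₁ × L₂ × L₃} {x y : TangentSpace 𝓘(ℝ, E₂) p.2.1}
    (hII : secondFundForm 𝓘(ℝ, E) (prodModel E₁ E₂ E₃) f p (incl₂ p x) (incl₂ p y) = 0) :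
    secondDeriv 𝓘(ℝ, E) (prodModel E₁ E₂ E₃) f p (incl₂ p x) (incl₂ p y) -
      ⟪D₂ E E₁ E₂ E₃ f p x, D₂ E E₁ E₂ E₃ f p y⟫_ℝ • D₁ E E₁ E₂ E₃ f p
        (-rieszVector (mvfderiv 𝓘(ℝ, E₁) (fun a => Real.log (φ₁ a)) p.1)) ∈
      tangentImage 𝓘(ℝ, E) 𝓘(ℝ, E₂) (leaf₂ f p.1 p.2.2) p.2.1 := by
  have h := hf.secondDeriv_sub_mem (p := p) (incl₂ p x) (incl₂ p y)
  rw [hII, sub_zero] at h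
  refine hf.mem_tangentImage_leaf₂ (Submodule.sub_mem _ h
    (Submodule.smul_mem _ _ ⟨incl₁ p _, rfl⟩)) (fun u => ?_) (fun z => ?_)
  · have h2 : ⟪_, D₁ E E₁ E₂ E₃ f p u⟫_ℝ = _ := hf.christoffelFirst₂₂₁ p x y u
    rw [inner_sub_left, h2, real_inner_smul_left, hf.inner_D₁_D₁, inner_neg_left,
      inner_rieszVector]
    ring
  · have h2 : ⟪_, D₃ E E₁ E₂ E₃ f p z⟫_ℝ = _ := hf.christoffelFirst₂₂₃ p x y z
    rw [inner_sub_left, h2, real_inner_smul_left, hf.inner_D₁_D₃]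
    ring

lemma secondDeriv₃₃_sub_mem {p : L₁ × L₂ × L₃} {h : TangentSpace 𝓘(ℝ, E) (f p)}
    (hh : h ∈ (tangentImage 𝓘(ℝ, E) (prodModel E₁ E₂ E₃) f p)ᗮ)
    {z w : TangentSpace 𝓘(ℝ, E₃) p.2.2}
    (hII : secondFundForm 𝓘(ℝ, E) (prodModel E₁ E₂ E₃) f p (incl₃ p z) (incl₃ p w) =
      ⟪D₃ E E₁ E₂ E₃ f p z, D₃ E E₁ E₂ E₃ f p w⟫_ℝ • h) :
    secondDeriv 𝓘(ℝ, E) (prodModel E₁ E₂ E₃) f p (incl₃ p z) (incl₃ p w) -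
      ⟪D₃ E E₁ E₂ E₃ f p z, D₃ E E₁ E₂ E₃ f p w⟫_ℝ • (h + D₁ E E₁ E₂ E₃ f p
        (-rieszVector (mvfderiv 𝓘(ℝ, E₁) (fun a => Real.log (φ₂ a)) p.1))) ∈
      tangentImage 𝓘(ℝ, E) 𝓘(ℝ, E₃) (leaf₃ f p.1 p.2.1) p.2.2 := by
  have hmem := hf.secondDeriv_sub_mem (p := p) (incl₃ p z) (incl₃ p w)
  rw [hII] at hmem
  obtain ⟨hh₁, hh₂, -⟩ := (mem_tangentImage_orthogonal_iff p h).1 hh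
  refine hf.mem_tangentImage_leaf₃ ?_ (fun u => ?_) (fun x => ?_)
  · rw [smul_add, ← sub_sub]
    exact Submodule.sub_mem _ hmem (Submodule.smul_mem _ _ ⟨incl₁ p _, rfl⟩)
  · have h2 : ⟪_, D₁ E E₁ E₂ E₃ f p u⟫_ℝ = _ := hf.christoffelFirst₃₃₁ p z w u
    rw [inner_sub_left, h2, real_inner_smul_left, inner_add_left, real_inner_comm _ h, hh₁,
      hf.inner_D₁_D₁, inner_neg_left, inner_rieszVector]
    ring
  · have h2 : ⟪_, D₂ E E₁ E₂ E₃ f p x⟫_ℝ = _ := hf.christoffelFirst₃₃₂ p z w x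
    rw [inner_sub_left, h2, real_inner_smul_left, inner_add_left, real_inner_comm _ h, hh₂,
      hf.inner_D₁_D₂]
    ring

/-- The leaves of the second factor are totally umbilical, with mean curvature vector
`- grad (ln φ₁)`. -/
lemma isTotallyUmbilical_leaf₂
    (hII : ∀ p x y, secondFundForm 𝓘(ℝ, E) (prodModel E₁ E₂ E₃) f p (incl₂ p x) (incl₂ p y) = 0)
    (a : L₁) (c : L₃) : IsTotallyUmbilical 𝓘(ℝ, E) 𝓘(ℝ, E₂) (leaf₂ f a c) := by
  refine isTotallyUmbilical_of_secondFundForm_eq (fun b => D₁ E E₁ E₂ E₃ f (a, b, c)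
    (-rieszVector (mvfderiv 𝓘(ℝ, E₁) (fun a => Real.log (φ₁ a)) a))) fun b x y => ?_
  have hm : mfderiv 𝓘(ℝ, E₂) 𝓘(ℝ, E) (leaf₂ f a c) b = D₂ E E₁ E₂ E₃ f (a, b, c) :=
    mfderiv_leaf₂ hf.smooth_f (a, b, c)
  have h1 : secondDeriv 𝓘(ℝ, E) 𝓘(ℝ, E₂) (leaf₂ f a c) b x y = _ :=
    secondDeriv_leaf₂ hf.smooth_f (a, b, c) x y
  rw [secondFundForm_eq, h1, hm]
  refine starProjection_orthogonal_eq (W := TangentSpace 𝓘(ℝ, E) (f (a, b, c))) ?_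
    (hf.secondDeriv₂₂_sub_mem (p := (a, b, c)) (hII (a, b, c) x y))
  refine Submodule.smul_mem _ _ ((Submodule.mem_orthogonal' _ _).2 ?_)
  rintro _ ⟨y', rfl⟩
  rw [hm]
  exact hf.inner_D₁_D₂ (a, b, c) _ y'

/-- The leaves of the third factor are totally umbilical, with mean curvature vector
`h - grad (ln φ₂)`. -/
lemma isTotallyUmbilical_leaf₃ (h : Π p, TangentSpace 𝓘(ℝ, E) (f p))
    (hh : ∀ p, h p ∈ (tangentImage 𝓘(ℝ, E) (prodModel E₁ E₂ E₃) f p)ᗮ)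
    (hII : ∀ p z w, secondFundForm 𝓘(ℝ, E) (prodModel E₁ E₂ E₃) f p (incl₃ p z) (incl₃ p w) =
      ⟪D₃ E E₁ E₂ E₃ f p z, D₃ E E₁ E₂ E₃ f p w⟫_ℝ • h p)
    (a : L₁) (b : L₂) : IsTotallyUmbilical 𝓘(ℝ, E) 𝓘(ℝ, E₃) (leaf₃ f a b) := by
  refine isTotallyUmbilical_of_secondFundForm_eq (fun c => h (a, b, c) + D₁ E E₁ E₂ E₃ f (a, b, c)
    (-rieszVector (mvfderiv 𝓘(ℝ, E₁) (fun a => Real.log (φ₂ a)) a))) fun c z w => ?_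
  have hm : mfderiv 𝓘(ℝ, E₃) 𝓘(ℝ, E) (leaf₃ f a b) c = D₃ E E₁ E₂ E₃ f (a, b, c) :=
    mfderiv_leaf₃ hf.smooth_f (a, b, c)
  have h1 : secondDeriv 𝓘(ℝ, E) 𝓘(ℝ, E₃) (leaf₃ f a b) c z w = _ :=
    secondDeriv_leaf₃ hf.smooth_f (a, b, c) z w
  obtain ⟨-, -, hh₃⟩ := (mem_tangentImage_orthogonal_iff (a, b, c) (h (a, b, c))).1 (hh (a, b, c))
  rw [secondFundForm_eq, h1, hm]
  refine starProjection_orthogonal_eq (W := TangentSpace 𝓘(ℝ, E) (f (a, b, c))) ?_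
    (hf.secondDeriv₃₃_sub_mem (p := (a, b, c)) (hh _) (hII (a, b, c) z w))
  refine Submodule.smul_mem _ _ (Submodule.add_mem _ ((Submodule.mem_orthogonal _ _).2 ?_)
    ((Submodule.mem_orthogonal' _ _).2 ?_))
  · rintro _ ⟨w', rfl⟩
    rw [hm]
    exact hh₃ w'
  · rintro _ ⟨w', rfl⟩
    rw [hm]
    exact hf.inner_D₁_D₃ (a, b, c) _ w'

end IsBiWarpedProductSubmanifold
end Leaves

end BiWarped

end

theorem theorem4p1
    -- the ambient Riemannian manifold
    {E : Type*} [NormedAddCommGroup E] [NormedSpace ℝ E] [FiniteDimensional ℝ E]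
    {M : Type*} [TopologicalSpace M] [ChartedSpace E M] [IsManifold 𝓘(ℝ, E) ∞ M]
    [RiemannianBundle (fun x : M => TangentSpace 𝓘(ℝ, E) x)]
    [IsContMDiffRiemannianBundle 𝓘(ℝ, E) ∞ E (fun x : M => TangentSpace 𝓘(ℝ, E) x)]
    -- the Riemannian manifold `L_ν`
    {Eν : Type*} [NormedAddCommGroup Eν] [NormedSpace ℝ Eν] [FiniteDimensional ℝ Eν]
    {Lν : Type*} [TopologicalSpace Lν] [ChartedSpace Eν Lν] [IsManifold 𝓘(ℝ, Eν) ∞ Lν]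
    [RiemannianBundle (fun x : Lν => TangentSpace 𝓘(ℝ, Eν) x)]
    [IsContMDiffRiemannianBundle 𝓘(ℝ, Eν) ∞ Eν (fun x : Lν => TangentSpace 𝓘(ℝ, Eν) x)]
    -- the Riemannian manifold `L_T`
    {ET : Type*} [NormedAddCommGroup ET] [NormedSpace ℝ ET] [FiniteDimensional ℝ ET]
    {LT : Type*} [TopologicalSpace LT] [ChartedSpace ET LT] [IsManifold 𝓘(ℝ, ET) ∞ LT]
    [RiemannianBundle (fun x : LT => TangentSpace 𝓘(ℝ, ET) x)]
    [IsContMDiffRiemannianBundle 𝓘(ℝ, ET) ∞ ET (fun x : LT => TangentSpace 𝓘(ℝ, ET) x)]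
    -- the Riemannian manifold `L_⊥`
    {Ep : Type*} [NormedAddCommGroup Ep] [NormedSpace ℝ Ep] [FiniteDimensional ℝ Ep]
    {Lp : Type*} [TopologicalSpace Lp] [ChartedSpace Ep Lp] [IsManifold 𝓘(ℝ, Ep) ∞ Lp]
    [RiemannianBundle (fun x : Lp => TangentSpace 𝓘(ℝ, Ep) x)]
    [IsContMDiffRiemannianBundle 𝓘(ℝ, Ep) ∞ Ep (fun x : Lp => TangentSpace 𝓘(ℝ, Ep) x)]
    -- the locally conformal almost cosymplectic structure
    (S : AlmostContactMetric E M) (β : M → ℝ)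
    (hS : S.IsLocallyConformalAlmostCosymplectic β)
    -- the bi-warped product submanifold `L = L_ν ×_{φ₁} L_T ×_{φ₂} L_⊥`
    (φ₁ φ₂ : Lν → ℝ) (f : Lν × LT × Lp → M)
    (hf : IsBiWarpedProductSubmanifold (E := E) (E₁ := Eν) (E₂ := ET) (E₃ := Ep) f φ₁ φ₂)
    (ν : ℝ)
    (hν : ∀ b c, S.IsProperSlant Eν (leaf₁ f b c) ν)
    (hT : ∀ a c, S.IsInvariant ET (leaf₂ f a c))
    (hp : ∀ a b, S.IsAntiInvariant Ep (leaf₃ f a b))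
    (hmixed : IsMixedTotallyGeodesic (E₁ := Eν) (E₂ := ET) (E₃ := Ep) S f) :
    (∀ p : Lν × LT × Lp,
      (Module.finrank ℝ ET : ℝ) * (1 + Real.cot ν ^ 2) * (1 + Real.cos ν ^ 2) *
            (gradNormSq 𝓘(ℝ, Eν) (fun a => Real.log (φ₁ a)) p.1 - β (f p) ^ 2)
          + (Module.finrank ℝ Ep : ℝ) * ((1 / Real.sin ν) ^ 2 - 1) *
            (gradNormSq 𝓘(ℝ, Eν) (fun a => Real.log (φ₂ a)) p.1 - β (f p) ^ 2)
        ≤ secondFundFormNormSq 𝓘(ℝ, E) (prodModel Eν ET Ep) f p) ∧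
    ((∀ p : Lν × LT × Lp,
      secondFundFormNormSq 𝓘(ℝ, E) (prodModel Eν ET Ep) f p =
        (Module.finrank ℝ ET : ℝ) * (1 + Real.cot ν ^ 2) * (1 + Real.cos ν ^ 2) *
              (gradNormSq 𝓘(ℝ, Eν) (fun a => Real.log (φ₁ a)) p.1 - β (f p) ^ 2)
            + (Module.finrank ℝ Ep : ℝ) * ((1 / Real.sin ν) ^ 2 - 1) *
              (gradNormSq 𝓘(ℝ, Eν) (fun a => Real.log (φ₂ a)) p.1 - β (f p) ^ 2)) →
      (∀ b c, IsTotallyGeodesic 𝓘(ℝ, E) 𝓘(ℝ, Eν) (leaf₁ f b c)) ∧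
      (∀ a c, IsTotallyUmbilical 𝓘(ℝ, E) 𝓘(ℝ, ET) (leaf₂ f a c)) ∧
      (∀ a b, IsTotallyUmbilical 𝓘(ℝ, E) 𝓘(ℝ, Ep) (leaf₃ f a b)) ∧
      IsSlantTotallyGeodesic (E₁ := Eν) (E₂ := ET) (E₃ := Ep) S f) := by
  have hξ : ∀ b c, S.IsTangentToReeb Eν (leaf₁ f b c) := fun b c => (hν b c).1.1
  have hsl : ∀ b c, S.IsSlant Eν (leaf₁ f b c) ν := fun b c => (hν b c).1
  -- the normal vector `h p` of the third factor; if `dim L_⊥ = 0`, it is `0`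
  have hex : ∀ p : Lν × LT × Lp,
      ∃ h ∈ (tangentImage 𝓘(ℝ, E) (prodModel Eν ET Ep) f p)ᗮ,
        (finrank ℝ Ep : ℝ) * ⟪h, h⟫_ℝ = (finrank ℝ Ep : ℝ) * ((1 / Real.sin ν) ^ 2 - 1) *
          (gradNormSq 𝓘(ℝ, Eν) (fun a => Real.log (φ₂ a)) p.1 - β (f p) ^ 2) ∧
        ∀ z w, ⟪secondDeriv 𝓘(ℝ, E) (prodModel Eν ET Ep) f p (incl₃ p z) (incl₃ p w), h⟫_ℝ =
          ⟪D₃ E Eν ET Ep f p z, D₃ E Eν ET Ep f p w⟫_ℝ * ⟪h, h⟫_ℝ := by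
    intro p
    rcases Nat.eq_zero_or_pos (finrank ℝ Ep) with h0 | hpos
    · refine ⟨0, Submodule.zero_mem _, ?_, fun z w => ?_⟩
      · rw [h0]; simp
      · rw [inner_zero_right, inner_zero_right, mul_zero]
    · obtain ⟨h, hh, h1, h2⟩ := hf.exists_normal_of_third_factor hS hξ hmixed hsl hT hpos
        (hf.cos_ne_zero_of_isProperSlant hsl (hν p.2.1 p.2.2).2.2)
        (hf.sin_ne_zero_of_isProperSlant hsl (hν p.2.1 p.2.2).2.1) p
      exact ⟨h, hh, by rw [h1, mul_assoc], h2⟩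
  choose h hh hnorm hA using hex
  have hfirst : ∀ p : Lν × LT × Lp,
      (Module.finrank ℝ ET : ℝ) * (1 + Real.cot ν ^ 2) * (1 + Real.cos ν ^ 2) *
        (gradNormSq 𝓘(ℝ, Eν) (fun a => Real.log (φ₁ a)) p.1 - β (f p) ^ 2) = 0 := by
    intro p
    rcases Nat.eq_zero_or_pos (finrank ℝ ET) with h0 | hpos
    · rw [h0]; simp
    · rw [hf.gradNormSq_log_φ₁ hS hξ hT hpos p, sub_self, mul_zero]
  refine ⟨fun p => ?_, fun heq => ?_⟩
  · rw [hfirst, zero_add, ← hnorm]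
    exact hf.finrank_mul_le_secondFundFormNormSq (hh p) (hA p)
  · have hII : ∀ p v w, secondFundForm 𝓘(ℝ, E) (prodModel Eν ET Ep) f p v w =
        ⟪thirdPart E Eν ET Ep f p v, thirdPart E Eν ET Ep f p w⟫_ℝ • h p := fun p =>
      hf.secondFundForm_eq_of_normSq_eq (hh p) (hA p) (by rw [heq, hfirst, zero_add, hnorm])
    have hII₁ : ∀ p u w, secondFundForm 𝓘(ℝ, E) (prodModel Eν ET Ep) f p (incl₁ p u) w = 0 :=
      fun p u w => by rw [hII, thirdPart_incl₁, inner_zero_left, zero_smul]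
    refine ⟨hf.isTotallyGeodesic_leaf₁ fun p u v => hII₁ p u _,
      hf.isTotallyUmbilical_leaf₂ fun p x y => ?_,
      hf.isTotallyUmbilical_leaf₃ h hh fun p z w => ?_, ?_⟩
    · rw [hII, thirdPart_incl₂, inner_zero_left, zero_smul]
    · rw [hII, thirdPart_incl₃, thirdPart_incl₃]
    · rintro p _ ⟨⟨u, rfl⟩, -⟩ V -
      exact hII₁ p u V
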